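/- Identify $S^1$ with $\mathbb R/2\pi\mathbb Z$, let $C^n(S^1;E)$ be the Banach space of $n$ times continuously differentiable functions $S^1\to E$ with norm $\|f\|_n=\max_{0\le j\le n}\sup_\varphi\|f^{(j)}(\varphi)\|$, and write $C^n=C^n(S^1;\mathbb R^2)$. For a closed curve $\gamma\colon S^1\to\mathbb R^2$ let $\operatorname{int}(\gamma)$ be the union of the bounded connected components of $\mathbb R^2\setminus\gamma(S^1)$ (the usual interior if $\gamma$ is a Jordan curve), and for $r>0$ define the circular integral invariant $$I_r[\gamma](\varphi)=\operatorname{area}\bigl(B_r(\gamma(\varphi))\cap\operatorname{int}(\gamma)\bigr),\qquad \varphi\in S^1 .$$ For $n\ge1$ let $\mathcal C_n\subset C^n$ be the submanifold of all injective curves $\gamma\in C^n$ for which there is $c_\gamma>0$ with $\|\dot\gamma(\varphi)\|=c_\gamma$ for all $\varphi$, $\gamma(0)=(1,0)$ and $\dot\gamma(0)=(0,c_\gamma)$. Its tangent space $T_\gamma\mathcal C_n$ consists of all $\sigma\in C^n$ such that $\langle\dot\sigma(\varphi),\dot\gamma(\varphi)\rangle$ does not depend on $\varphi$, $\sigma(0)=0$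 and $\langle\dot\sigma(0),\gamma(0)\rangle=0$. Let $\gamma_R(\varphi)=(1-R+R\cos\varphi,\;R\sin\varphi)$ be the circle of radius $R$ in $\mathcal C_n$. Theorem. Let $k\ge1$, $r>0$ and $R>r/2$. (1) For every $\ell\ge1$ there is an open neighbourhood $\mathcal V\subset C^{k+\ell+1}$ of $\gamma_R$ such that $I_r[\gamma]\in C^k(S^1;\mathbb R)$ for all $\gamma\in\mathcal V$, the map $I_r\colon\mathcal V\to C^k(S^1;\mathbb R)$ is $\ell$ times continuously Fréchet differentiable, and for every $\gamma$ in the neighbourhood $\mathcal U=\mathcal V\cap\mathcal C_{k+\ell+1}$ of $\gamma_R$ in $\mathcal C_{k+\ell+1}$ the tangential map $I_r'[\gamma]\colon T_\gamma\mathcal C_{k+\ell+1}\to C^k(S^1;\mathbb R)$ is injective. (2) There are an open neighbourhood $\mathcal W\subset C^{k+6}$ of $\gamma_R$ and a constant $c>0$ such that $I_r[\gamma]\in C^k(S^1;\mathbb R)$ for all $\gamma\in\mathcal W$ and, for all $\gamma,\tilde\gamma$ in $\tilde{\mathcal U}=\mathcal W\cap\mathcal C_{k+6}$, $$\|I_r[\gamma]-I_r[\tilde\gamma]\|_k\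 \ge\ c\,\|\gamma-\tilde\gamma\|_k .$$ In particular, $I_r$ is injective on $\tilde{\mathcal U}$. -/

import Mathlib

/-- The Euclidean plane. -/
abbrev Plane : Type := EuclideanSpace ℝ (Fin 2)

section CkSpaces

variable {E : Type*} [NormedAddCommGroup E] [NormedSpace ℝ E]

/-- The `2π`-periodic `C^n` functions `ℝ → E`. -/
def ckSubmodule (n : ℕ) (E : Type*) [NormedAddCommGroup E] [NormedSpace ℝ E] :
    Submodule ℝ (ℝ → E) where
  carrier := {f | ContDiff ℝ n f ∧ Function.Periodic f (2 * Real.pi)}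
  zero_mem' := ⟨contDiff_const, fun _ => rfl⟩
  add_mem' := fun hf hg => ⟨hf.1.add hg.1, hf.2.add hg.2⟩
  smul_mem' := fun c _ hf => ⟨hf.1.const_smul c, hf.2.smul c⟩

/-- The space `C^n(S¹; E)`, where `S¹ = ℝ / 2πℤ` and functions on `S¹` are `2π`-periodic functions
on `ℝ`. It carries the `C^n` norm defined below. -/
def Ck (n : ℕ) (E : Type*) [NormedAddCommGroup E] [NormedSpace ℝ E] : Type _ :=
  ↥(ckSubmodule n E)

namespace Ck

noncomputable instance (n : ℕ) : AddCommGroup (Ck n E) :=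
  inferInstanceAs (AddCommGroup ↥(ckSubmodule n E))

noncomputable instance (n : ℕ) : Module ℝ (Ck n E) :=
  inferInstanceAs (Module ℝ ↥(ckSubmodule n E))

instance (n : ℕ) : CoeFun (Ck n E) (fun _ => ℝ → E) := ⟨fun f => f.1⟩

theorem contDiff {n : ℕ} (f : Ck n E) : ContDiff ℝ n f := f.2.1

theorem periodic {n : ℕ} (f : Ck n E) : Function.Periodic f (2 * Real.pi) := f.2.2

theorem ext {n : ℕ} {f g : Ck n E} (h : ∀ x, f x = g x) : f = g := Subtype.ext (funext h)

theorem coe_add {n : ℕ} (f g : Ck n E) : (f + g : Ck n E).1 = f.1 + g.1 := rfl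

theorem coe_smul {n : ℕ} (c : ℝ) (f : Ck n E) : (c • f : Ck n E).1 = c • f.1 := rfl

theorem periodic_iteratedDeriv {n : ℕ} (f : Ck n E) (j : ℕ) :
    Function.Periodic (iteratedDeriv j f) (2 * Real.pi) := by
  intro x
  have h := iteratedDeriv_comp_add_const j f.1 (2 * Real.pi)
  rw [← congrFun h x]
  congr 1
  exact funext f.periodic

/-- The `j`-th derivative, `j ≤ n`, of a function in `C^n(S¹; E)`, as a bounded continuous
function. -/
noncomputable def der {n : ℕ} (f : Ck n E) (j : Fin (n + 1)) : BoundedContinuousFunction ℝ E :=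
  have hc : Continuous (iteratedDeriv j f) :=
    f.contDiff.continuous_iteratedDeriv j (by exact_mod_cast Nat.lt_succ_iff.mp j.2)
  BoundedContinuousFunction.mkOfBound ⟨iteratedDeriv j f, hc⟩
    (Classical.choose (Metric.isBounded_range_iff.mp
      ((f.periodic_iteratedDeriv j).isBounded_of_continuous Real.two_pi_pos.ne' hc)))
    (Classical.choose_spec (Metric.isBounded_range_iff.mp
      ((f.periodic_iteratedDeriv j).isBounded_of_continuous Real.two_pi_pos.ne' hc)))

theorem der_apply {n : ℕ} (f : Ck n E) (j : Fin (n + 1)) (x : ℝ) :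
    f.der j x = iteratedDeriv j f x := rfl

/-- All derivatives up to order `n`, as a linear map. -/
noncomputable def jet (n : ℕ) (E : Type*) [NormedAddCommGroup E] [NormedSpace ℝ E] :
    Ck n E →ₗ[ℝ] (Fin (n + 1) → BoundedContinuousFunction ℝ E) where
  toFun f j := f.der j
  map_add' f g := by
    funext j
    ext x
    have hj : ((j : ℕ) : WithTop ℕ∞) ≤ n := by exact_mod_cast Nat.lt_succ_iff.mp j.2
    simp only [Pi.add_apply, BoundedContinuousFunction.add_apply, der_apply, coe_add]
    exact iteratedDeriv_add (f.contDiff.contDiffAt.of_le hj) (g.contDiff.contDiffAt.of_le hj)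
  map_smul' c f := by
    funext j
    ext x
    have hj : ((j : ℕ) : WithTop ℕ∞) ≤ n := by exact_mod_cast Nat.lt_succ_iff.mp j.2
    simp only [Pi.smul_apply, BoundedContinuousFunction.smul_apply, der_apply, coe_smul,
      RingHom.id_apply]
    exact iteratedDeriv_const_smul (f.contDiff.contDiffAt.of_le hj) c

theorem jet_injective (n : ℕ) : Function.Injective (jet n E) := by
  intro f g h
  refine ext fun x => ?_
  have := DFunLike.congr_fun (congrFun h 0) x
  simpa [jet, der_apply] using this

/-- The `C^n` norm `‖f‖ = max_{j ≤ n} sup_x ‖f^{(j)}(x)‖`. -/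
noncomputable instance (n : ℕ) : NormedAddCommGroup (Ck n E) :=
  NormedAddCommGroup.induced (Ck n E) (Fin (n + 1) → BoundedContinuousFunction ℝ E)
    (jet n E) (jet_injective n)

noncomputable instance (n : ℕ) : NormedSpace ℝ (Ck n E) :=
  NormedSpace.induced ℝ (Ck n E) (Fin (n + 1) → BoundedContinuousFunction ℝ E) (jet n E)

/-- The inclusion `C^n(S¹; E) ⊆ C^k(S¹; E)` for `k ≤ n`. -/
def incl {k n : ℕ} (h : k ≤ n) (f : Ck n E) : Ck k E :=
  ⟨f.1, f.contDiff.of_le (by exact_mod_cast h), f.periodic⟩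

end Ck

end CkSpaces

/-- The interior of a closed curve: the points off the curve whose connected component in the
complement of the curve is bounded. -/
def curveInterior (γ : ℝ → Plane) : Set Plane :=
  {x | x ∉ Set.range γ ∧ Bornology.IsBounded (connectedComponentIn (Set.range γ)ᶜ x)}

/-- The circular integral invariant
`I_r[γ](φ) = area (B_r(γ(φ)) ∩ int γ)`. -/
noncomputable def circularInvariant (r : ℝ) (γ : ℝ → Plane) (φ : ℝ) : ℝ :=
  (MeasureTheory.volume (Metric.ball (γ φ) r ∩ curveInterior γ)).toReal

/-- The space of normalized embedded `C^n` curves of constant speed. -/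
def normalizedCurves (n : ℕ) : Set (Ck n Plane) :=
  {γ | (∃ c : ℝ, 0 < c ∧ (∀ φ, ‖deriv γ φ‖ = c) ∧ γ 0 = !₂[1, 0] ∧ deriv γ 0 = !₂[0, c]) ∧
    Set.InjOn γ (Set.Ico 0 (2 * Real.pi))}

/-- The tangent space at `γ` of the submanifold of normalized curves. -/
def curveTangentSpace {n : ℕ} (γ : Ck (n + 1) Plane) : Submodule ℝ (Ck (n + 1) Plane) where
  carrier := {σ | (∃ c : ℝ, ∀ φ, inner ℝ (deriv σ φ) (deriv γ φ) = c) ∧ σ 0 = 0 ∧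
    inner ℝ (deriv σ 0) (γ 0) = 0}
  zero_mem' := by
    have h : (0 : Ck (n + 1) Plane).1 = fun _ => 0 := rfl
    simp [h]
  add_mem' := by
    rintro σ τ ⟨⟨c, hc⟩, h0, h1⟩ ⟨⟨d, hd⟩, k0, k1⟩
    have key : ∀ φ, deriv (σ + τ : Ck (n + 1) Plane) φ = deriv σ φ + deriv τ φ := fun φ =>
      deriv_add (σ.contDiff.differentiable (by simp) φ) (τ.contDiff.differentiable (by simp) φ)
    refine ⟨⟨c + d, fun φ => ?_⟩, ?_, ?_⟩
    · rw [key, inner_add_left, hc, hd]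
    · simp [Ck.coe_add, h0, k0]
    · rw [key, inner_add_left, h1, k1, add_zero]
  smul_mem' := by
    rintro a σ ⟨⟨c, hc⟩, h0, h1⟩
    have key : ∀ φ, deriv (a • σ : Ck (n + 1) Plane) φ = a • deriv σ φ := fun φ =>
      deriv_const_smul a (σ.contDiff.differentiable (by simp) φ)
    refine ⟨⟨a * c, fun φ => ?_⟩, ?_, ?_⟩
    · rw [key, real_inner_smul_left, hc]
    · simp [Ck.coe_smul, h0]
    · rw [key, real_inner_smul_left, h1, mul_zero]

/-- The circle of radius `R`, parametrized with constant speed and normalized to start at `(1, 0)`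
in direction `(0, 1)`; its centre is `(1 - R, 0)`. -/
noncomputable def circleCurve (n : ℕ) (R : ℝ) : Ck n Plane :=
  ⟨fun φ => !₂[1 - R + R * Real.cos φ, R * Real.sin φ], by
    refine ⟨?_, fun φ => by simp⟩
    rw [contDiff_euclidean]
    intro i
    fin_cases i
    · exact contDiff_const.add (contDiff_const.mul Real.contDiff_cos)
    · exact contDiff_const.mul Real.contDiff_sin⟩

theorem circleCurve_hasDerivAt (n : ℕ) (R φ : ℝ) :
    HasDerivAt (circleCurve n R) !₂[-(R * Real.sin φ), R * Real.cos φ] φ := by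
  refine (hasStrictFDerivAt_euclidean.2 fun i => ?_).hasFDerivAt
  fin_cases i
  · refine (((Real.hasStrictDerivAt_cos φ).const_mul R).const_add
      (1 - R)).hasStrictFDerivAt.congr_fderiv ?_
    ext
    simp
  · refine ((Real.hasStrictDerivAt_sin φ).const_mul R).hasStrictFDerivAt.congr_fderiv ?_
    ext
    simp

theorem circleCurve_mem (n : ℕ) {R : ℝ} (hR : 0 < R) : circleCurve n R ∈ normalizedCurves n := by
  have hd := fun φ => (circleCurve_hasDerivAt n R φ).deriv
  refine ⟨⟨R, hR, fun φ => ?_, ?_, ?_⟩, fun x hx y hy hxy => ?_⟩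
  · rw [hd, EuclideanSpace.norm_eq, Fin.sum_univ_two]
    simp only [Real.norm_eq_abs, sq_abs]
    rw [Real.sqrt_eq_iff_mul_self_eq (by positivity) hR.le]
    simp
    linear_combination (R ^ 2) * Real.sin_sq_add_cos_sq φ
  · simp [circleCurve]
  · rw [hd]
    simp
  · have h0 := congrArg (fun v : Plane => v 0) hxy
    have h1 := congrArg (fun v : Plane => v 1) hxy
    simp [circleCurve, hR.ne'] at h0 h1
    have h := Real.Angle.cos_sin_inj h0 h1
    rw [Real.Angle.angle_eq_iff_two_pi_dvd_sub] at h
    obtain ⟨m, hm⟩ := h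
    have hp := Real.two_pi_pos
    have h2 : (m : ℝ) < 1 := by
      by_contra hc
      nlinarith [hx.1, hx.2, hy.1, hy.2, not_lt.mp hc]
    have h3 : (-1 : ℝ) < m := by
      by_contra hc
      nlinarith [hx.1, hx.2, hy.1, hy.2, not_lt.mp hc]
    have h4 : m = 0 := by
      have : m < 1 := by exact_mod_cast h2
      have : -1 < m := by exact_mod_cast h3
      omega
    rw [h4] at hm
    simp at hm
    linarith

/-- Point evaluation of the `j`-th derivative is a continuous linear map on `C^n(S¹; E)`. -/
noncomputable def Ck.evalDer {E : Type*} [NormedAddCommGroup E] [NormedSpace ℝ E] {n : ℕ}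
    (j : Fin (n + 1)) (x : ℝ) : Ck n E →L[ℝ] E :=
  LinearMap.mkContinuous
    { toFun := fun f => iteratedDeriv j f x
      map_add' := fun f g => DFunLike.congr_fun (congrFun ((Ck.jet n E).map_add f g) j) x
      map_smul' := fun c f => DFunLike.congr_fun (congrFun ((Ck.jet n E).map_smul c f) j) x } 1
    fun f => by
      rw [one_mul]
      exact ((Ck.jet n E f j).norm_coe_le_norm x).trans (norm_le_pi_norm (Ck.jet n E f) j)

/-- The velocity of every differentiable path of normalized curves lies in the tangent space. -/
theorem mem_curveTangentSpace_of_hasDerivAt {n : ℕ} {c : ℝ → Ck (n + 1) Plane}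
    {σ : Ck (n + 1) Plane} (hc : ∀ t, c t ∈ normalizedCurves (n + 1)) (hσ : HasDerivAt c σ 0) :
    σ ∈ curveTangentSpace (c 0) := by
  have e0 : ∀ x, HasDerivAt (fun t => (c t) x) (σ x) 0 := fun x => by
    have := (Ck.evalDer (E := Plane) (n := n + 1) 0 x).hasFDerivAt.comp_hasDerivAt 0 hσ
    simpa [Ck.evalDer, Function.comp_def] using this
  have e1 : ∀ x, HasDerivAt (fun t => deriv (c t) x) (deriv σ x) 0 := fun x => by
    have := (Ck.evalDer (E := Plane) (n := n + 1) 1 x).hasFDerivAt.comp_hasDerivAt 0 hσ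
    simpa [Ck.evalDer, Function.comp_def] using this
  refine ⟨⟨inner ℝ (deriv σ 0) (deriv (c 0) 0), fun φ => ?_⟩, ?_, ?_⟩
  · have a := (e1 φ).inner ℝ (e1 φ)
    have b := (e1 0).inner ℝ (e1 0)
    have hab : (fun t => inner ℝ (deriv (c t) φ) (deriv (c t) φ)) =
        fun t => inner ℝ (deriv (c t) 0) (deriv (c t) 0) := by
      funext t
      obtain ⟨⟨s, -, hs, -⟩, -⟩ := hc t
      rw [real_inner_self_eq_norm_sq, real_inner_self_eq_norm_sq, hs, hs]
    rw [hab] at a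
    have := a.unique b
    rw [real_inner_comm (deriv σ φ), real_inner_comm (deriv σ 0)] at this
    linarith
  · have h : (fun t => (c t) 0) = fun _ => !₂[1, 0] := by
      funext t
      obtain ⟨⟨s, -, -, hs, -⟩, -⟩ := hc t
      exact hs
    have := e0 0
    rw [h] at this
    exact this.unique (hasDerivAt_const _ _)
  · obtain ⟨⟨s, -, -, hs, -⟩, -⟩ := hc 0
    have h : (fun t => inner ℝ (deriv (c t) 0) (!₂[1, 0] : Plane)) = fun _ => (0 : ℝ) := by
      funext t
      obtain ⟨⟨s, -, -, -, hs⟩, -⟩ := hc t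
      simp [hs, PiLp.inner_apply]
    have a := (e1 0).inner ℝ (hasDerivAt_const (0 : ℝ) (!₂[1, 0] : Plane))
    rw [h] at a
    have := a.unique (hasDerivAt_const _ _)
    rw [hs]
    simpa using this

open Set Filter Topology MeasureTheory

namespace Ck

variable {E F : Type*} [NormedAddCommGroup E] [NormedSpace ℝ E] [NormedAddCommGroup F]
  [NormedSpace ℝ F] {n : ℕ}

theorem norm_le_iff {f : Ck n E} {M : ℝ} (hM : 0 ≤ M) :
    ‖f‖ ≤ M ↔ ∀ j ≤ n, ∀ x, ‖iteratedDeriv j f x‖ ≤ M := by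
  change ‖jet n E f‖ ≤ M ↔ _
  rw [pi_norm_le_iff_of_nonneg hM]
  constructor
  · intro h j hj x
    exact ((jet n E f ⟨j, Nat.lt_succ_of_le hj⟩).norm_coe_le_norm x).trans (h _)
  · intro h j
    rw [BoundedContinuousFunction.norm_le hM]
    intro x
    exact h j (Nat.lt_succ_iff.mp j.2) x

theorem norm_iteratedDeriv_le (f : Ck n E) {j : ℕ} (hj : j ≤ n) (x : ℝ) :
    ‖iteratedDeriv j f x‖ ≤ ‖f‖ :=
  (norm_le_iff (norm_nonneg f)).1 le_rfl j hj x

theorem norm_apply_le (f : Ck n E) (x : ℝ) : ‖f x‖ ≤ ‖f‖ := by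
  simpa using f.norm_iteratedDeriv_le (Nat.zero_le n) x

theorem norm_deriv_le (f : Ck (n + 1) E) (x : ℝ) : ‖deriv f x‖ ≤ ‖f‖ := by
  simpa using f.norm_iteratedDeriv_le (Nat.le_add_left 1 n) x

theorem zero_apply (x : ℝ) : (0 : Ck n E) x = 0 := rfl

theorem sub_apply (f g : Ck n E) (x : ℝ) : (f - g : Ck n E) x = f x - g x := rfl

theorem add_apply (f g : Ck n E) (x : ℝ) : (f + g : Ck n E) x = f x + g x := rfl

theorem smul_apply (c : ℝ) (f : Ck n E) (x : ℝ) : (c • f : Ck n E) x = c • f x := rfl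

theorem iteratedDeriv_sub_apply (f g : Ck n E) {j : ℕ} (hj : j ≤ n) (x : ℝ) :
    iteratedDeriv j (f - g : Ck n E) x = iteratedDeriv j f x - iteratedDeriv j g x := by
  have hj' : (j : WithTop ℕ∞) ≤ n := by exact_mod_cast hj
  exact iteratedDeriv_sub (f.contDiff.contDiffAt.of_le hj') (g.contDiff.contDiffAt.of_le hj')

theorem differentiable (f : Ck (n + 1) E) : Differentiable ℝ f.1 :=
  f.contDiff.differentiable (by simp)

theorem periodic_deriv (f : Ck n E) : Function.Periodic (deriv f) (2 * Real.pi) := by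
  simpa using f.periodic_iteratedDeriv 1

/-- Differentiation `C^{n+1}(S¹; E) → C^n(S¹; E)`. -/
noncomputable def derivL (n : ℕ) (E : Type*) [NormedAddCommGroup E] [NormedSpace ℝ E] :
    Ck (n + 1) E →L[ℝ] Ck n E :=
  LinearMap.mkContinuous
    { toFun := fun f => ⟨deriv f, (contDiff_succ_iff_deriv.1
        (by exact_mod_cast f.contDiff)).2.2, f.periodic_deriv⟩
      map_add' := fun f g => ext fun x => deriv_add (f.differentiable x) (g.differentiable x)
      map_smul' := fun c f => ext fun x => deriv_const_smul c (f.differentiable x) } 1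
    fun f => by
      rw [one_mul, norm_le_iff (norm_nonneg f)]
      intro j hj x
      have := f.norm_iteratedDeriv_le (Nat.succ_le_succ hj) x
      rwa [iteratedDeriv_succ'] at this

theorem derivL_apply (f : Ck (n + 1) E) (x : ℝ) : derivL n E f x = deriv f x := rfl

/-- The inclusion `C^n(S¹; E) ⊆ C^k(S¹; E)`, as a continuous linear map. -/
noncomputable def inclL {k n : ℕ} (h : k ≤ n) (E : Type*) [NormedAddCommGroup E]
    [NormedSpace ℝ E] : Ck n E →L[ℝ] Ck k E :=
  LinearMap.mkContinuous
    { toFun := incl h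
      map_add' := fun _ _ => rfl
      map_smul' := fun _ _ => rfl } 1
    fun f => by
      rw [one_mul, norm_le_iff (norm_nonneg f)]
      intro j hj x
      exact f.norm_iteratedDeriv_le (hj.trans h) x

/-- Postcomposition with a continuous linear map. -/
noncomputable def map (L : E →L[ℝ] F) (f : Ck n E) : Ck n F :=
  ⟨fun x => L (f x), L.contDiff.comp f.contDiff, fun x => by simp [f.periodic x]⟩

theorem iteratedDeriv_map (L : E →L[ℝ] F) (f : Ck n E) {j : ℕ} (hj : j ≤ n) (x : ℝ) :
    iteratedDeriv j (map L f) x = L (iteratedDeriv j f x) := by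
  have hj' : (j : WithTop ℕ∞) ≤ n := by exact_mod_cast hj
  have := L.iteratedFDeriv_comp_left (f.contDiff.contDiffAt (x := x)) hj'
  simp only [iteratedDeriv_eq_iteratedFDeriv]
  change iteratedFDeriv ℝ j (L ∘ f.1) x _ = _
  rw [this]
  rfl

theorem norm_map_le (L : E →L[ℝ] F) (f : Ck n E) : ‖map L f‖ ≤ ‖L‖ * ‖f‖ := by
  rw [norm_le_iff (by positivity)]
  intro j hj x
  rw [iteratedDeriv_map L f hj]
  exact L.le_opNorm_of_le (f.norm_iteratedDeriv_le hj x)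

/-- A function in `C^n(S¹; F →L E)` as a continuous linear map `F → C^n(S¹; E)`. -/
noncomputable def flipL (n : ℕ) (F E : Type*) [NormedAddCommGroup E] [NormedSpace ℝ E]
    [NormedAddCommGroup F] [NormedSpace ℝ F] : Ck n (F →L[ℝ] E) →L[ℝ] F →L[ℝ] Ck n E :=
  LinearMap.mkContinuous₂
    (LinearMap.mk₂ ℝ (fun f h => map (ContinuousLinearMap.apply ℝ E h) f)
      (fun _ _ _ => rfl) (fun _ _ _ => rfl)
      (fun f g h => ext fun x => (f x).map_add g h)
      (fun c f h => ext fun x => (f x).map_smul c h)) 1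
    fun f h => by
      rw [one_mul]
      refine (norm_map_le _ f).trans ?_
      rw [mul_comm]
      gcongr
      refine ContinuousLinearMap.opNorm_le_bound _ (norm_nonneg _) fun L => ?_
      rw [mul_comm]
      exact L.le_opNorm h

theorem flipL_apply (f : Ck n (F →L[ℝ] E)) (h : F) (x : ℝ) : flipL n F E f h x = f x h := rfl

theorem iteratedDeriv_flipL (f : Ck n (F →L[ℝ] E)) (h : F) {j : ℕ} (hj : j ≤ n) (x : ℝ) :
    iteratedDeriv j (flipL n F E f h) x = iteratedDeriv j f x h :=
  iteratedDeriv_map (ContinuousLinearMap.apply ℝ E h) f hj x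

theorem isometry_jet (n : ℕ) (E : Type*) [NormedAddCommGroup E] [NormedSpace ℝ E] :
    Isometry (jet n E) :=
  AddMonoidHomClass.isometry_of_norm (jet n E) fun _ => rfl

instance [CompleteSpace E] : CompleteSpace (Ck n E) := by
  refine Metric.complete_of_cauchySeq_tendsto fun u hu => ?_
  obtain ⟨g, hg⟩ := cauchySeq_tendsto_of_complete
    ((isometry_jet n E).uniformContinuous.comp_cauchySeq hu)
  have hunif : ∀ j : Fin (n + 1),
      TendstoUniformly (fun m => iteratedDeriv j (u m)) (g j) atTop := fun j =>
    BoundedContinuousFunction.tendsto_iff_tendstoUniformly.1 ((tendsto_pi_nhds.1 hg) j)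
  have hder : ∀ j (hj : j < n) x, HasDerivAt (g ⟨j, hj.trans (Nat.lt_succ_self n)⟩)
      (g ⟨j + 1, Nat.succ_lt_succ hj⟩ x) x := by
    intro j hj x
    refine hasDerivAt_of_tendstoUniformly (hunif ⟨j + 1, Nat.succ_lt_succ hj⟩)
      (Eventually.of_forall fun m y => ?_)
      (fun y => (hunif ⟨j, hj.trans (Nat.lt_succ_self n)⟩).tendsto_at y) x
    have := ((u m).contDiff.differentiable_iteratedDeriv j (by exact_mod_cast hj) y).hasDerivAt
    simpa [iteratedDeriv_succ] using this
  have hit : ∀ j (hj : j ≤ n), iteratedDeriv j (g 0) = g ⟨j, Nat.lt_succ_of_le hj⟩ := by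
    intro j
    induction j with
    | zero => intro _; simp
    | succ j ih =>
      intro hj
      rw [iteratedDeriv_succ, ih (by omega)]
      exact funext fun x => (hder j (by omega) x).deriv
  have hcd : ContDiff ℝ n (g 0) := by
    rw [contDiff_nat_iff_iteratedDeriv]
    refine ⟨fun j hj => ?_, fun j hj => ?_⟩
    · rw [hit j hj]
      exact (g _).continuous
    · rw [hit j hj.le]
      exact fun x => (hder j hj x).differentiableAt
  have hper : Function.Periodic (g 0) (2 * Real.pi) := by
    intro x
    have h1 := (hunif 0).tendsto_at (x + 2 * Real.pi)
    have h2 := (hunif 0).tendsto_at x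
    refine tendsto_nhds_unique h1 (h2.congr fun m => ?_)
    exact ((u m).periodic_iteratedDeriv 0 x).symm
  obtain ⟨f, hf⟩ : ∃ f : Ck n E, f.1 = g 0 := ⟨⟨g 0, hcd, hper⟩, rfl⟩
  refine ⟨f, (isometry_jet n E).isEmbedding.tendsto_nhds_iff.2 ?_⟩
  convert hg
  funext j
  ext x
  change iteratedDeriv j f.1 x = _
  rw [hf]
  exact congrFun (hit j (Nat.lt_succ_iff.mp j.2)) x

/-- Evaluation at a point. -/
noncomputable def evalL (n : ℕ) (E : Type*) [NormedAddCommGroup E] [NormedSpace ℝ E] (x : ℝ) :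
    Ck n E →L[ℝ] E :=
  LinearMap.mkContinuous
    { toFun := fun f => f x
      map_add' := fun _ _ => rfl
      map_smul' := fun _ _ => rfl } 1 fun f => by
        rw [one_mul]
        exact f.norm_apply_le x

theorem evalL_apply (f : Ck n E) (x : ℝ) : evalL n E x f = f x := rfl

theorem norm_sub_le (f : Ck (n + 1) E) (x y : ℝ) : ‖f y - f x‖ ≤ ‖f‖ * ‖y - x‖ :=
  convex_univ.norm_image_sub_le_of_norm_deriv_le (fun x _ => f.differentiable x)
    (fun x _ => f.norm_deriv_le x) (mem_univ _) (mem_univ _)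

theorem norm_sub_sub_smul_le (f : Ck (n + 2) E) (x y : ℝ) :
    ‖f y - f x - (y - x) • deriv f x‖ ≤ ‖f‖ * ‖y - x‖ * ‖y - x‖ := by
  have hd : ∀ z, HasDerivAt (fun z => f z - z • deriv f x) (deriv f z - deriv f x) z := fun z => by
    simpa using (f.differentiable z).hasDerivAt.fun_sub
      ((hasDerivAt_id z).smul_const (deriv f x))
  have hb : ∀ z ∈ segment ℝ x y, ‖deriv f z - deriv f x‖ ≤ ‖f‖ * ‖y - x‖ := by
    intro z hz
    have h1 := (derivL (n + 1) E f).norm_sub_le x z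
    refine h1.trans ?_
    gcongr
    · refine (norm_le_iff (norm_nonneg _)).2 fun j hj t => ?_
      have := f.norm_iteratedDeriv_le (Nat.succ_le_succ hj) t
      rwa [iteratedDeriv_succ'] at this
    · rw [← dist_eq_norm, ← dist_eq_norm, dist_comm z, dist_comm y]
      rw [← dist_add_dist_of_mem_segment hz]
      linarith [dist_nonneg (x := z) (y := y)]
  have := (convex_segment x y).norm_image_sub_le_of_norm_hasDerivWithin_le
    (fun z _ => (hd z).hasDerivWithinAt) hb (left_mem_segment ℝ x y) (right_mem_segment ℝ x y)
  refine le_trans (le_of_eq ?_) this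
  congr 1
  simp only [sub_smul]
  abel

theorem contDiff_evalL (m : ℕ) : ContDiff ℝ m (evalL (m + 1) E) := by
  induction m with
  | zero =>
    rw [Nat.cast_zero, contDiff_zero, continuous_iff_continuousAt]
    intro x
    have : LipschitzWith 1 (evalL (0 + 1) E) := LipschitzWith.of_dist_le_mul fun y z => by
      rw [dist_eq_norm, dist_eq_norm, NNReal.coe_one, one_mul]
      refine ContinuousLinearMap.opNorm_le_bound _ (norm_nonneg _) fun f => ?_
      rw [mul_comm]
      exact f.norm_sub_le z y
    exact this.continuous.continuousAt
  | succ m ih =>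
    have hd : ∀ x, HasDerivAt (evalL (m + 1 + 1) E)
        ((evalL (m + 1) E x).comp (derivL (m + 1) E)) x := by
      intro x
      rw [hasDerivAt_iff_isLittleO]
      refine Asymptotics.IsBigO.trans_isLittleO (g := fun y => ‖y - x‖ * ‖y - x‖) ?_ ?_
      · refine Asymptotics.IsBigO.of_bound 1 (Eventually.of_forall fun y => ?_)
        refine ContinuousLinearMap.opNorm_le_bound _ (by positivity) fun f => ?_
        have := f.norm_sub_sub_smul_le x y
        rw [norm_mul, norm_norm, one_mul, mul_comm, ← mul_assoc]
        exact this
      · have h1 : Tendsto (fun y => ‖y - x‖) (𝓝 x) (𝓝 0) := by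
          have : Continuous fun y : ℝ => ‖y - x‖ := by fun_prop
          simpa using this.tendsto x
        have h2 := (Asymptotics.isLittleO_one_iff ℝ).2 h1
        have h3 := h2.mul_isBigO (Asymptotics.isBigO_refl (fun y => ‖y - x‖) (𝓝 x))
        simpa using h3
    rw [show ((m + 1 : ℕ) : WithTop ℕ∞) = (m : WithTop ℕ∞) + 1 by push_cast; rfl,
      contDiff_succ_iff_deriv]
    refine ⟨fun x => (hd x).differentiableAt, by simp, ?_⟩
    rw [funext fun x => (hd x).deriv]
    exact ih.clm_comp contDiff_const

theorem contDiff_eval (n : ℕ) : ContDiff ℝ n fun p : Ck n E × ℝ => p.1 p.2 := by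
  induction n with
  | zero =>
    rw [Nat.cast_zero, contDiff_zero, continuous_iff_continuousAt]
    rintro ⟨f, x⟩
    rw [ContinuousAt, tendsto_iff_norm_sub_tendsto_zero]
    have h1 : Tendsto (fun p : Ck 0 E × ℝ => ‖p.1 - f‖ + ‖f p.2 - f x‖) (𝓝 (f, x)) (𝓝 0) := by
      have hf : Continuous f.1 := f.contDiff.continuous
      have : Continuous fun p : Ck 0 E × ℝ => ‖p.1 - f‖ + ‖f p.2 - f x‖ := by fun_prop
      simpa using this.tendsto (f, x)
    refine squeeze_zero (fun _ => norm_nonneg _) (fun p => ?_) h1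
    calc ‖p.1 p.2 - f x‖ = ‖(p.1 - f) p.2 + (f p.2 - f x)‖ := by rw [sub_apply]; abel_nf
      _ ≤ _ := (norm_add_le _ _).trans (add_le_add_left ((p.1 - f).norm_apply_le p.2) _)
  | succ n ih =>
    have hd : ∀ p : Ck (n + 1) E × ℝ, HasFDerivAt (fun p : Ck (n + 1) E × ℝ => p.1 p.2)
        ((evalL (n + 1) E p.2).comp (ContinuousLinearMap.fst ℝ _ _) +
          (ContinuousLinearMap.snd ℝ (Ck (n + 1) E) ℝ).smulRight (derivL n E p.1 p.2)) p := by
      rintro ⟨f, x⟩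
      have h1 : HasFDerivAt (fun p : Ck (n + 1) E × ℝ => f p.2)
          ((ContinuousLinearMap.snd ℝ (Ck (n + 1) E) ℝ).smulRight (deriv f x)) (f, x) := by
        have := (show HasFDerivAt f.1 _ (f, x).2 from
          (f.differentiable x).hasDerivAt.hasFDerivAt).comp (f, x) hasFDerivAt_snd
        refine this.congr_fderiv ?_
        ext p <;> simp
      have h2 : HasFDerivAt (fun p : Ck (n + 1) E × ℝ => (p.1 - f) p.2)
          ((evalL (n + 1) E x).comp (ContinuousLinearMap.fst ℝ (Ck (n + 1) E) ℝ)) (f, x) := by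
        rw [hasFDerivAt_iff_isLittleO]
        refine Asymptotics.IsBigO.trans_isLittleO
          (g := fun p : Ck (n + 1) E × ℝ => ‖p - (f, x)‖ * ‖p - (f, x)‖) ?_ ?_
        · refine Asymptotics.IsBigO.of_bound 1 (Eventually.of_forall fun p => ?_)
          have h3 := (p.1 - f).norm_sub_le x p.2
          rw [norm_mul, norm_norm, one_mul]
          calc _ = ‖(p.1 - f) p.2 - (p.1 - f) x‖ := by simp [evalL_apply, sub_apply, zero_apply]
            _ ≤ ‖p.1 - f‖ * ‖p.2 - x‖ := h3
            _ ≤ _ := by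
              gcongr
              · exact norm_fst_le (p - (f, x))
              · exact norm_snd_le (p - (f, x))
        · have h1 : Tendsto (fun p : Ck (n + 1) E × ℝ => ‖p - (f, x)‖) (𝓝 (f, x)) (𝓝 0) := by
            have : Continuous fun p : Ck (n + 1) E × ℝ => ‖p - (f, x)‖ := by fun_prop
            simpa using this.tendsto (f, x)
          have h2 := (Asymptotics.isLittleO_one_iff ℝ).2 h1
          have h3 := h2.mul_isBigO
            (Asymptotics.isBigO_refl (fun p : Ck (n + 1) E × ℝ => ‖p - (f, x)‖) (𝓝 (f, x)))
          simp only [one_mul] at h3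
          exact h3.of_norm_right
      refine (h2.add h1).congr_of_eventuallyEq (Eventually.of_forall fun p => ?_)
      simp [sub_apply]
    rw [show ((n + 1 : ℕ) : WithTop ℕ∞) = (n : WithTop ℕ∞) + 1 by push_cast; rfl,
      contDiff_succ_iff_fderiv]
    refine ⟨fun x => (hd x).differentiableAt, by simp, ?_⟩
    rw [funext fun x => (hd x).fderiv]
    have h1 : ContDiff ℝ n fun p : Ck (n + 1) E × ℝ => derivL n E p.1 p.2 :=
      ih.comp (((derivL n E).contDiff.comp contDiff_fst).prodMk contDiff_snd)
    exact (((contDiff_evalL n).comp contDiff_snd).clm_comp contDiff_const).add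
      (contDiff_const.smulRight h1)

end Ck

section Curry

universe u

variable {X E : Type u} [NormedAddCommGroup X] [NormedSpace ℝ X] [NormedAddCommGroup E]
  [NormedSpace ℝ E]

/-- The partial derivative in the parameter of a function on `X × ℝ`. -/
noncomputable def partialFst (G : X × ℝ → E) (p : X × ℝ) : X →L[ℝ] E :=
  (fderiv ℝ G p).comp (ContinuousLinearMap.inl ℝ X ℝ)

/-- The partial derivative in the real variable of a function on `X × ℝ`. -/
noncomputable def partialSnd (G : X × ℝ → E) (p : X × ℝ) : E := fderiv ℝ G p (0, 1)

variable {U : Set X} {G H : X × ℝ → E}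

theorem ContDiffOn.partialFst {m : ℕ} (hU : IsOpen U)
    (hG : ContDiffOn ℝ (m + 1 : ℕ) G (U ×ˢ univ)) : ContDiffOn ℝ m (partialFst G) (U ×ˢ univ) := by
  have := hG.fderiv_of_isOpen (hU.prod isOpen_univ) (m := m) (by norm_cast)
  exact this.clm_comp contDiffOn_const

theorem ContDiffOn.partialSnd {m : ℕ} (hU : IsOpen U)
    (hG : ContDiffOn ℝ (m + 1 : ℕ) G (U ×ˢ univ)) : ContDiffOn ℝ m (partialSnd G) (U ×ˢ univ) := by
  have := hG.fderiv_of_isOpen (hU.prod isOpen_univ) (m := m) (by norm_cast)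
  exact this.clm_apply contDiffOn_const

theorem ContDiffOn.iterate_partialSnd (hU : IsOpen U) {m : ℕ} (j : ℕ)
    (hG : ContDiffOn ℝ (m + j : ℕ) G (U ×ˢ univ)) :
    ContDiffOn ℝ m (_root_.partialSnd^[j] G) (U ×ˢ univ) := by
  induction j generalizing G with
  | zero => exact hG
  | succ j ih => exact ih (ContDiffOn.partialSnd hU (m := m + j) hG)

theorem Set.EqOn.partialSnd (hU : IsOpen U) (h : EqOn G H (U ×ˢ univ)) :
    EqOn (_root_.partialSnd G) (_root_.partialSnd H) (U ×ˢ univ) := fun p hp => by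
  have := (h.eventuallyEq_of_mem ((hU.prod isOpen_univ).mem_nhds hp)).fderiv_eq (𝕜 := ℝ)
  simp only [_root_.partialSnd, this]

theorem Set.EqOn.iterate_partialSnd (hU : IsOpen U) (h : EqOn G H (U ×ˢ univ)) (j : ℕ) :
    EqOn (_root_.partialSnd^[j] G) (_root_.partialSnd^[j] H) (U ×ˢ univ) := by
  induction j generalizing G H with
  | zero => exact h
  | succ j ih => exact ih (h.partialSnd hU)

theorem hasFDerivAt_of_contDiffOn_prod {n : ℕ} (hU : IsOpen U)
    (hG : ContDiffOn ℝ (n + 1 : ℕ) G (U ×ˢ univ)) {x : X} (hx : x ∈ U) (φ : ℝ) :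
    HasFDerivAt G (fderiv ℝ G (x, φ)) (x, φ) :=
  (((hG (x, φ) ⟨hx, mem_univ _⟩).contDiffAt
    ((hU.prod isOpen_univ).mem_nhds ⟨hx, mem_univ _⟩)).differentiableAt (by simp)).hasFDerivAt

theorem hasDerivAt_partialSnd {n : ℕ} (hU : IsOpen U)
    (hG : ContDiffOn ℝ (n + 1 : ℕ) G (U ×ˢ univ)) {x : X} (hx : x ∈ U) (φ : ℝ) :
    HasDerivAt (fun φ => G (x, φ)) (partialSnd G (x, φ)) φ :=
  (hasFDerivAt_of_contDiffOn_prod hU hG hx φ).comp_hasDerivAt φ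
    ((hasDerivAt_const φ x).prodMk (hasDerivAt_id φ))

theorem hasFDerivAt_partialFst {n : ℕ} (hU : IsOpen U)
    (hG : ContDiffOn ℝ (n + 1 : ℕ) G (U ×ˢ univ)) {x : X} (hx : x ∈ U) (φ : ℝ) :
    HasFDerivAt (fun x => G (x, φ)) (partialFst G (x, φ)) x :=
  HasFDerivAt.comp (f := fun x => (x, φ)) x (hasFDerivAt_of_contDiffOn_prod hU hG hx φ)
    (hasFDerivAt_prodMk_left x φ)

theorem iteratedDeriv_eq_iterate_partialSnd (hU : IsOpen U) {j : ℕ}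
    (hG : ContDiffOn ℝ j G (U ×ˢ univ)) {x : X} (hx : x ∈ U) (φ : ℝ) :
    iteratedDeriv j (fun φ => G (x, φ)) φ = partialSnd^[j] G (x, φ) := by
  induction j generalizing G with
  | zero => simp
  | succ j ih =>
    rw [iteratedDeriv_succ', funext fun φ => (hasDerivAt_partialSnd hU hG hx φ).deriv]
    exact ih (hG.partialSnd hU)

theorem partialFst_partialSnd (hU : IsOpen U) (hG : ContDiffOn ℝ (2 : ℕ) G (U ×ˢ univ)) :
    EqOn (partialFst (partialSnd G)) (partialSnd (partialFst G)) (U ×ˢ univ) := by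
  intro p hp
  have hmem := (hU.prod isOpen_univ).mem_nhds hp
  have hc : ContDiffAt ℝ (2 : ℕ) G p := (hG p hp).contDiffAt hmem
  have hsym : IsSymmSndFDerivAt ℝ G p := hc.isSymmSndFDerivAt (by simp)
  have hd : DifferentiableAt ℝ (fderiv ℝ G) p :=
    (hc.fderiv_right (m := 1) (by norm_num)).differentiableAt (by simp)
  have h1 : HasFDerivAt (partialFst G)
      ((ContinuousLinearMap.compL ℝ X (X × ℝ) E).flip (ContinuousLinearMap.inl ℝ X ℝ) ∘L
        fderiv ℝ (fderiv ℝ G) p) p :=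
    (((ContinuousLinearMap.compL ℝ X (X × ℝ) E).flip
      (ContinuousLinearMap.inl ℝ X ℝ)).hasFDerivAt).comp p hd.hasFDerivAt
  have h2 : HasFDerivAt (partialSnd G)
      (ContinuousLinearMap.apply ℝ E ((0 : X), (1 : ℝ)) ∘L fderiv ℝ (fderiv ℝ G) p) p :=
    (ContinuousLinearMap.apply ℝ E ((0 : X), (1 : ℝ))).hasFDerivAt.comp p hd.hasFDerivAt
  ext h
  simp only [partialFst, partialSnd] at h1 h2 ⊢
  rw [h1.fderiv, h2.fderiv]
  exact hsym (h, 0) (0, 1)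

theorem partialFst_iterate_partialSnd (hU : IsOpen U) {j : ℕ}
    (hG : ContDiffOn ℝ (j + 1 : ℕ) G (U ×ˢ univ)) :
    EqOn (partialFst (partialSnd^[j] G)) (partialSnd^[j] (partialFst G)) (U ×ˢ univ) := by
  induction j generalizing G with
  | zero => exact fun _ _ => rfl
  | succ j ih =>
    exact (ih (hG.partialSnd hU)).trans ((partialFst_partialSnd hU
      (hG.of_le (by norm_cast; omega))).iterate_partialSnd hU j)

theorem eventually_forall_norm_sub_lt_of_periodic {X E : Type*} [NormedAddCommGroup X]
    [NormedAddCommGroup E] {U : Set X} {G : X × ℝ → E} (hU : IsOpen U)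
    (hG : ContinuousOn G (U ×ˢ univ))
    (hper : ∀ x ∈ U, Function.Periodic (fun φ => G (x, φ)) (2 * Real.pi)) {x₀ : X} (hx₀ : x₀ ∈ U)
    {ε : ℝ} (hε : 0 < ε) : ∀ᶠ x in 𝓝 x₀, ∀ φ, ‖G (x, φ) - G (x₀, φ)‖ < ε := by
  have h1 : ∀ᶠ x in 𝓝 x₀, ∀ φ ∈ Icc 0 (2 * Real.pi), ‖G (x, φ) - G (x₀, φ)‖ < ε := by
    refine isCompact_Icc.eventually_forall_of_forall_eventually fun φ _ => ?_
    have hc : ContinuousAt G (x₀, φ) :=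
      (hG _ ⟨hx₀, mem_univ _⟩).continuousAt ((hU.prod isOpen_univ).mem_nhds ⟨hx₀, mem_univ _⟩)
    have hc2 : ContinuousAt (fun z : X × ℝ => ‖G (z.1, z.2) - G (x₀, z.2)‖) (x₀, φ) := by
      refine (ContinuousAt.sub hc ?_).norm
      exact ContinuousAt.comp (f := fun z : X × ℝ => (x₀, z.2)) hc (by fun_prop)
    have := hc2.eventually_lt continuousAt_const (show _ < ε by simpa using hε)
    exact this
  filter_upwards [h1, hU.mem_nhds hx₀] with x hx hxU φ
  obtain ⟨ψ, hψ, h⟩ := ((hper x hxU).sub (hper x₀ hx₀)).exists_mem_Ico₀ Real.two_pi_pos φ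
  simp only [Pi.sub_apply] at h
  rw [h]
  exact hx ψ ⟨hψ.1, hψ.2.le⟩

open Classical in
/-- A function on `ℝ` as an element of `C^k(S¹; E)`, with value `0` if it does not qualify. -/
noncomputable def Ck.ofFun (k : ℕ) (g : ℝ → E) : Ck k E :=
  if h : ContDiff ℝ k g ∧ Function.Periodic g (2 * Real.pi) then ⟨g, h⟩ else 0

theorem Ck.coe_ofFun {k : ℕ} {g : ℝ → E} (h : ContDiff ℝ k g)
    (h' : Function.Periodic g (2 * Real.pi)) : (Ck.ofFun k g).1 = g := by
  exact congrArg Subtype.val (dif_pos (⟨h, h'⟩ : ContDiff ℝ k g ∧ _))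

theorem contDiff_section {k : ℕ} (hG : ContDiffOn ℝ k G (U ×ˢ univ)) {x : X} (hx : x ∈ U) :
    ContDiff ℝ k fun φ => G (x, φ) := by
  rw [← contDiffOn_univ]
  exact hG.comp (by fun_prop) fun φ _ => ⟨hx, mem_univ _⟩

theorem Ck.coe_ofFun_section {k : ℕ} (hG : ContDiffOn ℝ k G (U ×ˢ univ))
    (hper : ∀ x ∈ U, Function.Periodic (fun φ => G (x, φ)) (2 * Real.pi)) {x : X} (hx : x ∈ U) :
    (Ck.ofFun k fun φ => G (x, φ)).1 = fun φ => G (x, φ) :=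
  Ck.coe_ofFun (contDiff_section hG hx) (hper x hx)

theorem iteratedDeriv_ofFun_section (hU : IsOpen U) {k : ℕ} (hG : ContDiffOn ℝ k G (U ×ˢ univ))
    (hper : ∀ x ∈ U, Function.Periodic (fun φ => G (x, φ)) (2 * Real.pi)) {x : X} (hx : x ∈ U)
    {j : ℕ} (hj : j ≤ k) (φ : ℝ) :
    iteratedDeriv j (Ck.ofFun k fun φ => G (x, φ)) φ = partialSnd^[j] G (x, φ) := by
  rw [Ck.coe_ofFun_section hG hper hx]
  exact iteratedDeriv_eq_iterate_partialSnd hU (hG.of_le (by exact_mod_cast hj)) hx φ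

theorem periodic_iterate_partialSnd (hU : IsOpen U) {k : ℕ} (hG : ContDiffOn ℝ k G (U ×ˢ univ))
    (hper : ∀ x ∈ U, Function.Periodic (fun φ => G (x, φ)) (2 * Real.pi)) {x : X} (hx : x ∈ U)
    {j : ℕ} (hj : j ≤ k) :
    Function.Periodic (fun φ => partialSnd^[j] G (x, φ)) (2 * Real.pi) := by
  intro φ
  simp only [← iteratedDeriv_ofFun_section hU hG hper hx hj]
  exact Ck.periodic_iteratedDeriv _ _ _

theorem periodic_partialFst (hU : IsOpen U)
    (hper : ∀ x ∈ U, Function.Periodic (fun φ => G (x, φ)) (2 * Real.pi)) {x : X} (hx : x ∈ U) :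
    Function.Periodic (fun φ => partialFst G (x, φ)) (2 * Real.pi) := by
  intro φ
  have h1 : (fun p : X × ℝ => G (p + (0, 2 * Real.pi))) =ᶠ[𝓝 (x, φ)] G := by
    filter_upwards [(hU.prod isOpen_univ).mem_nhds (show (x, φ) ∈ U ×ˢ univ from ⟨hx, mem_univ _⟩)]
      with p hp
    have h : p + (0, 2 * Real.pi) = (p.1, p.2 + 2 * Real.pi) := by ext <;> simp
    rw [h]
    exact hper p.1 hp.1 p.2
  have h2 := h1.fderiv_eq (𝕜 := ℝ)
  rw [fderiv_comp_add_right] at h2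
  simp only [partialFst, ← h2]
  simp

theorem continuousOn_ofFun_section (hU : IsOpen U) {k : ℕ} (hG : ContDiffOn ℝ k G (U ×ˢ univ))
    (hper : ∀ x ∈ U, Function.Periodic (fun φ => G (x, φ)) (2 * Real.pi)) :
    ContinuousOn (fun x => Ck.ofFun k fun φ => G (x, φ)) U := by
  refine fun x₀ hx₀ => ContinuousAt.continuousWithinAt ?_
  rw [Metric.continuousAt_iff']
  intro ε hε
  have h1 : ∀ j ∈ Finset.range (k + 1), ∀ᶠ x in 𝓝 x₀, ∀ φ,
      ‖partialSnd^[j] G (x, φ) - partialSnd^[j] G (x₀, φ)‖ < ε / 2 := by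
    intro j hj
    have hj : j ≤ k := Nat.lt_succ_iff.1 (Finset.mem_range.1 hj)
    exact eventually_forall_norm_sub_lt_of_periodic hU
      (ContDiffOn.iterate_partialSnd hU (m := 0) j
        (hG.of_le (by norm_cast; omega))).continuousOn
      (fun x hx => periodic_iterate_partialSnd hU hG hper hx hj) hx₀ (half_pos hε)
  filter_upwards [(Filter.eventually_all_finset _).2 h1, hU.mem_nhds hx₀] with x hx hxU
  rw [dist_eq_norm]
  refine lt_of_le_of_lt ((Ck.norm_le_iff (half_pos hε).le).2 fun j hj φ => ?_) (half_lt_self hε)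
  rw [Ck.iteratedDeriv_sub_apply _ _ hj, iteratedDeriv_ofFun_section hU hG hper hxU hj,
    iteratedDeriv_ofFun_section hU hG hper hx₀ hj]
  exact (hx j (Finset.mem_range.2 (Nat.lt_succ_of_le hj)) φ).le

theorem hasFDerivAt_ofFun_section (hU : IsOpen U) {k : ℕ}
    (hG : ContDiffOn ℝ (k + 1 : ℕ) G (U ×ˢ univ))
    (hper : ∀ x ∈ U, Function.Periodic (fun φ => G (x, φ)) (2 * Real.pi)) {x₀ : X} (hx₀ : x₀ ∈ U) :
    HasFDerivAt (fun x => Ck.ofFun k fun φ => G (x, φ))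
      (Ck.flipL k X E (Ck.ofFun k fun φ => partialFst G (x₀, φ))) x₀ := by
  have hGk : ContDiffOn ℝ k G (U ×ˢ univ) := hG.of_le (by norm_cast; omega)
  have hG1 := hG.partialFst hU
  have hper1 : ∀ x ∈ U, Function.Periodic (fun φ => partialFst G (x, φ)) (2 * Real.pi) :=
    fun x hx => periodic_partialFst hU hper hx
  rw [hasFDerivAt_iff_isLittleO, Asymptotics.isLittleO_iff]
  intro ε hε
  have h1 : ∀ j ∈ Finset.range (k + 1), ∀ᶠ x in 𝓝 x₀, ∀ φ,
      ‖partialSnd^[j] (partialFst G) (x, φ) - partialSnd^[j] (partialFst G) (x₀, φ)‖ < ε := by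
    intro j hj
    have hj : j ≤ k := Nat.lt_succ_iff.1 (Finset.mem_range.1 hj)
    exact eventually_forall_norm_sub_lt_of_periodic hU
      (ContDiffOn.iterate_partialSnd hU (m := 0) j
        (hG1.of_le (by norm_cast; omega))).continuousOn
      (fun x hx => periodic_iterate_partialSnd hU hG1 hper1 hx hj) hx₀ hε
  obtain ⟨δ, hδ, hball⟩ := Metric.eventually_nhds_iff_ball.1
    (((Filter.eventually_all_finset _).2 h1).and (hU.eventually_mem hx₀))
  filter_upwards [Metric.ball_mem_nhds x₀ hδ] with x hx
  rw [Ck.norm_le_iff (by positivity)]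
  intro j hj φ
  rw [Ck.iteratedDeriv_sub_apply _ _ hj, Ck.iteratedDeriv_sub_apply _ _ hj,
    iteratedDeriv_ofFun_section hU hGk hper (hball x hx).2 hj,
    iteratedDeriv_ofFun_section hU hGk hper hx₀ hj, Ck.iteratedDeriv_flipL _ _ hj,
    iteratedDeriv_ofFun_section hU hG1 hper1 hx₀ hj]
  have hGj : ContDiffOn ℝ (0 + 1 : ℕ) (partialSnd^[j] G) (U ×ˢ univ) :=
    ContDiffOn.iterate_partialSnd hU j (hG.of_le (by norm_cast; omega))
  have hGj' : ContDiffOn ℝ (j + 1 : ℕ) G (U ×ˢ univ) := hG.of_le (by norm_cast; omega)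
  refine (convex_ball x₀ δ).norm_image_sub_le_of_norm_hasFDerivWithin_le'
    (f := fun x => partialSnd^[j] G (x, φ))
    (fun y hy => (hasFDerivAt_partialFst hU hGj (hball y hy).2 φ).hasFDerivWithinAt)
    (fun y hy => ?_) (Metric.mem_ball_self hδ) hx
  rw [partialFst_iterate_partialSnd hU hGj'
    (show (y, φ) ∈ U ×ˢ univ from ⟨(hball y hy).2, mem_univ _⟩)]
  exact ((hball y hy).1 j (Finset.mem_range.2 (Nat.lt_succ_of_le hj)) φ).le

/-- A jointly `C^{k+ℓ}` function on `U × S¹` is a `C^ℓ` function from `U` to `C^k(S¹)`. -/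
theorem contDiffOn_ofFun_section (hU : IsOpen U) {k ℓ : ℕ}
    (hG : ContDiffOn ℝ (k + ℓ : ℕ) G (U ×ˢ univ))
    (hper : ∀ x ∈ U, Function.Periodic (fun φ => G (x, φ)) (2 * Real.pi)) :
    ContDiffOn ℝ ℓ (fun x => Ck.ofFun k fun φ => G (x, φ)) U := by
  induction ℓ generalizing E with
  | zero =>
    rw [Nat.cast_zero, contDiffOn_zero]
    exact continuousOn_ofFun_section hU hG hper
  | succ ℓ ih =>
    have hd := fun x (hx : x ∈ U) => hasFDerivAt_ofFun_section hU (k := k)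
      (hG.of_le (by norm_cast; omega)) hper hx
    rw [show ((ℓ + 1 : ℕ) : WithTop ℕ∞) = (ℓ : WithTop ℕ∞) + 1 by push_cast; rfl,
      contDiffOn_succ_iff_fderiv_of_isOpen hU]
    refine ⟨fun x hx => (hd x hx).differentiableAt.differentiableWithinAt, by simp, ?_⟩
    refine ContDiffOn.congr ?_ fun x hx => (hd x hx).fderiv
    exact (Ck.flipL k X E).contDiff.comp_contDiffOn
      (ih (hG.partialFst hU (m := k + ℓ)) fun x hx => periodic_partialFst hU hper hx)

end Curry

section ParametricIntegral

universe u

variable {X E : Type u} [NormedAddCommGroup X] [NormedSpace ℝ X] [NormedAddCommGroup E]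
  [NormedSpace ℝ E]

/-- The continuous linear functional `f ↦ ½ ∫₀^π sin v · f(v) dv`. -/
noncomputable def Ck.sinIntegral (E : Type*) [NormedAddCommGroup E] [NormedSpace ℝ E] :
    Ck 0 E →L[ℝ] E :=
  LinearMap.mkContinuous
    { toFun := fun f => ∫ v in (0 : ℝ)..Real.pi, (Real.sin v / 2) • f v
      map_add' := fun f g => by
        have hf : Continuous f.1 := f.contDiff.continuous
        have hg : Continuous g.1 := g.contDiff.continuous
        rw [← intervalIntegral.integral_add (Continuous.intervalIntegrable (by fun_prop) _ _)
          (Continuous.intervalIntegrable (by fun_prop) _ _)]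
        simp only [Ck.add_apply, smul_add]
      map_smul' := fun c f => by
        rw [RingHom.id_apply, ← intervalIntegral.integral_smul]
        simp only [Ck.smul_apply, smul_comm c] } (1 / 2 * Real.pi)
    fun f => by
      have := intervalIntegral.norm_integral_le_of_norm_le_const (a := 0) (b := Real.pi)
        (f := fun v => (Real.sin v / 2) • f v) (C := 1 / 2 * ‖f‖) fun v _ => by
          rw [norm_smul, norm_div, Real.norm_two]
          gcongr
          · exact Real.abs_sin_le_one v
          · exact f.norm_apply_le v
      rw [sub_zero, abs_of_pos Real.pi_pos] at this
      refine this.trans (le_of_eq (by ring))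

theorem Ck.sinIntegral_apply (f : Ck 0 E) :
    Ck.sinIntegral E f = ∫ v in (0 : ℝ)..Real.pi, (Real.sin v / 2) • f v := rfl

theorem integral_unit_eq_sin {g : ℝ → E} (hg : ContinuousOn g (Icc 0 1)) :
    ∫ u in (0 : ℝ)..1, g u =
      ∫ v in (0 : ℝ)..Real.pi, (Real.sin v / 2) • g ((1 - Real.cos v) / 2) := by
  have h := intervalIntegral.integral_deriv_smul_comp' (a := 0) (b := Real.pi)
    (f := fun v => (1 - Real.cos v) / 2) (f' := fun v => Real.sin v / 2) (g := g)
    (fun v _ => by simpa using ((Real.hasDerivAt_cos v).const_sub 1).div_const 2)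
    (by fun_prop) (hg.mono ?_)
  · simpa using h.symm
  · rintro _ ⟨v, -, rfl⟩
    constructor <;> linarith [Real.cos_le_one v, Real.neg_one_le_cos v]

theorem unit_of_cos (v : ℝ) : (1 - Real.cos v) / 2 ∈ Icc (0 : ℝ) 1 := by
  constructor <;> linarith [Real.cos_le_one v, Real.neg_one_le_cos v]

variable {U : Set X} {f : X × ℝ → E}

theorem contDiffOn_comp_cos {m : ℕ} (hf : ∀ x ∈ U, ∀ u ∈ Icc (0 : ℝ) 1, ContDiffAt ℝ m f (x, u)) :
    ContDiffOn ℝ m (fun p : X × ℝ => f (p.1, (1 - Real.cos p.2) / 2)) (U ×ˢ univ) := by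
  rintro ⟨x, v⟩ ⟨hx, -⟩
  refine ContDiffAt.contDiffWithinAt ?_
  refine ContDiffAt.comp (f := fun p : X × ℝ => (p.1, (1 - Real.cos p.2) / 2)) (x, v)
    (hf x hx _ (unit_of_cos v)) ?_
  have : ContDiff ℝ m (fun p : X × ℝ => (p.1, (1 - Real.cos p.2) / 2)) := by fun_prop
  exact this.contDiffAt

theorem continuousOn_unit {m : ℕ} {x : X} (hf : ∀ u ∈ Icc (0 : ℝ) 1, ContDiffAt ℝ m f (x, u)) :
    ContinuousOn (fun u => f (x, u)) (Icc 0 1) := fun u hu =>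
  (ContinuousAt.comp (f := fun u => (x, u)) (hf u hu).continuousAt
    (by fun_prop)).continuousWithinAt

theorem integral_unit_eq_sinIntegral {m : ℕ}
    (hf : ∀ x ∈ U, ∀ u ∈ Icc (0 : ℝ) 1, ContDiffAt ℝ m f (x, u)) {x : X} (hx : x ∈ U) :
    ∫ u in (0 : ℝ)..1, f (x, u) =
      Ck.sinIntegral E (Ck.ofFun 0 fun v => f (x, (1 - Real.cos v) / 2)) := by
  rw [integral_unit_eq_sin (continuousOn_unit (hf x hx))]
  have h := Ck.coe_ofFun_section (k := 0) ((contDiffOn_comp_cos hf).of_le (by simp))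
    (fun x _ v => by simp) hx
  rw [Ck.sinIntegral_apply, h]

theorem contDiffOn_integral_unit (hU : IsOpen U) {m : ℕ}
    (hf : ∀ x ∈ U, ∀ u ∈ Icc (0 : ℝ) 1, ContDiffAt ℝ m f (x, u)) :
    ContDiffOn ℝ m (fun x => ∫ u in (0 : ℝ)..1, f (x, u)) U := by
  refine ContDiffOn.congr ?_ fun x hx => integral_unit_eq_sinIntegral hf hx
  refine (Ck.sinIntegral E).contDiff.comp_contDiffOn ?_
  exact contDiffOn_ofFun_section (k := 0) hU (by simpa using contDiffOn_comp_cos hf)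
    (fun x _ v => by simp)

theorem fderiv_integral_unit (hU : IsOpen U)
    (hf : ∀ x ∈ U, ∀ u ∈ Icc (0 : ℝ) 1, ContDiffAt ℝ (1 : ℕ) f (x, u)) {x : X} (hx : x ∈ U)
    (h : X) :
    fderiv ℝ (fun x => ∫ u in (0 : ℝ)..1, f (x, u)) x h =
      ∫ u in (0 : ℝ)..1, partialFst f (x, u) h := by
  have hc := contDiffOn_comp_cos hf
  have hper : ∀ x ∈ U, Function.Periodic (fun v => (fun p : X × ℝ =>
      f (p.1, (1 - Real.cos p.2) / 2)) (x, v)) (2 * Real.pi) := fun x _ v => by simp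
  have h1 := (Ck.sinIntegral E).hasFDerivAt.comp x
    (hasFDerivAt_ofFun_section (k := 0) hU (by simpa using hc) hper hx)
  have h2 : HasFDerivAt (fun x => ∫ u in (0 : ℝ)..1, f (x, u)) _ x :=
    h1.congr_of_eventuallyEq (by
      filter_upwards [hU.mem_nhds hx] with y hy
      exact integral_unit_eq_sinIntegral hf hy)
  rw [h2.fderiv]
  have h3 := Ck.coe_ofFun_section (k := 0) (hc.partialFst hU (m := 0))
    (fun x hx => periodic_partialFst hU hper hx) hx
  rw [ContinuousLinearMap.comp_apply, Ck.sinIntegral_apply]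
  simp only [Ck.flipL_apply]
  rw [h3, integral_unit_eq_sin]
  · refine intervalIntegral.integral_congr fun v _ => ?_
    have h4 : HasFDerivAt (fun x => f (x, (1 - Real.cos v) / 2)) _ x :=
      HasFDerivAt.comp (f := fun x => (x, (1 - Real.cos v) / 2)) x
        ((hf x hx _ (unit_of_cos v)).differentiableAt (by simp)).hasFDerivAt
        (hasFDerivAt_prodMk_left x _)
    have h5 := hasFDerivAt_partialFst hU (n := 0) hc hx v
    simp only [h5.unique h4]
    rfl
  · intro u hu
    refine ContinuousAt.continuousWithinAt ?_
    have h6 : ContinuousAt (fderiv ℝ f) (x, u) :=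
      ((hf x hx u hu).fderiv_right (m := 0) (by norm_num)).continuousAt
    have h7 : ContinuousAt (fun u => fderiv ℝ f (x, u)) u :=
      ContinuousAt.comp (f := fun u => (x, u)) h6 (by fun_prop)
    exact h7.clm_apply continuousAt_const

variable {O : Set (X × ℝ)} {K : X × ℝ → E}

theorem isOpen_segment_mem {X : Type*} [TopologicalSpace X] {O : Set (X × ℝ)} (hO : IsOpen O) :
    IsOpen {p : X × ℝ × ℝ | ∀ u ∈ Icc (0 : ℝ) 1, (p.1, p.2.1 + (p.2.2 - p.2.1) * u) ∈ O} := by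
  rw [isOpen_iff_eventually]
  intro p hp
  refine isCompact_Icc.eventually_forall_of_forall_eventually fun u hu => ?_
  have hc : Continuous fun z : (X × ℝ × ℝ) × ℝ =>
      (z.1.1, z.1.2.1 + (z.1.2.2 - z.1.2.1) * z.2) := by fun_prop
  exact hc.continuousAt.eventually (hO.mem_nhds (hp u hu))

theorem integral_eq_smul_integral_unit (g : ℝ → E) (b c : ℝ) :
    ∫ t in b..c, g t = (c - b) • ∫ u in (0 : ℝ)..1, g (b + (c - b) * u) := by
  rw [intervalIntegral.smul_integral_comp_add_mul]
  simp

theorem contDiffAt_comp_segment {m : ℕ} (hO : IsOpen O) (hK : ContDiffOn ℝ m K O)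
    {p : X × ℝ × ℝ} {u : ℝ} (hp : (p.1, p.2.1 + (p.2.2 - p.2.1) * u) ∈ O) :
    ContDiffAt ℝ m (fun z : (X × ℝ × ℝ) × ℝ => K (z.1.1, z.1.2.1 + (z.1.2.2 - z.1.2.1) * z.2))
      (p, u) := by
  have h1 : ContDiff ℝ m fun z : (X × ℝ × ℝ) × ℝ =>
      (z.1.1, z.1.2.1 + (z.1.2.2 - z.1.2.1) * z.2) := by fun_prop
  exact ContDiffAt.comp (p, u) ((hK _ hp).contDiffAt (hO.mem_nhds hp)) h1.contDiffAt

theorem contDiffOn_intervalIntegral {m : ℕ} (hO : IsOpen O) (hK : ContDiffOn ℝ m K O) :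
    ContDiffOn ℝ m (fun p : X × ℝ × ℝ => ∫ t in p.2.1..p.2.2, K (p.1, t))
      {p | ∀ u ∈ Icc (0 : ℝ) 1, (p.1, p.2.1 + (p.2.2 - p.2.1) * u) ∈ O} := by
  refine ContDiffOn.congr ?_ fun p _ =>
    integral_eq_smul_integral_unit (fun t => K (p.1, t)) p.2.1 p.2.2
  refine ContDiffOn.smul (by fun_prop) ?_
  exact contDiffOn_integral_unit (isOpen_segment_mem hO)
    (f := fun z : (X × ℝ × ℝ) × ℝ => K (z.1.1, z.1.2.1 + (z.1.2.2 - z.1.2.1) * z.2))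
    fun p hp u hu => contDiffAt_comp_segment hO hK (hp u hu)

theorem segment_mem_of_uIcc {X : Type*} {O : Set (X × ℝ)} {x : X} {b c : ℝ}
    (h : ∀ t ∈ uIcc b c, (x, t) ∈ O) :
    ∀ u ∈ Icc (0 : ℝ) 1, (x, b + (c - b) * u) ∈ O := by
  rintro u ⟨h0, h1⟩
  refine h _ ?_
  rcases le_total b c with hbc | hbc
  · rw [uIcc_of_le hbc]
    constructor <;> nlinarith
  · rw [uIcc_of_ge hbc]
    constructor <;> nlinarith

theorem fderiv_intervalIntegral [CompleteSpace E] (hO : IsOpen O) (hK : ContDiffOn ℝ (1 : ℕ) K O)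
    {x : X} {b c : ℝ} (hp : ∀ t ∈ uIcc b c, (x, t) ∈ O) (h : X) (β κ : ℝ) :
    fderiv ℝ (fun p : X × ℝ × ℝ => ∫ t in p.2.1..p.2.2, K (p.1, t)) (x, b, c) (h, β, κ) =
      (∫ t in b..c, partialFst K (x, t) h) + κ • K (x, c) - β • K (x, b) := by
  set F := fun p : X × ℝ × ℝ => ∫ t in p.2.1..p.2.2, K (p.1, t) with hF
  have hΩ := isOpen_segment_mem hO
  have hmem : (x, b, c) ∈ {p : X × ℝ × ℝ | ∀ u ∈ Icc (0 : ℝ) 1,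
    (p.1, p.2.1 + (p.2.2 - p.2.1) * u) ∈ O} := segment_mem_of_uIcc hp
  have hd : HasFDerivAt F (fderiv ℝ F (x, b, c)) (x, b, c) :=
    (((contDiffOn_intervalIntegral hO hK _ hmem).contDiffAt
      (hΩ.mem_nhds hmem)).differentiableAt (by simp)).hasFDerivAt
  have hcont : ∀ t, (x, t) ∈ O → ContinuousAt (fun t => K (x, t)) t := fun t ht =>
    ContinuousAt.comp (f := fun t => (x, t))
      ((hK _ ht).contDiffAt (hO.mem_nhds ht)).continuousAt (by fun_prop)
  have hOx : IsOpen {t | (x, t) ∈ O} := hO.preimage (by fun_prop)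
  have hco : ContinuousOn (fun t => K (x, t)) {t | (x, t) ∈ O} := fun t ht =>
    (hcont t ht).continuousWithinAt
  have hint : IntervalIntegrable (fun t => K (x, t)) volume b c :=
    ContinuousOn.intervalIntegrable fun t ht => (hcont t (hp t ht)).continuousWithinAt
  have hc1 : HasDerivAt (fun c => F (x, b, c)) (K (x, c)) c :=
    intervalIntegral.integral_hasDerivAt_right hint
      (hco.stronglyMeasurableAtFilter hOx _ (hp c right_mem_uIcc)) (hcont c (hp c right_mem_uIcc))
  have hb1 : HasDerivAt (fun b => F (x, b, c)) (-K (x, b)) b :=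
    intervalIntegral.integral_hasDerivAt_left hint
      (hco.stronglyMeasurableAtFilter hOx _ (hp b left_mem_uIcc)) (hcont b (hp b left_mem_uIcc))
  have hc2 : HasDerivAt (fun c => F (x, b, c)) (fderiv ℝ F (x, b, c) (0, 0, 1)) c :=
    HasFDerivAt.comp_hasDerivAt (f := fun c => (x, b, c)) c hd
      ((hasDerivAt_const c x).prodMk ((hasDerivAt_const c b).prodMk (hasDerivAt_id' c)))
  have hb2 : HasDerivAt (fun b => F (x, b, c)) (fderiv ℝ F (x, b, c) (0, 1, 0)) b :=
    HasFDerivAt.comp_hasDerivAt (f := fun b => (x, b, c)) b hd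
      ((hasDerivAt_const b x).prodMk ((hasDerivAt_id' b).prodMk (hasDerivAt_const b c)))
  have hx2 : HasFDerivAt (fun x => F (x, b, c))
      ((fderiv ℝ F (x, b, c)).comp (ContinuousLinearMap.inl ℝ X (ℝ × ℝ))) x :=
    HasFDerivAt.comp (f := fun x => (x, b, c)) x hd (hasFDerivAt_prodMk_left x (b, c))
  have hx1 : fderiv ℝ (fun x => F (x, b, c)) x h = ∫ t in b..c, partialFst K (x, t) h := by
    have hV : IsOpen {y : X | ∀ u ∈ Icc (0 : ℝ) 1, (y, b + (c - b) * u) ∈ O} :=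
      hΩ.preimage (f := fun y : X => (y, b, c)) (by fun_prop)
    have hf : ∀ y ∈ {y : X | ∀ u ∈ Icc (0 : ℝ) 1, (y, b + (c - b) * u) ∈ O},
        ∀ u ∈ Icc (0 : ℝ) 1, ContDiffAt ℝ (1 : ℕ)
          (fun z : X × ℝ => K (z.1, b + (c - b) * z.2)) (y, u) := by
      intro y hy u hu
      have h1 : ContDiff ℝ (1 : ℕ) fun z : X × ℝ => (z.1, b + (c - b) * z.2) := by fun_prop
      exact ContDiffAt.comp (y, u) ((hK _ (hy u hu)).contDiffAt (hO.mem_nhds (hy u hu)))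
        h1.contDiffAt
    have hfun : (fun x => F (x, b, c)) = fun x => (c - b) • ∫ u in (0 : ℝ)..1,
        K (x, b + (c - b) * u) :=
      funext fun y => integral_eq_smul_integral_unit (fun t => K (y, t)) b c
    have hdiff := ((contDiffOn_integral_unit hV hf x hmem).contDiffAt
      (hV.mem_nhds hmem)).differentiableAt (by simp)
    rw [hfun, fderiv_fun_const_smul hdiff, smul_apply,
      fderiv_integral_unit hV hf hmem,
      integral_eq_smul_integral_unit (fun t => partialFst K (x, t) h)]
    congr 1
    refine intervalIntegral.integral_congr fun u hu => ?_
    rw [uIcc_of_le zero_le_one] at hu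
    have h4 : HasFDerivAt (fun y => K (y, b + (c - b) * u)) _ x :=
      HasFDerivAt.comp (f := fun y => (y, b + (c - b) * u)) x
        (((hK _ (hmem u hu)).contDiffAt (hO.mem_nhds (hmem u hu))).differentiableAt
          (by simp)).hasFDerivAt (hasFDerivAt_prodMk_left x _)
    have h5 : HasFDerivAt (fun y => K (y, b + (c - b) * u)) _ x :=
      HasFDerivAt.comp (f := fun y => (y, u)) (g := fun z : X × ℝ => K (z.1, b + (c - b) * z.2)) x
        ((hf x hmem u hu).differentiableAt (by simp)).hasFDerivAt
        (hasFDerivAt_prodMk_left x u)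
    exact DFunLike.congr_fun (h5.unique h4) h
  have hsplit : ((h, β, κ) : X × ℝ × ℝ) = (h, 0, 0) + β • (0, 1, 0) + κ • (0, 0, 1) := by simp
  rw [hsplit, map_add, map_add, map_smul, map_smul, hc2.unique hc1, hb2.unique hb1, ← hx1,
    hx2.fderiv]
  simp only [ContinuousLinearMap.comp_apply, ContinuousLinearMap.inl_apply, Prod.mk_zero_zero,
    smul_neg]
  abel

/-- Smoothness of a parametric integral with variable endpoints. -/
theorem ContDiffOn.integral_endpoints {U : Set X} {m : ℕ} (hO : IsOpen O) (hK : ContDiffOn ℝ m K O)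
    {b c : X → ℝ} (hb : ContDiffOn ℝ m b U) (hc : ContDiffOn ℝ m c U)
    (hp : ∀ x ∈ U, ∀ t ∈ uIcc (b x) (c x), (x, t) ∈ O) :
    ContDiffOn ℝ m (fun x => ∫ t in b x..c x, K (x, t)) U :=
  (contDiffOn_intervalIntegral hO hK).comp (contDiffOn_id.prodMk (hb.prodMk hc))
    fun x hx => segment_mem_of_uIcc (hp x hx)

/-- The derivative of a parametric integral with variable endpoints. -/
theorem HasFDerivAt.integral_endpoints [CompleteSpace E] (hO : IsOpen O)
    (hK : ContDiffOn ℝ (1 : ℕ) K O) {b c : X → ℝ} {b' c' : X →L[ℝ] ℝ} {x : X}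
    (hb : HasFDerivAt b b' x) (hc : HasFDerivAt c c' x)
    (hp : ∀ t ∈ uIcc (b x) (c x), (x, t) ∈ O) (h : X) :
    fderiv ℝ (fun x => ∫ t in b x..c x, K (x, t)) x h =
      (∫ t in b x..c x, partialFst K (x, t) h) + c' h • K (x, c x) - b' h • K (x, b x) := by
  rw [← fderiv_intervalIntegral hO hK hp h (b' h) (c' h)]
  have hΩ := isOpen_segment_mem hO
  have hmem : (x, b x, c x) ∈ {p : X × ℝ × ℝ | ∀ u ∈ Icc (0 : ℝ) 1,
    (p.1, p.2.1 + (p.2.2 - p.2.1) * u) ∈ O} := segment_mem_of_uIcc hp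
  have hd := (((contDiffOn_intervalIntegral hO hK _ hmem).contDiffAt
      (hΩ.mem_nhds hmem)).differentiableAt (by simp)).hasFDerivAt
  have := HasFDerivAt.comp (f := fun x => (x, b x, c x)) x hd
    ((hasFDerivAt_id x).prodMk (hb.prodMk hc))
  exact DFunLike.congr_fun this.fderiv h

end ParametricIntegral

section ImplicitRoot

variable {X : Type*} [NormedAddCommGroup X] [NormedSpace ℝ X] [CompleteSpace X]

/-- A family of strictly increasing functions changing sign has a root depending smoothly on the
parameter. -/
theorem exists_contDiffOn_root {n : ℕ} (hn : n ≠ 0) {F : X × ℝ → ℝ} (hF : ContDiff ℝ n F)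
    {U : Set X} (hU : IsOpen U) {α β : ℝ} (hαβ : α < β) (hα : ∀ x ∈ U, F (x, α) < 0)
    (hβ : ∀ x ∈ U, 0 < F (x, β))
    (hd : ∀ x ∈ U, ∀ θ ∈ Icc α β, 0 < deriv (fun θ => F (x, θ)) θ) :
    ∃ ρ : X → ℝ, ContDiffOn ℝ n ρ U ∧ ∀ x ∈ U, ρ x ∈ Ioo α β ∧ F (x, ρ x) = 0 ∧
      ∀ θ ∈ Icc α β, (θ < ρ x → F (x, θ) < 0) ∧ (ρ x < θ → 0 < F (x, θ)) := by
  have hcont : ∀ x, Continuous fun θ => F (x, θ) := fun x =>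
    hF.continuous.comp (by fun_prop)
  have hmono : ∀ x ∈ U, StrictMonoOn (fun θ => F (x, θ)) (Icc α β) := fun x hx =>
    strictMonoOn_of_deriv_pos (convex_Icc α β) (hcont x).continuousOn fun θ hθ =>
      hd x hx θ (interior_subset hθ)
  have hex : ∀ x, ∃ ρ, x ∈ U → ρ ∈ Ioo α β ∧ F (x, ρ) = 0 := by
    intro x
    by_cases hx : x ∈ U
    · obtain ⟨ρ, hρ, h⟩ := intermediate_value_Ioo hαβ.le (hcont x).continuousOn
        (show (0 : ℝ) ∈ Ioo _ _ from ⟨hα x hx, hβ x hx⟩)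
      exact ⟨ρ, fun _ => ⟨hρ, h⟩⟩
    · exact ⟨0, fun h => absurd h hx⟩
  choose ρ hρ using hex
  refine ⟨ρ, fun x₀ hx₀ => ContDiffAt.contDiffWithinAt ?_, fun x hx => ⟨(hρ x hx).1, (hρ x hx).2,
    fun θ hθ => ⟨fun h => ?_, fun h => ?_⟩⟩⟩
  · have hdiff : HasFDerivAt F (fderiv ℝ F (x₀, ρ x₀)) (x₀, ρ x₀) :=
      (hF.differentiable (by exact_mod_cast hn) _).hasFDerivAt
    have hder : HasDerivAt (fun θ => F (x₀, θ)) (fderiv ℝ F (x₀, ρ x₀) (0, 1)) (ρ x₀) :=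
      hdiff.comp_hasDerivAt (ρ x₀) ((hasDerivAt_const _ x₀).prodMk (hasDerivAt_id _))
    have hpos := hd x₀ hx₀ (ρ x₀) (Ioo_subset_Icc_self (hρ x₀ hx₀).1)
    rw [hder.deriv] at hpos
    set q := fderiv ℝ F (x₀, ρ x₀) (0, 1) with hq
    have hinv : (fderiv ℝ F (x₀, ρ x₀) ∘L .inr ℝ X ℝ).IsInvertible := by
      refine ⟨ContinuousLinearEquiv.unitsEquivAut ℝ (Units.mk0 q hpos.ne'), ?_⟩
      ext
      simp [hq]
    have hcd : ContDiffAt ℝ n F (x₀, ρ x₀) := hF.contDiffAt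
    have hn' : (n : WithTop ℕ∞) ≠ 0 := by exact_mod_cast hn
    set ψ := hcd.implicitFunction hn' hinv with hψ
    have h1 : ContDiffAt ℝ n ψ x₀ := hcd.contDiffAt_implicitFunction hn' hinv
    have h2 : ψ x₀ = ρ x₀ := hcd.implicitFunction_apply_self hn' hinv
    have h3 := hcd.eventually_apply_implicitFunction hn' hinv
    refine h1.congr_of_eventuallyEq ?_
    have h4 : ∀ᶠ x in 𝓝 x₀, ψ x ∈ Ioo α β := h1.continuousAt.eventually
      (isOpen_Ioo.mem_nhds (by rw [h2]; exact (hρ x₀ hx₀).1))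
    filter_upwards [h3, h4, hU.mem_nhds hx₀] with x hx3 hx4 hxU
    refine (hmono x hxU).injOn (Ioo_subset_Icc_self (hρ x hxU).1) (Ioo_subset_Icc_self hx4) ?_
    rw [(hρ x hxU).2, hx3, (hρ x₀ hx₀).2]
  · rw [← (hρ x hx).2]
    exact hmono x hx hθ (Ioo_subset_Icc_self (hρ x hx).1) h
  · rw [← (hρ x hx).2]
    exact hmono x hx (Ioo_subset_Icc_self (hρ x hx).1) hθ h

end ImplicitRoot

/-- The cross product `x₀ y₁ - x₁ y₀` of plane vectors, as a continuous bilinear form. -/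
noncomputable def wedge : Plane →L[ℝ] Plane →L[ℝ] ℝ :=
  (EuclideanSpace.proj (0 : Fin 2) : Plane →L[ℝ] ℝ).smulRight
      (EuclideanSpace.proj (1 : Fin 2) : Plane →L[ℝ] ℝ) -
    (EuclideanSpace.proj (1 : Fin 2) : Plane →L[ℝ] ℝ).smulRight
      (EuclideanSpace.proj (0 : Fin 2) : Plane →L[ℝ] ℝ)

theorem wedge_apply (x y : Plane) : wedge x y = x 0 * y 1 - x 1 * y 0 := by
  simp [wedge]

theorem wedge_self (x : Plane) : wedge x x = 0 := by
  rw [wedge_apply]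
  ring

theorem wedge_comm (x y : Plane) : wedge x y = -wedge y x := by
  simp only [wedge_apply]
  ring

/-- A closed curve all of whose points are seen from each of its points in counterclockwise
order. -/
structure IsConvexCurve (γ : ℝ → Plane) : Prop where
  contDiff : ContDiff ℝ 1 γ
  periodic : Function.Periodic γ (2 * Real.pi)
  wedge_pos : ∀ φ t, φ < t → t < φ + 2 * Real.pi → 0 < wedge (γ t - γ φ) (deriv γ t)

namespace IsConvexCurve

variable {γ : ℝ → Plane} {φ : ℝ}

theorem hasDerivAt (hγ : IsConvexCurve γ) (t : ℝ) : HasDerivAt γ (deriv γ t) t :=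
  (hγ.contDiff.differentiable (by simp) t).hasDerivAt

theorem continuous_deriv (hγ : IsConvexCurve γ) : Continuous (deriv γ) :=
  hγ.contDiff.continuous_deriv (by simp)

theorem deriv_add_two_pi (hγ : IsConvexCurve γ) (t : ℝ) :
    deriv γ (t + 2 * Real.pi) = deriv γ t := by
  rw [← deriv_comp_add_const]
  congr 1
  exact funext hγ.periodic

theorem wedge_deriv_pos (hγ : IsConvexCurve γ) {t : ℝ} (ht : t ∈ Ioo φ (φ + 2 * Real.pi)) :
    0 < wedge (deriv γ φ) (γ t - γ φ) := by
  have h := hγ.wedge_pos t (φ + 2 * Real.pi) ht.2 (by linarith [ht.1])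
  rw [hγ.deriv_add_two_pi, hγ.periodic, wedge_comm] at h
  rw [← neg_sub, map_neg]
  exact h

theorem wedge_chords_pos (hγ : IsConvexCurve γ) {s t : ℝ} (hs : s ∈ Ioo φ (φ + 2 * Real.pi))
    (ht : t ∈ Ioo φ (φ + 2 * Real.pi)) (hst : s < t) : 0 < wedge (γ s - γ φ) (γ t - γ φ) := by
  have hd : ∀ y (z : Plane), HasDerivAt (fun y => wedge z (γ y - γ φ)) (wedge z (deriv γ y)) y :=
    fun y z => (wedge z).hasFDerivAt.comp_hasDerivAt y ((hγ.hasDerivAt y).sub_const _)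
  have hq : ∀ y ∈ Ioo φ (φ + 2 * Real.pi), HasDerivAt
      (fun y => wedge (γ s - γ φ) (γ y - γ φ) / wedge (deriv γ φ) (γ y - γ φ)) _ y := fun y hy =>
    (hd y _).div (hd y _) (hγ.wedge_deriv_pos hy).ne'
  have hmono : StrictMonoOn
      (fun y => wedge (γ s - γ φ) (γ y - γ φ) / wedge (deriv γ φ) (γ y - γ φ))
      (Ioo φ (φ + 2 * Real.pi)) := by
    refine strictMonoOn_of_deriv_pos (convex_Ioo _ _)
      (fun y hy => (hq y hy).continuousAt.continuousWithinAt) fun y hy => ?_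
    rw [interior_Ioo] at hy
    rw [(hq y hy).deriv]
    have h1 := hγ.wedge_deriv_pos hy
    refine div_pos ?_ (by positivity)
    have h2 : wedge (γ s - γ φ) (deriv γ y) * wedge (deriv γ φ) (γ y - γ φ) -
        wedge (γ s - γ φ) (γ y - γ φ) * wedge (deriv γ φ) (deriv γ y) =
        wedge (deriv γ φ) (γ s - γ φ) * wedge (γ y - γ φ) (deriv γ y) := by
      simp only [wedge_apply]
      ring
    rw [h2]
    exact mul_pos (hγ.wedge_deriv_pos hs) (hγ.wedge_pos φ y hy.1 hy.2)
  have := hmono hs ht hst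
  simp only [wedge_self, zero_div] at this
  exact (div_pos_iff_of_pos_right (hγ.wedge_deriv_pos ht)).1 this

theorem chord_ne_zero (hγ : IsConvexCurve γ) {t : ℝ} (ht : t ∈ Ioo φ (φ + 2 * Real.pi)) :
    γ t - γ φ ≠ 0 := by
  intro h
  have := hγ.wedge_deriv_pos ht
  simp [h] at this

theorem chord_injOn (hγ : IsConvexCurve γ) {u v s t : ℝ} (hu : 0 < u) (hv : 0 < v)
    (hs : s ∈ Ioo φ (φ + 2 * Real.pi))
    (ht : t ∈ Ioo φ (φ + 2 * Real.pi)) (h : u • (γ s - γ φ) = v • (γ t - γ φ)) :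
    u = v ∧ s = t := by
  have h0 : wedge (u • (γ s - γ φ)) (v • (γ t - γ φ)) = 0 := by rw [h, wedge_self]
  simp only [map_smul, smul_apply, smul_eq_mul, mul_eq_zero, hu.ne', hv.ne',
    false_or] at h0
  have hst : s = t := by
    rcases lt_trichotomy s t with hst | hst | hst
    · exact absurd h0 (hγ.wedge_chords_pos hs ht hst).ne'
    · exact hst
    · rw [wedge_comm, neg_eq_zero] at h0
      exact absurd h0 (hγ.wedge_chords_pos ht hs hst).ne'
  subst hst
  exact ⟨smul_left_injective ℝ (hγ.chord_ne_zero hs) h, rfl⟩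

variable (φ)

theorem exists_mem_Ico (hγ : IsConvexCurve γ) (x : Plane) (hx : x ∈ range γ) :
    ∃ t ∈ Ico φ (φ + 2 * Real.pi), γ t = x := by
  obtain ⟨s, rfl⟩ := hx
  obtain ⟨t, ht, h⟩ := hγ.periodic.exists_mem_Ico Real.two_pi_pos s φ
  exact ⟨t, ht, h.symm⟩

/-- The map `(u, t) ↦ γ(φ) + u (γ(t) - γ(φ))`, sweeping out the interior of a convex curve. -/
def _root_.sweep (γ : ℝ → Plane) (φ : ℝ) (z : ℝ × ℝ) : Plane := γ φ + z.1 • (γ z.2 - γ φ)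

theorem sweep_injOn (hγ : IsConvexCurve γ) :
    InjOn (sweep γ φ) (Ioi 0 ×ˢ Ioo φ (φ + 2 * Real.pi)) := by
  rintro ⟨u, s⟩ ⟨hu, hs⟩ ⟨v, t⟩ ⟨hv, ht⟩ h
  obtain ⟨h1, h2⟩ := hγ.chord_injOn hu hv hs ht (add_left_cancel h)
  simp only at h1 h2
  rw [h1, h2]

theorem sweep_notMem_range (hγ : IsConvexCurve γ) {z : ℝ × ℝ}
    (hz : z ∈ Ioo 0 1 ×ˢ Ioo φ (φ + 2 * Real.pi)) :
    sweep γ φ z ∉ range γ := by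
  obtain ⟨u, s⟩ := z
  obtain ⟨⟨hu, hu1⟩, hs⟩ := hz
  intro hmem
  obtain ⟨t, ht, h⟩ := hγ.exists_mem_Ico φ _ hmem
  have h' : u • (γ s - γ φ) = (1 : ℝ) • (γ t - γ φ) := by
    rw [h, sweep]
    simp
  rcases ht.1.eq_or_lt with h0 | h0
  · subst h0
    rw [sub_self, smul_zero, smul_eq_zero] at h'
    exact h'.elim hu.ne' (hγ.chord_ne_zero hs)
  · exact hu1.ne (hγ.chord_injOn hu one_pos hs ⟨h0, ht.2⟩ h').1

theorem isOpen_sweep (hγ : IsConvexCurve γ) :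
    IsOpen (sweep γ φ '' (Ioo 0 1 ×ˢ Ioo φ (φ + 2 * Real.pi))) := by
  rw [isOpen_iff_mem_nhds]
  rintro _ ⟨⟨u, t⟩, ⟨⟨hu, hu1⟩, ht⟩, rfl⟩
  have hc : ContDiff ℝ 1 (sweep γ φ) := by
    have := hγ.contDiff
    unfold sweep
    fun_prop
  have hd := hc.contDiffAt.hasStrictFDerivAt (x := (u, t)) (by simp)
  have hd1 : HasDerivAt (fun u => sweep γ φ (u, t)) (γ t - γ φ) u := by
    simpa [sweep] using ((hasDerivAt_id u).smul_const (γ t - γ φ)).const_add (γ φ)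
  have hd2 : HasDerivAt (fun t => sweep γ φ (u, t)) (u • deriv γ t) t :=
    (((hγ.hasDerivAt t).sub_const _).const_smul u).const_add _
  have e1 := hd1.unique (hd.hasFDerivAt.comp_hasDerivAt (f := fun u => (u, t)) u
    ((hasDerivAt_id' u).prodMk (hasDerivAt_const u t)))
  have e2 := hd2.unique (hd.hasFDerivAt.comp_hasDerivAt (f := fun t => (u, t)) t
    ((hasDerivAt_const t u).prodMk (hasDerivAt_id' t)))
  rw [← hd.map_nhds_eq_of_surj]
  · exact image_mem_map ((isOpen_Ioo.prod isOpen_Ioo).mem_nhds ⟨⟨hu, hu1⟩, ht⟩)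
  · rw [LinearMap.range_eq_top]
    intro v
    set J := wedge (γ t - γ φ) (deriv γ t) with hJ
    have hJ0 : 0 < J := hγ.wedge_pos φ t ht.1 ht.2
    refine ⟨(wedge v (deriv γ t) / J, wedge (γ t - γ φ) v / (u * J)), ?_⟩
    have hs : ((wedge v (deriv γ t) / J, wedge (γ t - γ φ) v / (u * J)) : ℝ × ℝ) =
        (wedge v (deriv γ t) / J) • ((1 : ℝ), (0 : ℝ)) +
          (wedge (γ t - γ φ) v / (u * J)) • ((0 : ℝ), (1 : ℝ)) := by simp
    rw [ContinuousLinearMap.coe_coe, hs, map_add, map_smul, map_smul, ← e1, ← e2, smul_smul]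
    have hk : wedge (γ t - γ φ) v / (u * J) * u = wedge (γ t - γ φ) v / J := by
      field_simp
    rw [hk]
    rw [wedge_apply] at hJ
    ext i
    simp only [PiLp.add_apply, PiLp.smul_apply, smul_eq_mul, wedge_apply]
    field_simp
    fin_cases i
    · simp only [Fin.zero_eta, hJ]
      ring
    · simp only [Fin.mk_one, hJ]
      ring

theorem curveInterior_eq (hγ : IsConvexCurve γ) :
    curveInterior γ = sweep γ φ '' (Ioo 0 1 ×ˢ Ioo φ (φ + 2 * Real.pi)) := by
  set U := sweep γ φ '' (Ioo 0 1 ×ˢ Ioo φ (φ + 2 * Real.pi)) with hU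
  have hcont : Continuous (sweep γ φ) := by
    have := hγ.contDiff.continuous
    unfold sweep
    fun_prop
  set C := sweep γ φ '' (Icc 0 1 ×ˢ Icc φ (φ + 2 * Real.pi)) with hC
  have hCc : IsCompact C := (isCompact_Icc.prod isCompact_Icc).image hcont
  have hUC : U ⊆ C := image_mono (prod_mono Ioo_subset_Icc_self Ioo_subset_Icc_self)
  have hCU : C ⊆ U ∪ range γ := by
    rintro _ ⟨⟨u, t⟩, ⟨⟨hu0, hu1⟩, ⟨ht0, ht1⟩⟩, rfl⟩
    simp only at hu0 hu1 ht0 ht1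
    rcases hu0.eq_or_lt with h | hu0
    · exact Or.inr ⟨φ, by simp [sweep, ← h]⟩
    rcases hu1.eq_or_lt with h | hu1
    · exact Or.inr ⟨t, by simp [sweep, h]⟩
    rcases ht0.eq_or_lt with h | ht0
    · exact Or.inr ⟨φ, by simp [sweep, ← h]⟩
    rcases ht1.eq_or_lt with h | ht1
    · exact Or.inr ⟨φ, by simp [sweep, h, hγ.periodic φ]⟩
    exact Or.inl ⟨(u, t), ⟨⟨hu0, hu1⟩, ⟨ht0, ht1⟩⟩, rfl⟩
  ext x
  constructor
  · rintro ⟨hx, hb⟩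
    by_contra hxU
    have hray : ((fun s : ℝ => γ φ + s • (x - γ φ)) '' Ici 1) ⊆ (range γ)ᶜ := by
      rintro _ ⟨s, hs, rfl⟩ hmem
      have hs0 : 0 < s := zero_lt_one.trans_le hs
      obtain ⟨t, ht, h⟩ := hγ.exists_mem_Ico φ _ hmem
      have h' : x = γ φ + s⁻¹ • (γ t - γ φ) := by
        rw [h, add_sub_cancel_left, smul_smul, inv_mul_cancel₀ hs0.ne', one_smul]
        abel
      rcases ht.1.eq_or_lt with h0 | h0
      · subst h0
        exact hx ⟨φ, by rw [h', sub_self, smul_zero, add_zero]⟩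
      · rcases (show (1 : ℝ) ≤ s from hs).eq_or_lt with h1 | h1
        · exact hx ⟨t, by rw [h', ← h1]; simp⟩
        · exact hxU ⟨(s⁻¹, t), ⟨⟨by positivity, inv_lt_one_of_one_lt₀ h1⟩, ⟨h0, ht.2⟩⟩, h'.symm⟩
    have hpre : IsPreconnected ((fun s : ℝ => γ φ + s • (x - γ φ)) '' Ici 1) :=
      isPreconnected_Ici.image _ (by fun_prop)
    have hb' := hb.subset (hpre.subset_connectedComponentIn ⟨1, self_mem_Ici, by simp⟩ hray)
    have hne : 0 < ‖x - γ φ‖ := norm_pos_iff.2 (sub_ne_zero.2 fun h => hx ⟨φ, h.symm⟩)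
    obtain ⟨M, hM⟩ := hb'.exists_norm_le
    have h1 : (1 : ℝ) ≤ (|M| + ‖γ φ‖ + 1) / ‖x - γ φ‖ + 1 := by
      have : 0 ≤ (|M| + ‖γ φ‖ + 1) / ‖x - γ φ‖ := by positivity
      linarith
    have h2 := hM _ ⟨_, h1, rfl⟩
    have h3 : ‖((|M| + ‖γ φ‖ + 1) / ‖x - γ φ‖ + 1) • (x - γ φ)‖ =
        |M| + ‖γ φ‖ + 1 + ‖x - γ φ‖ := by
      rw [norm_smul, Real.norm_of_nonneg (by linarith), add_mul, one_mul,
        div_mul_cancel₀ _ hne.ne']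
    have h4 := norm_sub_norm_le (((|M| + ‖γ φ‖ + 1) / ‖x - γ φ‖ + 1) • (x - γ φ)) (-γ φ)
    rw [sub_neg_eq_add, norm_neg, add_comm _ (γ φ), h3] at h4
    linarith [le_abs_self M]
  · intro hx
    have hxr : x ∉ range γ := by
      obtain ⟨z, hz, rfl⟩ := hx
      exact hγ.sweep_notMem_range φ hz
    refine ⟨hxr, hCc.isBounded.subset (Subset.trans ?_ hUC)⟩
    refine IsPreconnected.subset_left_of_subset_union (hγ.isOpen_sweep φ) hCc.isClosed.isOpen_compl
      (disjoint_compl_right_iff_subset.2 hUC) (fun y hy => ?_)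
      ⟨x, mem_connectedComponentIn hxr, hx⟩ isPreconnected_connectedComponentIn
    by_cases hyC : y ∈ C
    · exact Or.inl ((hCU hyC).resolve_right (connectedComponentIn_subset _ _ hy))
    · exact Or.inr hyC

end IsConvexCurve

/-- The weight with which a boundary point at position `x` relative to the centre of a disk of
radius `r` contributes to the area of the part of the disk swept out by segments from the
centre. -/
noncomputable def diskWeight (r : ℝ) (x : Plane) : ℝ := if ‖x‖ < r then 1 else r ^ 2 / ‖x‖ ^ 2

theorem measurable_diskWeight (r : ℝ) : Measurable (diskWeight r) := by
  unfold diskWeight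
  exact Measurable.ite (measurableSet_lt (by fun_prop) (by fun_prop)) measurable_const
    (by fun_prop)

theorem diskWeight_nonneg (r : ℝ) (x : Plane) : 0 ≤ diskWeight r x := by
  unfold diskWeight
  split_ifs <;> positivity

theorem diskWeight_eq_sq {r : ℝ} {x : Plane} (hx : x ≠ 0) :
    diskWeight r x = (min 1 (r / ‖x‖)) ^ 2 := by
  have hx' : 0 < ‖x‖ := norm_pos_iff.2 hx
  unfold diskWeight
  split_ifs with h
  · rw [min_eq_left ((one_le_div hx').2 h.le), one_pow]
  · rw [min_eq_right ((div_le_one hx').2 (not_lt.1 h)), div_pow]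

theorem measurePreserving_toPlane :
    MeasurePreserving (fun z : ℝ × ℝ => (!₂[z.1, z.2] : Plane)) := by
  have h1 := (volume_preserving_finTwoArrow ℝ).symm
  have h2 := PiLp.volume_preserving_toLp (Fin 2)
  have h3 := h2.comp h1
  have h4 : (fun z : ℝ × ℝ => (!₂[z.1, z.2] : Plane)) =
      (WithLp.toLp 2) ∘ (MeasurableEquiv.finTwoArrow (α := ℝ)).symm := by
    funext z
    ext i
    fin_cases i <;> simp [MeasurableEquiv.finTwoArrow]
  rw [h4]
  exact h3

theorem lintegral_Ioo_linear {a c : ℝ} (ha : 0 ≤ a) (hc : 0 ≤ c) :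
    ∫⁻ u in Ioo 0 a, ENNReal.ofReal (u * c) = ENNReal.ofReal (1 / 2 * a ^ 2 * c) := by
  rw [← ofReal_integral_eq_lintegral_ofReal]
  · congr 1
    rw [← integral_Ioc_eq_integral_Ioo, ← intervalIntegral.integral_of_le ha,
      intervalIntegral.integral_mul_const, integral_id]
    ring
  · exact (Continuous.integrableOn_Icc (a := 0) (b := a) (by fun_prop)).mono_set
      Ioo_subset_Icc_self
  · filter_upwards [ae_restrict_mem measurableSet_Ioo] with u hu
    exact mul_nonneg hu.1.le hc

namespace IsConvexCurve

variable {γ : ℝ → Plane}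

theorem volume_sweep (hγ : IsConvexCurve γ) (φ : ℝ) {D : Set (ℝ × ℝ)} (hD : MeasurableSet D)
    (hsub : D ⊆ Ioi 0 ×ˢ Ioo φ (φ + 2 * Real.pi)) :
    volume (sweep γ φ '' D) =
      ∫⁻ z in D, ENNReal.ofReal (z.1 * wedge (γ z.2 - γ φ) (deriv γ z.2)) := by
  set Ψ : ℝ × ℝ → ℝ × ℝ := fun z => (sweep γ φ z 0, sweep γ φ z 1) with hΨ
  have hcomp : ∀ z, !₂[(Ψ z).1, (Ψ z).2] = sweep γ φ z := fun z => by
    ext i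
    fin_cases i <;> simp [hΨ]
  have hinj : Function.Injective fun z : ℝ × ℝ => (!₂[z.1, z.2] : Plane) := by
    intro x y h
    have h0 := congrArg (fun v : Plane => v 0) h
    have h1 := congrArg (fun v : Plane => v 1) h
    simp at h0 h1
    exact Prod.ext h0 h1
  have himg : sweep γ φ '' D = (fun z : ℝ × ℝ => (!₂[z.1, z.2] : Plane)) '' (Ψ '' D) := by
    rw [image_image]
    exact image_congr fun z _ => (hcomp z).symm
  have hΨinj : InjOn Ψ D := fun x hx y hy h => by
    refine hγ.sweep_injOn φ (hsub hx) (hsub hy) ?_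
    rw [← hcomp, ← hcomp, h]
  set Ψ' : ℝ × ℝ → (ℝ × ℝ →L[ℝ] ℝ × ℝ) := fun z =>
    (Matrix.toLin (.finTwoProd ℝ) (.finTwoProd ℝ)
      !![(γ z.2 - γ φ) 0, z.1 * deriv γ z.2 0;
        (γ z.2 - γ φ) 1, z.1 * deriv γ z.2 1]).toContinuousLinearMap with hΨ'
  have hder : ∀ z, HasFDerivAt Ψ (Ψ' z) z := by
    intro z
    have hcoord : ∀ i, HasFDerivAt (fun z => sweep γ φ z i)
        ((γ z.2 - γ φ) i • ContinuousLinearMap.fst ℝ ℝ ℝ +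
          (z.1 * deriv γ z.2 i) • ContinuousLinearMap.snd ℝ ℝ ℝ) z := by
      intro i
      have h1 : HasDerivAt (fun t => (γ t - γ φ) i) (deriv γ z.2 i) z.2 :=
        (EuclideanSpace.proj (𝕜 := ℝ) i).hasFDerivAt.comp_hasDerivAt z.2
          ((hγ.hasDerivAt z.2).sub_const (γ φ))
      have h2 := (hasFDerivAt_fst (𝕜 := ℝ) (p := z)).mul (h1.comp_hasFDerivAt z hasFDerivAt_snd)
      have h3 := h2.const_add (γ φ i)
      refine (h3.congr_fderiv ?_).congr_of_eventuallyEq (Eventually.of_forall fun y => ?_)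
      · ext <;> simp
      · simp [sweep]
    simp only [hΨ']
    rw [Matrix.toLin_finTwoProd_toContinuousLinearMap]
    exact (hcoord 0).prodMk (hcoord 1)
  have hdet : ∀ z, (Ψ' z).det = z.1 * wedge (γ z.2 - γ φ) (deriv γ z.2) := by
    intro z
    simp only [hΨ', LinearMap.det_toContinuousLinearMap, LinearMap.det_toLin,
      Matrix.det_fin_two_of, wedge_apply]
    ring
  have hmeasure : volume (sweep γ φ '' D) = volume (Ψ '' D) := by
    have hmeas : MeasurableSet (sweep γ φ '' D) := by
      refine hD.image_of_continuousOn_injOn ?_ ((hγ.sweep_injOn φ).mono hsub)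
      have := hγ.contDiff.continuous
      unfold sweep
      fun_prop
    rw [← measurePreserving_toPlane.measure_preimage hmeas.nullMeasurableSet, himg,
      hinj.preimage_image]
  rw [hmeasure, ← lintegral_abs_det_fderiv_eq_addHaar_image volume hD
    (fun z _ => (hder z).hasFDerivWithinAt) hΨinj]
  refine setLIntegral_congr_fun hD fun z hz => ?_
  obtain ⟨h1, h2⟩ := hsub hz
  rw [hdet, abs_of_pos (mul_pos h1 (hγ.wedge_pos φ z.2 h2.1 h2.2))]

/-- The area of the part of the interior of a convex curve in a disk centred on the curve. -/
theorem circularInvariant_eq (hγ : IsConvexCurve γ) {r : ℝ} (hr : 0 < r) (φ : ℝ) :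
    circularInvariant r γ φ = ∫ t in φ..φ + 2 * Real.pi,
      1 / 2 * diskWeight r (γ t - γ φ) * wedge (γ t - γ φ) (deriv γ t) := by
  have hcγ : Continuous γ := hγ.contDiff.continuous
  have hcγ' : Continuous (deriv γ) := hγ.continuous_deriv
  set D : Set (ℝ × ℝ) := {z | z ∈ Ioo 0 1 ×ˢ Ioo φ (φ + 2 * Real.pi) ∧
    z.1 * ‖γ z.2 - γ φ‖ < r} with hDdef
  have hset : Metric.ball (γ φ) r ∩ curveInterior γ = sweep γ φ '' D := by
    rw [hγ.curveInterior_eq φ]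
    ext x
    constructor
    · rintro ⟨hx, z, hz, rfl⟩
      refine ⟨z, ⟨hz, ?_⟩, rfl⟩
      have h0 : 0 < z.1 := hz.1.1
      rw [mem_ball_iff_norm, sweep, add_sub_cancel_left, norm_smul, Real.norm_of_nonneg h0.le] at hx
      exact hx
    · rintro ⟨z, ⟨hz, hzr⟩, rfl⟩
      refine ⟨?_, z, hz, rfl⟩
      have h0 : 0 < z.1 := hz.1.1
      rw [mem_ball_iff_norm, sweep, add_sub_cancel_left, norm_smul, Real.norm_of_nonneg h0.le]
      exact hzr
  have hD : MeasurableSet D :=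
    ((measurableSet_Ioo.prod measurableSet_Ioo).inter
      (measurableSet_lt (f := fun z : ℝ × ℝ => z.1 * ‖γ z.2 - γ φ‖)
        (Continuous.measurable (by fun_prop)) measurable_const))
  have hsub : D ⊆ Ioi 0 ×ˢ Ioo φ (φ + 2 * Real.pi) := fun z hz => ⟨hz.1.1.1, hz.1.2⟩
  have hvol : volume (sweep γ φ '' D) = ∫⁻ t in Ioo φ (φ + 2 * Real.pi), ENNReal.ofReal
      (1 / 2 * diskWeight r (γ t - γ φ) * wedge (γ t - γ φ) (deriv γ t)) := by
    have hJ : Measurable fun z : ℝ × ℝ =>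
        ENNReal.ofReal (z.1 * wedge (γ z.2 - γ φ) (deriv γ z.2)) := by
      refine ENNReal.measurable_ofReal.comp (Continuous.measurable ?_)
      fun_prop
    rw [hγ.volume_sweep φ hD hsub, ← lintegral_indicator hD, Measure.volume_eq_prod,
      lintegral_prod_symm _ (hJ.indicator hD).aemeasurable, ← lintegral_indicator measurableSet_Ioo]
    refine lintegral_congr fun t => ?_
    by_cases ht : t ∈ Ioo φ (φ + 2 * Real.pi)
    · have hne := hγ.chord_ne_zero ht
      have hpos : 0 < ‖γ t - γ φ‖ := norm_pos_iff.2 hne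
      rw [indicator_of_mem ht, diskWeight_eq_sq hne,
        ← lintegral_Ioo_linear (by positivity) (hγ.wedge_pos φ t ht.1 ht.2).le,
        ← lintegral_indicator measurableSet_Ioo]
      refine lintegral_congr fun u => ?_
      have hiff : (u, t) ∈ D ↔ u ∈ Ioo 0 (min 1 (r / ‖γ t - γ φ‖)) := by
        simp only [hDdef, mem_ofPred_eq, mem_prod, mem_Ioo, lt_min_iff, lt_div_iff₀ hpos]
        exact ⟨fun h => ⟨h.1.1.1, h.1.1.2, h.2⟩, fun h => ⟨⟨⟨h.1, h.2.1⟩, ht⟩, h.2.2⟩⟩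
      by_cases hu : (u, t) ∈ D
      · rw [indicator_of_mem hu, indicator_of_mem (hiff.1 hu)]
      · rw [indicator_of_notMem hu, indicator_of_notMem fun h => hu (hiff.2 h)]
    · rw [indicator_of_notMem ht]
      refine (lintegral_congr fun u => ?_).trans lintegral_zero
      exact indicator_of_notMem (fun h => ht h.1.2) _
  rw [circularInvariant, hset, hvol, intervalIntegral.integral_of_le (by linarith [Real.pi_pos]),
    integral_Ioc_eq_integral_Ioo, integral_eq_lintegral_of_nonneg_ae]
  · filter_upwards [ae_restrict_mem measurableSet_Ioo] with t ht
    exact mul_nonneg (mul_nonneg (by norm_num) (diskWeight_nonneg r _))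
      (hγ.wedge_pos φ t ht.1 ht.2).le
  · refine Measurable.aestronglyMeasurable ?_
    have h1 : Measurable fun t => diskWeight r (γ t - γ φ) :=
      (measurable_diskWeight r).comp (by fun_prop)
    have h2 : Measurable fun t => wedge (γ t - γ φ) (deriv γ t) :=
      Continuous.measurable (by fun_prop)
    exact (h1.const_mul _).mul h2

end IsConvexCurve

section Tube

variable {X : Type*} [TopologicalSpace X]

theorem eventually_forall_pos_of_periodic {Q : X × ℝ × ℝ → ℝ} (hQ : Continuous Q)
    (hper : ∀ x φ θ, Q (x, φ + 2 * Real.pi, θ) = Q (x, φ, θ)) {K : Set ℝ} (hK : IsCompact K)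
    {x₀ : X} (h : ∀ φ, ∀ θ ∈ K, 0 < Q (x₀, φ, θ)) :
    ∀ᶠ x in 𝓝 x₀, ∀ φ, ∀ θ ∈ K, 0 < Q (x, φ, θ) := by
  have h1 : ∀ᶠ x in 𝓝 x₀, ∀ p ∈ Icc 0 (2 * Real.pi) ×ˢ K, 0 < Q (x, p) := by
    refine (isCompact_Icc.prod hK).eventually_forall_of_forall_eventually fun p hp => ?_
    exact hQ.continuousAt.eventually (lt_mem_nhds (h p.1 p.2 hp.2))
  filter_upwards [h1] with x hx φ θ hθ
  obtain ⟨ψ, hψ, he⟩ := (show Function.Periodic (fun φ => Q (x, φ, θ)) (2 * Real.pi) from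
    fun φ => hper x φ θ).exists_mem_Ico₀ Real.two_pi_pos φ
  rw [he]
  exact hx (ψ, θ) ⟨⟨hψ.1, hψ.2.le⟩, hθ⟩

end Tube

namespace Ck

variable {m : ℕ}

theorem contDiff_deriv_eval (m : ℕ) :
    ContDiff ℝ m fun p : Ck (m + 1) Plane × ℝ => deriv p.1 p.2 :=
  (contDiff_eval (E := Plane) m).comp
    (((derivL m Plane).contDiff.comp contDiff_fst).prodMk contDiff_snd)

theorem continuous_deriv_deriv_eval (m : ℕ) :
    Continuous fun p : Ck (m + 2) Plane × ℝ => deriv (deriv p.1) p.2 :=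
  (contDiff_deriv_eval m).continuous.comp
    ((((derivL (m + 1) Plane).continuous.comp continuous_fst)).prodMk continuous_snd)

theorem hasDerivAt (γ : Ck (m + 1) Plane) (t : ℝ) : HasDerivAt γ (deriv γ t) t :=
  (γ.differentiable t).hasDerivAt

theorem hasDerivAt_deriv (γ : Ck (m + 2) Plane) (t : ℝ) :
    HasDerivAt (deriv γ) (deriv (deriv γ) t) t :=
  (derivL (m + 1) Plane γ).hasDerivAt t

end Ck

/-- A `C²` curve whose tangent turns counterclockwise on short arcs and which sees its far points
in counterclockwise order is convex. -/
theorem isConvexCurve_of_wedge {m : ℕ} {γ : Ck (m + 2) Plane}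
    (h1 : ∀ s v, |v - s| ≤ 1 → 0 < wedge (deriv γ s) (deriv (deriv γ) v))
    (h2 : ∀ φ, ∀ θ ∈ Icc 1 (2 * Real.pi - 1), 0 < wedge (γ (φ + θ) - γ φ) (deriv γ (φ + θ))) :
    IsConvexCurve γ := by
  have hturn : ∀ s t, s < t → t ≤ s + 1 → 0 < wedge (deriv γ s) (deriv γ t) := by
    intro s t hst hts
    have hd : ∀ v, HasDerivAt (fun v => wedge (deriv γ s) (deriv γ v))
        (wedge (deriv γ s) (deriv (deriv γ) v)) v := fun v =>
      (wedge (deriv γ s)).hasFDerivAt.comp_hasDerivAt v (γ.hasDerivAt_deriv v)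
    have := strictMonoOn_of_deriv_pos (convex_Icc s t)
      (fun v _ => (hd v).continuousAt.continuousWithinAt) (fun v hv => by
        rw [interior_Icc] at hv
        rw [(hd v).deriv]
        exact h1 s v (by rw [abs_le]; constructor <;> linarith [hv.1, hv.2]))
      (left_mem_Icc.2 hst.le) (right_mem_Icc.2 hst.le) hst
    simpa [wedge_self] using this
  have hchord : ∀ t s, HasDerivAt (fun s => wedge (γ t - γ s) (deriv γ t))
      (wedge (deriv γ t) (deriv γ s)) s := fun t s => by
    have := (wedge (deriv γ t)).hasFDerivAt.comp_hasDerivAt s ((γ.hasDerivAt s).sub_const (γ t))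
    refine this.congr_of_eventuallyEq (Eventually.of_forall fun y => ?_)
    simp only [Function.comp_apply]
    rw [wedge_comm, ← map_neg, neg_sub]
  refine ⟨γ.contDiff.of_le (by norm_cast; omega), γ.periodic, fun φ t h0 h3 => ?_⟩
  rcases le_total t (φ + 1) with ht | ht
  · have := strictAntiOn_of_deriv_neg (convex_Icc φ t)
      (fun v _ => (hchord t v).continuousAt.continuousWithinAt) (fun v hv => by
        rw [interior_Icc] at hv
        rw [(hchord t v).deriv, wedge_comm, neg_lt_zero]
        exact hturn v t hv.2 (by linarith [hv.1]))
      (left_mem_Icc.2 h0.le) (right_mem_Icc.2 h0.le) h0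
    simpa using this
  rcases le_total t (φ + (2 * Real.pi - 1)) with ht' | ht'
  · have := h2 φ (t - φ) ⟨by linarith, by linarith⟩
    rwa [add_sub_cancel] at this
  · have := strictMonoOn_of_deriv_pos (convex_Icc t (φ + 2 * Real.pi))
      (fun v _ => (hchord t v).continuousAt.continuousWithinAt) (fun v hv => by
        rw [interior_Icc] at hv
        rw [(hchord t v).deriv]
        exact hturn t v hv.1 (by linarith [hv.2]))
      (left_mem_Icc.2 h3.le) (right_mem_Icc.2 h3.le) h3
    simpa [γ.periodic φ] using this

/-- The conditions on a curve near a circle under which disks of radius `r` centred on the curve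
meet it transversally in exactly two points, at parameter distances between `α` and `β`. -/
structure IsNearCircle (r α β : ℝ) {n : ℕ} (γ : Ck n Plane) : Prop where
  isConvexCurve : IsConvexCurve γ
  norm_lt : ∀ φ, ∀ θ ∈ Icc (-α) α, ‖γ (φ + θ) - γ φ‖ ^ 2 < r ^ 2
  lt_norm : ∀ φ, ∀ θ ∈ Icc β (2 * Real.pi - β), r ^ 2 < ‖γ (φ + θ) - γ φ‖ ^ 2
  inner_pos : ∀ φ, ∀ θ ∈ Icc α β, 0 < inner ℝ (γ (φ + θ) - γ φ) (deriv γ (φ + θ))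
  inner_neg : ∀ φ, ∀ θ ∈ Icc α β, inner ℝ (γ (φ - θ) - γ φ) (deriv γ (φ - θ)) < 0

section Circle

variable (n : ℕ) (R : ℝ)

theorem circleCurve_apply (φ : ℝ) :
    circleCurve n R φ = !₂[1 - R + R * Real.cos φ, R * Real.sin φ] := rfl

theorem deriv_circleCurve (φ : ℝ) :
    deriv (circleCurve n R) φ = !₂[-(R * Real.sin φ), R * Real.cos φ] :=
  (circleCurve_hasDerivAt n R φ).deriv

theorem deriv_deriv_circleCurve (φ : ℝ) :
    deriv (deriv (circleCurve n R)) φ = !₂[-(R * Real.cos φ), -(R * Real.sin φ)] := by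
  have h : deriv (circleCurve n R) = fun φ => !₂[-(R * Real.sin φ), R * Real.cos φ] :=
    funext fun φ => deriv_circleCurve n R φ
  rw [h]
  refine HasDerivAt.deriv ?_
  refine (hasStrictFDerivAt_euclidean.2 fun i => ?_).hasFDerivAt
  fin_cases i
  · refine ((Real.hasStrictDerivAt_sin φ).const_mul R).neg.hasStrictFDerivAt.congr_fderiv ?_
    ext
    simp
  · refine ((Real.hasStrictDerivAt_cos φ).const_mul R).hasStrictFDerivAt.congr_fderiv ?_
    ext
    simp

theorem norm_sq_circleCurve_sub (φ θ : ℝ) :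
    ‖circleCurve n R (φ + θ) - circleCurve n R φ‖ ^ 2 = 2 * R ^ 2 * (1 - Real.cos θ) := by
  rw [EuclideanSpace.norm_sq_eq, Fin.sum_univ_two]
  simp only [circleCurve_apply, PiLp.sub_apply, Real.norm_eq_abs, sq_abs, Real.cos_add,
    Real.sin_add]
  simp
  linear_combination (R ^ 2 * (Real.cos θ ^ 2 + Real.sin θ ^ 2 - 2 * Real.cos θ + 1)) *
    Real.sin_sq_add_cos_sq φ + R ^ 2 * Real.sin_sq_add_cos_sq θ

theorem inner_circleCurve (φ θ : ℝ) :
    inner ℝ (circleCurve n R (φ + θ) - circleCurve n R φ) (deriv (circleCurve n R) (φ + θ)) =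
      R ^ 2 * Real.sin θ := by
  rw [deriv_circleCurve]
  simp only [PiLp.inner_apply, Fin.sum_univ_two, circleCurve_apply, PiLp.sub_apply]
  simp
  have h : Real.sin θ = Real.sin (φ + θ) * Real.cos φ - Real.cos (φ + θ) * Real.sin φ := by
    rw [← Real.sin_sub]
    ring_nf
  rw [h]
  ring

theorem wedge_circleCurve (φ θ : ℝ) :
    wedge (circleCurve n R (φ + θ) - circleCurve n R φ) (deriv (circleCurve n R) (φ + θ)) =
      R ^ 2 * (1 - Real.cos θ) := by
  rw [deriv_circleCurve, wedge_apply]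
  simp [circleCurve_apply]
  have h : Real.cos θ = Real.cos (φ + θ) * Real.cos φ + Real.sin (φ + θ) * Real.sin φ := by
    rw [← Real.cos_sub]
    ring_nf
  rw [h]
  linear_combination R ^ 2 * Real.sin_sq_add_cos_sq (φ + θ)

theorem wedge_deriv_circleCurve (s v : ℝ) :
    wedge (deriv (circleCurve n R) s) (deriv (deriv (circleCurve n R)) v) =
      R ^ 2 * Real.cos (v - s) := by
  rw [deriv_circleCurve, deriv_deriv_circleCurve, wedge_apply, Real.cos_sub]
  simp
  ring

variable {R}

theorem eventually_isConvexCurve (m : ℕ) (hR : 0 < R) :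
    ∀ᶠ γ : Ck (m + 2) Plane in 𝓝 (circleCurve (m + 2) R), IsConvexCurve γ := by
  have c0 := (Ck.contDiff_eval (E := Plane) (m + 2)).continuous
  have c1 := (Ck.contDiff_deriv_eval (m + 1)).continuous
  have c2 := Ck.continuous_deriv_deriv_eval m
  have e1 : ∀ᶠ γ : Ck (m + 2) Plane in 𝓝 (circleCurve (m + 2) R), ∀ φ, ∀ θ ∈ Icc (-1 : ℝ) 1,
      0 < wedge (deriv γ φ) (deriv (deriv γ) (φ + θ)) := by
    refine eventually_forall_pos_of_periodic (Q := fun p : Ck (m + 2) Plane × ℝ × ℝ =>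
      wedge (deriv p.1 p.2.1) (deriv (deriv p.1) (p.2.1 + p.2.2))) ?_ ?_ isCompact_Icc ?_
    · have h1 : Continuous fun p : Ck (m + 2) Plane × ℝ × ℝ => deriv p.1 p.2.1 :=
        c1.comp (continuous_fst.prodMk (by fun_prop))
      have h2 : Continuous fun p : Ck (m + 2) Plane × ℝ × ℝ =>
          deriv (deriv p.1) (p.2.1 + p.2.2) :=
        c2.comp (continuous_fst.prodMk (by fun_prop))
      fun_prop
    · intro γ φ θ
      simp only
      rw [γ.periodic_deriv, add_right_comm]
      exact congrArg _ ((Ck.derivL (m + 1) Plane γ).periodic_deriv (φ + θ))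
    · intro φ θ hθ
      simp only
      rw [wedge_deriv_circleCurve, add_sub_cancel_left]
      have := Real.cos_pos_of_le_one (abs_le.2 hθ)
      positivity
  have e2 : ∀ᶠ γ : Ck (m + 2) Plane in 𝓝 (circleCurve (m + 2) R), ∀ φ,
      ∀ θ ∈ Icc 1 (2 * Real.pi - 1), 0 < wedge (γ (φ + θ) - γ φ) (deriv γ (φ + θ)) := by
    refine eventually_forall_pos_of_periodic (Q := fun p : Ck (m + 2) Plane × ℝ × ℝ =>
      wedge (p.1 (p.2.1 + p.2.2) - p.1 p.2.1) (deriv p.1 (p.2.1 + p.2.2))) ?_ ?_ isCompact_Icc ?_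
    · have h1 : Continuous fun p : Ck (m + 2) Plane × ℝ × ℝ => deriv p.1 (p.2.1 + p.2.2) :=
        c1.comp (continuous_fst.prodMk (by fun_prop))
      have h2 : Continuous fun p : Ck (m + 2) Plane × ℝ × ℝ => p.1 (p.2.1 + p.2.2) :=
        c0.comp (continuous_fst.prodMk (by fun_prop))
      have h3 : Continuous fun p : Ck (m + 2) Plane × ℝ × ℝ => p.1 p.2.1 :=
        c0.comp (continuous_fst.prodMk (by fun_prop))
      fun_prop
    · intro γ φ θ
      simp only
      rw [add_right_comm, γ.periodic_deriv, γ.periodic, γ.periodic]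
    · intro φ θ hθ
      simp only
      rw [wedge_circleCurve]
      have h1 : Real.cos θ ≠ 1 := by
        intro h
        obtain ⟨j, hj⟩ := (Real.cos_eq_one_iff θ).1 h
        have hp := Real.pi_gt_three
        have h2 : (0 : ℝ) < j := by nlinarith [hθ.1]
        have h3 : (j : ℝ) < 1 := by nlinarith [hθ.2]
        have h2' : 0 < j := by exact_mod_cast h2
        have h3' : j < 1 := by exact_mod_cast h3
        omega
      have := lt_of_le_of_ne (Real.cos_le_one θ) h1
      exact mul_pos (by positivity) (by linarith)
  filter_upwards [e1, e2] with γ h1 h2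
  refine isConvexCurve_of_wedge (fun s v hsv => ?_) h2
  have := h1 s (v - s) (abs_le.1 hsv)
  rwa [add_sub_cancel] at this

theorem eventually_isNearCircle (m : ℕ) (hR : 0 < R) {r θ₀ α β : ℝ}
    (hr : r ^ 2 = 2 * R ^ 2 * (1 - Real.cos θ₀)) (hα : 0 < α) (hαθ : α < θ₀) (hθβ : θ₀ < β)
    (hβ : β < Real.pi) :
    ∀ᶠ γ : Ck (m + 2) Plane in 𝓝 (circleCurve (m + 2) R), IsNearCircle r α β γ := by
  have c0 := (Ck.contDiff_eval (E := Plane) (m + 2)).continuous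
  have c1 := (Ck.contDiff_deriv_eval (m + 1)).continuous
  have h1 : Continuous fun p : Ck (m + 2) Plane × ℝ × ℝ => deriv p.1 (p.2.1 + p.2.2) :=
    c1.comp (continuous_fst.prodMk (by fun_prop))
  have h2 : Continuous fun p : Ck (m + 2) Plane × ℝ × ℝ => p.1 (p.2.1 + p.2.2) :=
    c0.comp (continuous_fst.prodMk (by fun_prop))
  have h3 : Continuous fun p : Ck (m + 2) Plane × ℝ × ℝ => p.1 p.2.1 :=
    c0.comp (continuous_fst.prodMk (by fun_prop))
  have hR2 : 0 < R ^ 2 := by positivity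
  have e1 := eventually_forall_pos_of_periodic (Q := fun p : Ck (m + 2) Plane × ℝ × ℝ =>
      r ^ 2 - ‖p.1 (p.2.1 + p.2.2) - p.1 p.2.1‖ ^ 2) (by fun_prop)
      (fun γ φ θ => by simp only; rw [add_right_comm, γ.periodic, γ.periodic])
      (isCompact_Icc (a := -α) (b := α)) (x₀ := circleCurve (m + 2) R) (fun φ θ hθ => by
        simp only
        rw [norm_sq_circleCurve_sub, hr]
        have : Real.cos θ₀ < Real.cos θ := by
          rw [← Real.cos_abs θ]
          exact Real.cos_lt_cos_of_nonneg_of_le_pi (abs_nonneg _) (by linarith)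
            ((abs_le.2 hθ).trans_lt hαθ)
        nlinarith)
  have e2 := eventually_forall_pos_of_periodic (Q := fun p : Ck (m + 2) Plane × ℝ × ℝ =>
      ‖p.1 (p.2.1 + p.2.2) - p.1 p.2.1‖ ^ 2 - r ^ 2) (by fun_prop)
      (fun γ φ θ => by simp only; rw [add_right_comm, γ.periodic, γ.periodic])
      (isCompact_Icc (a := β) (b := 2 * Real.pi - β)) (x₀ := circleCurve (m + 2) R)
      (fun φ θ hθ => by
        simp only
        rw [norm_sq_circleCurve_sub, hr]
        have : Real.cos θ < Real.cos θ₀ := by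
          rcases le_total θ Real.pi with hp | hp
          · exact Real.cos_lt_cos_of_nonneg_of_le_pi (by linarith) hp (by linarith [hθ.1])
          · rw [← Real.cos_two_pi_sub θ]
            exact Real.cos_lt_cos_of_nonneg_of_le_pi (by linarith) (by linarith)
              (by linarith [hθ.2])
        nlinarith)
  have e3 := eventually_forall_pos_of_periodic (Q := fun p : Ck (m + 2) Plane × ℝ × ℝ =>
      inner ℝ (p.1 (p.2.1 + p.2.2) - p.1 p.2.1) (deriv p.1 (p.2.1 + p.2.2))) (by fun_prop)
      (fun γ φ θ => by
        simp only
        rw [add_right_comm, γ.periodic, γ.periodic, γ.periodic_deriv])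
      (isCompact_Icc (a := α) (b := β)) (x₀ := circleCurve (m + 2) R) (fun φ θ hθ => by
        simp only
        rw [inner_circleCurve]
        exact mul_pos hR2 (Real.sin_pos_of_pos_of_lt_pi (by linarith [hθ.1]) (by linarith [hθ.2])))
  have e4 := eventually_forall_pos_of_periodic (Q := fun p : Ck (m + 2) Plane × ℝ × ℝ =>
      -inner ℝ (p.1 (p.2.1 + p.2.2) - p.1 p.2.1) (deriv p.1 (p.2.1 + p.2.2))) (by fun_prop)
      (fun γ φ θ => by
        simp only
        rw [add_right_comm, γ.periodic, γ.periodic, γ.periodic_deriv])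
      (isCompact_Icc (a := -β) (b := -α)) (x₀ := circleCurve (m + 2) R) (fun φ θ hθ => by
        simp only
        rw [inner_circleCurve]
        have := mul_pos hR2 (Real.sin_pos_of_pos_of_lt_pi (x := -θ) (by linarith [hθ.2])
          (by linarith [hθ.1]))
        rw [Real.sin_neg] at this
        linarith)
  filter_upwards [eventually_isConvexCurve m hR, e1, e2, e3, e4] with γ h0 h1 h2 h3 h4
  refine ⟨h0, fun φ θ hθ => sub_pos.1 (h1 φ θ hθ), fun φ θ hθ => sub_pos.1 (h2 φ θ hθ), h3,
    fun φ θ hθ => ?_⟩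
  have := h4 φ (-θ) ⟨by linarith [hθ.2], by linarith [hθ.1]⟩
  rw [← sub_eq_add_neg] at this
  linarith

end Circle

/-- The chord of a curve from parameter `φ` to parameter `t`. -/
def chord {n : ℕ} (γ : Ck n Plane) (φ t : ℝ) : Plane := γ t - γ φ

/-- The parameters `φ - b` and `φ + a` delimit the part of the curve in the disk of radius `r`
centred at the point with parameter `φ`. -/
structure IsChordRoot (r α β : ℝ) {n : ℕ} (γ : Ck n Plane) (φ a b : ℝ) : Prop where
  right_mem : a ∈ Ioo α β
  left_mem : b ∈ Ioo α β
  norm_le : ∀ t ∈ Icc (φ - b) (φ + a), ‖chord γ φ t‖ ≤ r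
  le_norm : ∀ t ∈ Icc (φ + a) (φ - b + 2 * Real.pi), r ≤ ‖chord γ φ t‖

theorem chord_add_two_pi {n : ℕ} (γ : Ck n Plane) (φ t : ℝ) :
    chord γ φ (t + 2 * Real.pi) = chord γ φ t := by
  rw [chord, chord, γ.periodic]

theorem chord_add_two_pi' {n : ℕ} (γ : Ck n Plane) (φ t : ℝ) :
    chord γ (φ + 2 * Real.pi) t = chord γ φ t := by
  rw [chord, chord, γ.periodic]

theorem contDiff_chord (n : ℕ) :
    ContDiff ℝ n fun p : (Ck n Plane × ℝ) × ℝ => chord p.1.1 p.1.2 p.2 :=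
  ((Ck.contDiff_eval n).comp ((contDiff_fst.comp contDiff_fst).prodMk contDiff_snd)).sub
    ((Ck.contDiff_eval n).comp contDiff_fst)

namespace IsChordRoot

variable {r α β : ℝ} {n : ℕ} {γ : Ck n Plane} {φ a b : ℝ}

theorem norm_right (h : IsChordRoot r α β γ φ a b) (hα : 0 < α) (hβ : β < Real.pi) :
    ‖chord γ φ (φ + a)‖ = r := by
  have h1 := h.right_mem
  have h2 := h.left_mem
  exact le_antisymm (h.norm_le _ ⟨by linarith [h1.1, h2.1], le_rfl⟩)
    (h.le_norm _ ⟨le_rfl, by linarith [h1.2, h2.2]⟩)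

theorem norm_left (h : IsChordRoot r α β γ φ a b) (hα : 0 < α) (hβ : β < Real.pi) :
    ‖chord γ φ (φ - b)‖ = r := by
  have h1 := h.right_mem
  have h2 := h.left_mem
  refine le_antisymm (h.norm_le _ ⟨le_rfl, by linarith [h1.1, h2.1]⟩) ?_
  rw [← chord_add_two_pi]
  exact h.le_norm _ ⟨by linarith [h1.2, h2.2], le_rfl⟩

end IsChordRoot

theorem exists_chordRoots {r α β : ℝ} (hr : 0 < r) (hα : 0 < α) (hαβ : α < β) (hβ : β < Real.pi)
    {m : ℕ} {U : Set (Ck (m + 2) Plane)} (hU : IsOpen U)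
    (hnear : ∀ γ ∈ U, IsNearCircle r α β γ) :
    ∃ a b : Ck (m + 2) Plane × ℝ → ℝ,
      ContDiffOn ℝ (m + 2 : ℕ) a (U ×ˢ univ) ∧ ContDiffOn ℝ (m + 2 : ℕ) b (U ×ˢ univ) ∧
      (∀ γ ∈ U, Function.Periodic (fun φ => a (γ, φ)) (2 * Real.pi)) ∧
      (∀ γ ∈ U, Function.Periodic (fun φ => b (γ, φ)) (2 * Real.pi)) ∧
      ∀ γ ∈ U, ∀ φ, IsChordRoot r α β γ φ (a (γ, φ)) (b (γ, φ)) := by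
  have hUo : IsOpen (U ×ˢ (univ : Set ℝ)) := hU.prod isOpen_univ
  have hder : ∀ (γ : Ck (m + 2) Plane) φ t, HasDerivAt (fun t => ‖chord γ φ t‖ ^ 2 - r ^ 2)
      (2 * inner ℝ (chord γ φ t) (deriv γ t)) t := fun γ φ t =>
    (((γ.hasDerivAt t).sub_const (γ φ)).norm_sq).sub_const _
  have hcd : ∀ {f : (Ck (m + 2) Plane × ℝ) × ℝ → ℝ}, ContDiff ℝ (m + 2 : ℕ) f →
      ContDiff ℝ (m + 2 : ℕ) fun p : (Ck (m + 2) Plane × ℝ) × ℝ =>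
      ‖chord p.1.1 p.1.2 (f p)‖ ^ 2 - r ^ 2 := fun hf => by
    have h1 := (contDiff_chord (m + 2)).comp (contDiff_fst.prodMk hf)
    exact (h1.norm_sq ℝ).sub contDiff_const
  have hsq : ∀ {x : Plane}, ‖x‖ ^ 2 - r ^ 2 < 0 → ‖x‖ < r := fun h =>
    lt_of_pow_lt_pow_left₀ 2 hr.le (by linarith)
  have hsq' : ∀ {x : Plane}, 0 < ‖x‖ ^ 2 - r ^ 2 → r < ‖x‖ := fun h =>
    lt_of_pow_lt_pow_left₀ 2 (norm_nonneg _) (by linarith)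
  have hlt : ∀ γ ∈ U, ∀ φ, ∀ θ ∈ Icc (-α) α, ‖chord γ φ (φ + θ)‖ ^ 2 - r ^ 2 < 0 :=
    fun γ hγ φ θ hθ => sub_neg.2 ((hnear γ hγ).norm_lt φ θ hθ)
  have hgt : ∀ γ ∈ U, ∀ φ, ∀ θ ∈ Icc β (2 * Real.pi - β),
      0 < ‖chord γ φ (φ + θ)‖ ^ 2 - r ^ 2 :=
    fun γ hγ φ θ hθ => sub_pos.2 ((hnear γ hγ).lt_norm φ θ hθ)
  obtain ⟨a, ha, har⟩ := exists_contDiffOn_root (Nat.succ_ne_zero (m + 1))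
    (hcd (f := fun p => p.1.2 + p.2) (by fun_prop)) hUo hαβ
    (fun x hx => hlt x.1 hx.1 x.2 α ⟨by linarith, le_rfl⟩)
    (fun x hx => hgt x.1 hx.1 x.2 β ⟨le_rfl, by linarith⟩)
    (fun x hx θ hθ => by
      have h1 := (hnear x.1 hx.1).inner_pos x.2 θ hθ
      rw [((hder x.1 x.2 (x.2 + θ)).comp_const_add x.2 θ).deriv, chord]
      positivity)
  obtain ⟨b, hb, hbr⟩ := exists_contDiffOn_root (Nat.succ_ne_zero (m + 1))
    (hcd (f := fun p => p.1.2 - p.2) (by fun_prop)) hUo hαβ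
    (fun x hx => by
      have := hlt x.1 hx.1 x.2 (-α) ⟨le_rfl, by linarith⟩
      rwa [← sub_eq_add_neg] at this)
    (fun x hx => by
      have := hgt x.1 hx.1 x.2 (2 * Real.pi - β) ⟨by linarith, le_rfl⟩
      rwa [show x.2 + (2 * Real.pi - β) = x.2 - β + 2 * Real.pi by ring, chord_add_two_pi] at this)
    (fun x hx θ hθ => by
      have h1 := (hnear x.1 hx.1).inner_neg x.2 θ hθ
      rw [((hder x.1 x.2 (x.2 - θ)).comp_const_sub x.2 θ).deriv, chord]
      linarith)
  have hmem : ∀ {γ : Ck (m + 2) Plane}, γ ∈ U → ∀ φ : ℝ, (γ, φ) ∈ U ×ˢ (univ : Set ℝ) :=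
    fun hγ φ => ⟨hγ, mem_univ _⟩
  refine ⟨a, b, ha, hb, fun γ hγ φ => ?_, fun γ hγ φ => ?_, fun γ hγ φ => ?_⟩
  · obtain ⟨h1, h2, -⟩ := har _ (hmem hγ (φ + 2 * Real.pi))
    obtain ⟨-, -, h4⟩ := har _ (hmem hγ φ)
    simp only [chord_add_two_pi', add_right_comm φ (2 * Real.pi), chord_add_two_pi] at h2
    obtain ⟨h5, h6⟩ := h4 _ (Ioo_subset_Icc_self h1)
    rcases lt_trichotomy (a (γ, φ + 2 * Real.pi)) (a (γ, φ)) with h | h | h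
    · exact absurd h2 (h5 h).ne
    · exact h
    · exact absurd h2 (h6 h).ne'
  · obtain ⟨h1, h2, -⟩ := hbr _ (hmem hγ (φ + 2 * Real.pi))
    obtain ⟨-, -, h4⟩ := hbr _ (hmem hγ φ)
    simp only [chord_add_two_pi', add_sub_right_comm φ, chord_add_two_pi] at h2
    obtain ⟨h5, h6⟩ := h4 _ (Ioo_subset_Icc_self h1)
    rcases lt_trichotomy (b (γ, φ + 2 * Real.pi)) (b (γ, φ)) with h | h | h
    · exact absurd h2 (h5 h).ne
    · exact h
    · exact absurd h2 (h6 h).ne'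
  · obtain ⟨a1, a2, a3⟩ := har _ (hmem hγ φ)
    obtain ⟨b1, b2, b3⟩ := hbr _ (hmem hγ φ)
    simp only at a1 a2 a3 b1 b2 b3
    have a3' : ∀ t, φ + α ≤ t → t ≤ φ + β →
        (t < φ + a (γ, φ) → ‖chord γ φ t‖ < r) ∧ (φ + a (γ, φ) < t → r < ‖chord γ φ t‖) := by
      intro t h1 h2
      obtain ⟨h3, h4⟩ := a3 (t - φ) ⟨by linarith, by linarith⟩
      rw [add_sub_cancel] at h3 h4
      exact ⟨fun h => hsq (h3 (by linarith)), fun h => hsq' (h4 (by linarith))⟩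
    have b3' : ∀ t, φ - β ≤ t → t ≤ φ - α →
        (φ - b (γ, φ) < t → ‖chord γ φ t‖ < r) ∧ (t < φ - b (γ, φ) → r < ‖chord γ φ t‖) := by
      intro t h1 h2
      obtain ⟨h3, h4⟩ := b3 (φ - t) ⟨by linarith, by linarith⟩
      rw [sub_sub_cancel] at h3 h4
      exact ⟨fun h => hsq (h3 (by linarith)), fun h => hsq' (h4 (by linarith))⟩
    have a2' : ‖chord γ φ (φ + a (γ, φ))‖ = r :=
      (pow_left_inj₀ (norm_nonneg _) hr.le two_ne_zero).1 (sub_eq_zero.1 a2)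
    have b2' : ‖chord γ φ (φ - b (γ, φ))‖ = r :=
      (pow_left_inj₀ (norm_nonneg _) hr.le two_ne_zero).1 (sub_eq_zero.1 b2)
    refine ⟨a1, b1, fun t ht => ?_, fun t ht => ?_⟩
    · rcases le_total t (φ - α) with h1 | h1
      · rcases ht.1.eq_or_lt with h2 | h2
        · rw [← h2, b2']
        · exact ((b3' t (by linarith [b1.2]) h1).1 h2).le
      rcases le_total t (φ + α) with h3 | h3
      · have := hlt γ hγ φ (t - φ) ⟨by linarith, by linarith⟩
        rw [add_sub_cancel] at this
        exact (hsq this).le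
      · rcases ht.2.eq_or_lt with h2 | h2
        · rw [h2, a2']
        · exact ((a3' t h3 (by linarith [a1.2])).1 h2).le
    · rcases le_total t (φ + β) with h1 | h1
      · rcases ht.1.eq_or_lt with h2 | h2
        · rw [← h2, a2']
        · exact ((a3' t (by linarith [a1.1]) h1).2 h2).le
      rcases le_total t (φ + (2 * Real.pi - β)) with h3 | h3
      · have := hgt γ hγ φ (t - φ) ⟨by linarith, by linarith⟩
        rw [add_sub_cancel] at this
        exact (hsq' this).le
      · have h4 : chord γ φ t = chord γ φ (t - 2 * Real.pi) := by
          rw [← chord_add_two_pi γ φ (t - 2 * Real.pi), sub_add_cancel]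
        rw [h4]
        rcases ht.2.eq_or_lt with h2 | h2
        · rw [h2, add_sub_cancel_right, b2']
        · exact ((b3' (t - 2 * Real.pi) (by linarith) (by linarith [b1.1])).2 (by linarith)).le

section AreaFunctional

variable {m : ℕ}

/-- The density `½ (γ(t) - γ(φ)) × (dγ/dt)(t)` of the area swept out by chords from `γ(φ)`. -/
noncomputable def sectorDensity (p : (Ck (m + 2) Plane × ℝ) × ℝ) : ℝ :=
  1 / 2 * wedge (chord p.1.1 p.1.2 p.2) (deriv p.1.1 p.2)

/-- The density of the area swept out by the parts of length `r` of the chords from `γ(φ)`. -/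
noncomputable def cutSectorDensity (r : ℝ) (p : (Ck (m + 2) Plane × ℝ) × ℝ) : ℝ :=
  r ^ 2 / ‖chord p.1.1 p.1.2 p.2‖ ^ 2 * sectorDensity p

/-- The area of the part in the disk of radius `r` centred at `γ(φ)` of the interior of `γ`, in
terms of the intersection parameters `φ + a` and `φ - b`. -/
noncomputable def diskArea (r : ℝ) (a b : Ck (m + 2) Plane × ℝ → ℝ)
    (x : Ck (m + 2) Plane × ℝ) : ℝ :=
  (∫ t in x.2 - b x..x.2 + a x, sectorDensity (x, t)) +
    ∫ t in x.2 + a x..x.2 - b x + 2 * Real.pi, cutSectorDensity r (x, t)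

theorem contDiff_sectorDensity :
    ContDiff ℝ (m + 1 : ℕ) (sectorDensity : (Ck (m + 2) Plane × ℝ) × ℝ → ℝ) := by
  have h1 : ContDiff ℝ (m + 1 : ℕ) fun p : (Ck (m + 2) Plane × ℝ) × ℝ =>
      chord p.1.1 p.1.2 p.2 :=
    (contDiff_chord (m + 2)).of_le (by norm_cast; omega)
  have h2 : ContDiff ℝ (m + 1 : ℕ) fun p : (Ck (m + 2) Plane × ℝ) × ℝ => deriv p.1.1 p.2 :=
    (Ck.contDiff_deriv_eval (m + 1)).comp ((contDiff_fst.comp contDiff_fst).prodMk contDiff_snd)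
  exact contDiff_const.mul ((wedge.contDiff.comp h1).clm_apply h2)

theorem isOpen_chord_ne_zero :
    IsOpen {p : (Ck (m + 2) Plane × ℝ) × ℝ | chord p.1.1 p.1.2 p.2 ≠ 0} :=
  isOpen_ne.preimage (contDiff_chord (m + 2)).continuous

theorem contDiffOn_cutSectorDensity (r : ℝ) :
    ContDiffOn ℝ (m + 1 : ℕ) (cutSectorDensity r : (Ck (m + 2) Plane × ℝ) × ℝ → ℝ)
      {p | chord p.1.1 p.1.2 p.2 ≠ 0} := by
  have h1 : ContDiff ℝ (m + 1 : ℕ) fun p : (Ck (m + 2) Plane × ℝ) × ℝ =>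
      chord p.1.1 p.1.2 p.2 :=
    (contDiff_chord (m + 2)).of_le (by norm_cast; omega)
  refine (contDiffOn_const.div (h1.norm_sq ℝ).contDiffOn fun p hp => ?_).mul
    contDiff_sectorDensity.contDiffOn
  exact pow_ne_zero 2 (norm_ne_zero_iff.2 hp)

theorem sectorDensity_add_two_pi (x : Ck (m + 2) Plane × ℝ) (t : ℝ) :
    sectorDensity (x, t + 2 * Real.pi) = sectorDensity (x, t) := by
  simp only [sectorDensity, chord_add_two_pi]
  rw [x.1.periodic_deriv]

theorem cutSectorDensity_add_two_pi (r : ℝ) (x : Ck (m + 2) Plane × ℝ) (t : ℝ) :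
    cutSectorDensity r (x, t + 2 * Real.pi) = cutSectorDensity r (x, t) := by
  simp only [cutSectorDensity, chord_add_two_pi, sectorDensity_add_two_pi]

theorem cutSectorDensity_eq {r : ℝ} (hr : 0 < r) {x : Ck (m + 2) Plane × ℝ} {t : ℝ}
    (h : ‖chord x.1 x.2 t‖ = r) : cutSectorDensity r (x, t) = sectorDensity (x, t) := by
  rw [cutSectorDensity, h, div_self (by positivity), one_mul]

variable {r α β : ℝ} {U : Set (Ck (m + 2) Plane)} {a b : Ck (m + 2) Plane × ℝ → ℝ}

theorem IsChordRoot.chord_ne_zero {γ : Ck (m + 2) Plane} {φ a b : ℝ}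
    (h : IsChordRoot r α β γ φ a b) (hr : 0 < r) (hβ : β < Real.pi) :
    ∀ t ∈ uIcc (φ + a) (φ - b + 2 * Real.pi), chord γ φ t ≠ 0 := by
  intro t ht
  rw [uIcc_of_le (by linarith [h.right_mem.2, h.left_mem.2])] at ht
  exact norm_pos_iff.1 (hr.trans_le (h.le_norm t ht))

theorem contDiffOn_diskArea (hr : 0 < r) (hβ : β < Real.pi)
    (ha : ContDiffOn ℝ (m + 2 : ℕ) a (U ×ˢ univ)) (hb : ContDiffOn ℝ (m + 2 : ℕ) b (U ×ˢ univ))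
    (hroot : ∀ γ ∈ U, ∀ φ, IsChordRoot r α β γ φ (a (γ, φ)) (b (γ, φ))) :
    ContDiffOn ℝ (m + 1 : ℕ) (diskArea r a b) (U ×ˢ univ) := by
  have ha' : ContDiffOn ℝ (m + 1 : ℕ) a (U ×ˢ univ) := ha.of_le (by norm_cast; omega)
  have hb' : ContDiffOn ℝ (m + 1 : ℕ) b (U ×ˢ univ) := hb.of_le (by norm_cast; omega)
  refine ContDiffOn.add ?_ ?_
  · exact ContDiffOn.integral_endpoints isOpen_univ contDiff_sectorDensity.contDiffOn
      (contDiffOn_snd.sub hb') (contDiffOn_snd.add ha') fun _ _ _ _ => mem_univ _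
  · exact ContDiffOn.integral_endpoints isOpen_chord_ne_zero (contDiffOn_cutSectorDensity r)
      (contDiffOn_snd.add ha') ((contDiffOn_snd.sub hb').add contDiffOn_const)
      fun x hx => (hroot x.1 hx.1 x.2).chord_ne_zero hr hβ

theorem circularInvariant_eq_diskArea {γ : Ck (m + 2) Plane} (hγ : IsConvexCurve γ) (hr : 0 < r)
    (hα : 0 < α) (hβ : β < Real.pi) {φ : ℝ}
    (h : IsChordRoot r α β γ φ (a (γ, φ)) (b (γ, φ))) :
    circularInvariant r γ φ = diskArea r a b (γ, φ) := by
  set s := φ - b (γ, φ) with hs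
  set t := φ + a (γ, φ) with ht
  have h1 := h.right_mem
  have h2 := h.left_mem
  set f : ℝ → ℝ := fun t =>
    1 / 2 * diskWeight r (γ t - γ φ) * wedge (γ t - γ φ) (deriv γ t) with hf
  have hper : Function.Periodic f (2 * Real.pi) := fun t => by
    simp only [hf]
    rw [γ.periodic, γ.periodic_deriv]
  have e1 : EqOn f (fun t => sectorDensity ((γ, φ), t)) (uIcc s t) := by
    intro u hu
    rw [uIcc_of_le (by linarith [h1.1, h2.1])] at hu
    have hle := h.norm_le u hu
    have hw : diskWeight r (γ u - γ φ) = 1 := by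
      unfold diskWeight
      split_ifs with hlt
      · rfl
      · rw [show ‖γ u - γ φ‖ = r from le_antisymm hle (not_lt.1 hlt), div_self (by positivity)]
    simp only [hf, hw, sectorDensity, chord, mul_one]
  have e2 : EqOn f (fun t => cutSectorDensity r ((γ, φ), t)) (uIcc t (s + 2 * Real.pi)) := by
    intro u hu
    rw [uIcc_of_le (by linarith [h1.2, h2.2])] at hu
    have hle : ¬‖γ u - γ φ‖ < r := not_lt.2 (h.le_norm u hu)
    simp only [hf, diskWeight, cutSectorDensity, sectorDensity, chord, if_neg hle]
    ring
  have i1 : IntervalIntegrable f volume s t :=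
    (ContinuousOn.intervalIntegrable ((contDiff_sectorDensity.continuous.comp
      (Continuous.prodMk_right (γ, φ))).continuousOn.congr e1))
  have i2 : IntervalIntegrable f volume t (s + 2 * Real.pi) := by
    refine ContinuousOn.intervalIntegrable (ContinuousOn.congr ?_ e2)
    exact (contDiffOn_cutSectorDensity r).continuousOn.comp
      (Continuous.prodMk_right (γ, φ)).continuousOn fun u hu => h.chord_ne_zero hr hβ u hu
  rw [hγ.circularInvariant_eq hr, ← hper.intervalIntegral_add_eq s φ,
    ← intervalIntegral.integral_add_adjacent_intervals i1 i2,
    intervalIntegral.integral_congr e1, intervalIntegral.integral_congr e2]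
  rfl

theorem periodic_diskArea {γ : Ck (m + 2) Plane}
    (hap : Function.Periodic (fun φ => a (γ, φ)) (2 * Real.pi))
    (hbp : Function.Periodic (fun φ => b (γ, φ)) (2 * Real.pi)) :
    Function.Periodic (fun φ => diskArea r a b (γ, φ)) (2 * Real.pi) := by
  intro φ
  have e1 : ∀ t, sectorDensity ((γ, φ + 2 * Real.pi), t) = sectorDensity ((γ, φ), t) := fun t => by
    simp only [sectorDensity, chord_add_two_pi']
  have e2 : ∀ t, cutSectorDensity r ((γ, φ + 2 * Real.pi), t) =
      cutSectorDensity r ((γ, φ), t) := fun t => by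
    simp only [cutSectorDensity, chord_add_two_pi', e1]
  have ha : a (γ, φ + 2 * Real.pi) = a (γ, φ) := hap φ
  have hb : b (γ, φ + 2 * Real.pi) = b (γ, φ) := hbp φ
  simp only [diskArea, ha, hb, e1, e2, add_sub_right_comm φ (2 * Real.pi),
    add_right_comm φ (2 * Real.pi)]
  rw [← intervalIntegral.integral_comp_add_right _ (2 * Real.pi),
    ← intervalIntegral.integral_comp_add_right _ (2 * Real.pi)]
  simp only [sectorDensity_add_two_pi, cutSectorDensity_add_two_pi]

end AreaFunctional

theorem norm_sq_plane (x : Plane) : ‖x‖ ^ 2 = x 0 ^ 2 + x 1 ^ 2 := by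
  rw [EuclideanSpace.norm_sq_eq, Fin.sum_univ_two]
  simp

theorem inner_plane (x y : Plane) : inner ℝ x y = x 0 * y 0 + x 1 * y 1 := by
  simp only [PiLp.inner_apply, Fin.sum_univ_two]
  simp [mul_comm]

theorem HasDerivAt.wedge {f g : ℝ → Plane} {f' g' : Plane} {t : ℝ} (hf : HasDerivAt f f' t)
    (hg : HasDerivAt g g' t) :
    HasDerivAt (fun t => _root_.wedge (f t) (g t))
      (_root_.wedge f' (g t) + _root_.wedge (f t) g') t :=
  (_root_.wedge.hasFDerivAt.comp_hasDerivAt t hf).clm_apply hg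

theorem hasDerivAt_line_partialFst {X E : Type*} [NormedAddCommGroup X] [NormedSpace ℝ X]
    [NormedAddCommGroup E] [NormedSpace ℝ E] {f : X × ℝ → E} {x : X} {t : ℝ}
    (hf : DifferentiableAt ℝ f (x, t)) (h : X) :
    HasDerivAt (fun ε : ℝ => f (x + ε • h, t)) (fderiv ℝ f (x, t) (h, 0)) 0 := by
  have h1 : HasDerivAt (fun ε : ℝ => (x + ε • h, t)) (h, 0) 0 := by
    have := ((hasDerivAt_id (0 : ℝ)).smul_const h).const_add x
    simpa using this.prodMk (hasDerivAt_const (0 : ℝ) t)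
  have h2 : HasFDerivAt f (fderiv ℝ f (x, t)) (x + (0 : ℝ) • h, t) := by
    simpa using hf.hasFDerivAt
  exact h2.comp_hasDerivAt (f := fun ε : ℝ => (x + ε • h, t)) 0 h1

section Derivative

variable {m : ℕ}

theorem hasDerivAt_chord (γ : Ck (m + 1) Plane) (φ t : ℝ) :
    HasDerivAt (chord γ φ) (deriv γ t) t :=
  (γ.hasDerivAt t).sub_const (γ φ)

theorem chord_line (γ σ : Ck (m + 2) Plane) (φ t ε : ℝ) :
    chord (γ + ε • σ) φ t = chord γ φ t + ε • chord σ φ t := by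
  simp only [chord, Ck.add_apply, Ck.smul_apply, smul_sub]
  abel

theorem deriv_line (γ σ : Ck (m + 2) Plane) (t ε : ℝ) :
    deriv (γ + ε • σ : Ck (m + 2) Plane) t = deriv γ t + ε • deriv σ t :=
  ((γ.hasDerivAt t).add ((σ.hasDerivAt t).const_smul ε)).deriv

theorem hasDerivAt_affine (W N : Plane) : HasDerivAt (fun ε : ℝ => W + ε • N) N 0 := by
  simpa using ((hasDerivAt_id (0 : ℝ)).smul_const N).const_add W

theorem partialFst_sectorDensity (γ σ : Ck (m + 2) Plane) (φ t : ℝ) :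
    partialFst sectorDensity ((γ, φ), t) (σ, 0) =
      1 / 2 * (wedge (chord σ φ t) (deriv γ t) + wedge (chord γ φ t) (deriv σ t)) := by
  have h1 := hasDerivAt_line_partialFst (f := sectorDensity) (x := (γ, φ)) (t := t)
    (contDiff_sectorDensity.differentiable (by simp) _) (σ, 0)
  have h2 := ((hasDerivAt_affine (chord γ φ t) (chord σ φ t)).wedge
    (hasDerivAt_affine (deriv γ t) (deriv σ t))).const_mul (1 / 2)
  simp only [zero_smul, add_zero] at h2
  refine h1.unique (h2.congr_of_eventuallyEq (Eventually.of_forall fun ε => ?_))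
  simp [sectorDensity, chord_line, deriv_line]

theorem hasDerivAt_partialFst_cutSectorDensity (r : ℝ) (γ σ : Ck (m + 2) Plane) {φ t : ℝ}
    (hne : chord γ φ t ≠ 0) :
    HasDerivAt (fun t => 1 / 2 * r ^ 2 * (wedge (chord γ φ t) (chord σ φ t) / ‖chord γ φ t‖ ^ 2))
      (partialFst (cutSectorDensity r) ((γ, φ), t) (σ, 0)) t := by
  have hd : DifferentiableAt ℝ (cutSectorDensity r) ((γ, φ), t) :=
    ((contDiffOn_cutSectorDensity r _ hne).contDiffAt
      (isOpen_chord_ne_zero.mem_nhds hne)).differentiableAt (by simp)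
  have h1 := hasDerivAt_line_partialFst hd (σ, 0)
  have hn0 : ‖chord γ φ t‖ ^ 2 ≠ 0 := pow_ne_zero 2 (norm_ne_zero_iff.2 hne)
  have h2 := ((hasDerivAt_const (0 : ℝ) (r ^ 2)).div
    (hasDerivAt_affine (chord γ φ t) (chord σ φ t)).norm_sq (by simpa using hn0)).mul
    (((hasDerivAt_affine (chord γ φ t) (chord σ φ t)).wedge
      (hasDerivAt_affine (deriv γ t) (deriv σ t))).const_mul (1 / 2))
  simp only [zero_smul, add_zero, Pi.div_apply] at h2
  have h3 := h1.unique (h2.congr_of_eventuallyEq (Eventually.of_forall fun ε => by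
    simp [cutSectorDensity, sectorDensity, chord_line, deriv_line]))
  have h4 := (((hasDerivAt_chord γ φ t).wedge (hasDerivAt_chord σ φ t)).div
    (hasDerivAt_chord γ φ t).norm_sq hn0).const_mul (1 / 2 * r ^ 2)
  convert! h4 using 1
  simp only [partialFst, ContinuousLinearMap.comp_apply, ContinuousLinearMap.inl_apply]
  rw [h3]
  simp only [norm_sq_plane, inner_plane, wedge_apply] at hn0 ⊢
  field_simp
  ring

theorem continuousOn_partialFst_cutSectorDensity (r : ℝ) (γ σ : Ck (m + 2) Plane) {φ : ℝ}
    {s : Set ℝ} (hs : ∀ t ∈ s, chord γ φ t ≠ 0) :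
    ContinuousOn (fun t => partialFst (cutSectorDensity r) ((γ, φ), t) (σ, 0)) s := by
  have h1 : ContinuousOn (fderiv ℝ (cutSectorDensity r))
      {p : (Ck (m + 2) Plane × ℝ) × ℝ | chord p.1.1 p.1.2 p.2 ≠ 0} :=
    (contDiffOn_cutSectorDensity r).continuousOn_fderiv_of_isOpen isOpen_chord_ne_zero
      (by norm_cast; omega)
  have h2 : ContinuousOn (fun t => fderiv ℝ (cutSectorDensity r)
      (((γ, φ), t) : (Ck (m + 2) Plane × ℝ) × ℝ)) s :=
    h1.comp (Continuous.prodMk_right (γ, φ)).continuousOn hs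
  exact h2.clm_apply continuousOn_const

variable {r α β : ℝ} {U : Set (Ck (m + 2) Plane)} {a b : Ck (m + 2) Plane × ℝ → ℝ}

/-- The first variation of the area. -/
theorem fderiv_diskArea (hr : 0 < r) (hα : 0 < α) (hβ : β < Real.pi) (hU : IsOpen U)
    (ha : ContDiffOn ℝ (m + 2 : ℕ) a (U ×ˢ univ)) (hb : ContDiffOn ℝ (m + 2 : ℕ) b (U ×ˢ univ))
    (hroot : ∀ γ ∈ U, ∀ φ, IsChordRoot r α β γ φ (a (γ, φ)) (b (γ, φ)))
    {γ : Ck (m + 2) Plane} (hγ : γ ∈ U) (φ : ℝ) (σ : Ck (m + 2) Plane) :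
    fderiv ℝ (diskArea r a b) (γ, φ) (σ, 0) =
      ∫ t in φ - b (γ, φ)..φ + a (γ, φ), wedge (chord σ φ t) (deriv γ t) := by
  have hmem : (γ, φ) ∈ U ×ˢ (univ : Set ℝ) := ⟨hγ, mem_univ _⟩
  have hnhds := (hU.prod isOpen_univ).mem_nhds hmem
  have h := hroot γ hγ φ
  have had : HasFDerivAt a (fderiv ℝ a (γ, φ)) (γ, φ) :=
    (((ha _ hmem).contDiffAt hnhds).differentiableAt (by simp)).hasFDerivAt
  have hbd : HasFDerivAt b (fderiv ℝ b (γ, φ)) (γ, φ) :=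
    (((hb _ hmem).contDiffAt hnhds).differentiableAt (by simp)).hasFDerivAt
  have hK1 : ContDiffOn ℝ (1 : ℕ) (sectorDensity : (Ck (m + 2) Plane × ℝ) × ℝ → ℝ) univ :=
    contDiff_sectorDensity.contDiffOn.of_le (by norm_cast; omega)
  have hK2 : ContDiffOn ℝ (1 : ℕ) (cutSectorDensity r : (Ck (m + 2) Plane × ℝ) × ℝ → ℝ)
      {p | chord p.1.1 p.1.2 p.2 ≠ 0} :=
    (contDiffOn_cutSectorDensity r).of_le (by norm_cast; omega)
  have hl : HasFDerivAt (fun x : Ck (m + 2) Plane × ℝ => x.2 - b x)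
      (ContinuousLinearMap.snd ℝ _ ℝ - fderiv ℝ b (γ, φ)) (γ, φ) := hasFDerivAt_snd.sub hbd
  have hrt : HasFDerivAt (fun x : Ck (m + 2) Plane × ℝ => x.2 + a x)
      (ContinuousLinearMap.snd ℝ _ ℝ + fderiv ℝ a (γ, φ)) (γ, φ) := hasFDerivAt_snd.add had
  have hne := h.chord_ne_zero hr hβ
  have d1 := HasFDerivAt.integral_endpoints isOpen_univ hK1 hl hrt (fun _ _ => mem_univ _) (σ, 0)
  have d2 := HasFDerivAt.integral_endpoints isOpen_chord_ne_zero hK2 hrt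
    (hl.add_const (2 * Real.pi)) hne (σ, 0)
  have c1 := ContDiffOn.integral_endpoints isOpen_univ hK1
    (contDiffOn_snd.sub (hb.of_le (by norm_cast; omega)))
    (contDiffOn_snd.add (ha.of_le (by norm_cast; omega))) fun _ _ _ _ => mem_univ _
  have c2 := ContDiffOn.integral_endpoints isOpen_chord_ne_zero hK2
    (contDiffOn_snd.add (ha.of_le (by norm_cast; omega)))
    ((contDiffOn_snd.sub (hb.of_le (by norm_cast; omega))).add contDiffOn_const)
    fun x hx => (hroot x.1 hx.1 x.2).chord_ne_zero hr hβ
  have dc1 := ((c1 _ hmem).contDiffAt hnhds).differentiableAt (by simp)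
  have dc2 := ((c2 _ hmem).contDiffAt hnhds).differentiableAt (by simp)
  have hsum := DFunLike.congr_fun (fderiv_fun_add dc1 dc2) (σ, (0 : ℝ))
  rw [add_apply, d1, d2] at hsum
  refine hsum.trans ?_
  have hcσ : Continuous (chord σ φ) := (σ.contDiff.continuous).sub continuous_const
  have hcγ : Continuous (chord γ φ) := (γ.contDiff.continuous).sub continuous_const
  have hdσ : Continuous (deriv σ) := (Ck.derivL (m + 1) Plane σ).contDiff.continuous
  have hdγ : Continuous (deriv γ) := (Ck.derivL (m + 1) Plane γ).contDiff.continuous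
  have i1 : ∫ t in φ - b (γ, φ)..φ + a (γ, φ), partialFst sectorDensity ((γ, φ), t) (σ, 0) =
      (∫ t in φ - b (γ, φ)..φ + a (γ, φ), wedge (chord σ φ t) (deriv γ t)) +
        (1 / 2 * wedge (chord γ φ (φ + a (γ, φ))) (chord σ φ (φ + a (γ, φ))) -
          1 / 2 * wedge (chord γ φ (φ - b (γ, φ))) (chord σ φ (φ - b (γ, φ)))) := by
    rw [← intervalIntegral.integral_eq_sub_of_hasDerivAt (fun t _ =>
        ((hasDerivAt_chord γ φ t).wedge (hasDerivAt_chord σ φ t)).const_mul (1 / 2))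
        (Continuous.intervalIntegrable (by fun_prop) _ _),
      ← intervalIntegral.integral_add (Continuous.intervalIntegrable (by fun_prop) _ _)
        (Continuous.intervalIntegrable (by fun_prop) _ _)]
    refine intervalIntegral.integral_congr fun t _ => ?_
    simp only [partialFst_sectorDensity]
    rw [wedge_comm (deriv γ t) (chord σ φ t)]
    ring
  have i2 := intervalIntegral.integral_eq_sub_of_hasDerivAt
    (fun t ht => hasDerivAt_partialFst_cutSectorDensity r γ σ (hne t ht))
    (continuousOn_partialFst_cutSectorDensity r γ σ hne).intervalIntegrable
  have e1 := cutSectorDensity_eq hr (x := (γ, φ)) (h.norm_right hα hβ)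
  have e2 := cutSectorDensity_eq hr (x := (γ, φ)) (h.norm_left hα hβ)
  have e3 := cutSectorDensity_add_two_pi r (γ, φ) (φ - b (γ, φ))
  rw [i1, i2, chord_add_two_pi, chord_add_two_pi, h.norm_right hα hβ, h.norm_left hα hβ, e3, e2, e1]
  have hr2 : r ^ 2 ≠ 0 := by positivity
  field_simp
  ring

end Derivative

section Fourier

theorem abs_sin_nat_mul_le {θ : ℝ} (hS : 0 ≤ Real.sin θ) (n : ℕ) :
    |Real.sin (n * θ)| ≤ n * Real.sin θ := by
  induction n with
  | zero => simp
  | succ n ih =>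
    push_cast
    rw [add_mul, one_mul, Real.sin_add]
    calc _ ≤ |Real.sin (n * θ)| * |Real.cos θ| + |Real.cos (n * θ)| * |Real.sin θ| := by
          rw [← abs_mul, ← abs_mul]
          exact abs_add_le _ _
      _ ≤ n * Real.sin θ * 1 + 1 * Real.sin θ := by
          rw [abs_of_nonneg hS]
          gcongr
          · exact Real.abs_cos_le_one θ
          · exact Real.abs_cos_le_one _
      _ = _ := by ring

/-- The Fourier multipliers of the linearized area functional at a circle. -/
noncomputable def arcMultiplier (θ : ℝ) (m : ℤ) : ℝ :=
  if m = 0 then 2 * θ else 2 * Real.sin (m * θ) / m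

theorem arcMultiplier_neg (θ : ℝ) (m : ℤ) : arcMultiplier θ (-m) = arcMultiplier θ m := by
  unfold arcMultiplier
  by_cases hm : m = 0
  · simp [hm]
  · simp [hm]

theorem abs_arcMultiplier_le {θ : ℝ} {m : ℤ} (hm : m ≠ 0) :
    |arcMultiplier θ m| ≤ 2 / |(m : ℝ)| := by
  rw [arcMultiplier, if_neg hm, abs_div, abs_mul, abs_two]
  gcongr
  linarith [Real.abs_sin_le_one (m * θ)]

theorem arcMultiplier_le {θ : ℝ} (hS : 0 < Real.sin θ) {m : ℤ} (hm : 2 ≤ |m|) :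
    Real.sin θ * (1 - |Real.cos θ|) ≤ 2 * Real.sin θ - arcMultiplier θ m := by
  obtain ⟨n, rfl | rfl⟩ := m.eq_nat_or_neg
  all_goals
    first
    | rw [arcMultiplier_neg]
    | skip
    simp only [abs_neg, Nat.abs_cast] at hm
    obtain ⟨k, rfl⟩ : ∃ k, n = k + 1 := ⟨n - 1, by omega⟩
    have hk : (1 : ℝ) ≤ k := by
      have : 1 ≤ k := by omega
      exact_mod_cast this
    have hcos := Real.abs_cos_le_one θ
    rw [arcMultiplier, if_neg (by omega)]
    push_cast
    have h1 : Real.sin ((k + 1) * θ) ≤ k * Real.sin θ * |Real.cos θ| + Real.sin θ := by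
      rw [add_mul, one_mul, Real.sin_add]
      calc _ ≤ |Real.sin (k * θ)| * |Real.cos θ| + |Real.cos (k * θ)| * |Real.sin θ| := by
            rw [← abs_mul, ← abs_mul]
            exact add_le_add (le_abs_self _) (le_abs_self _)
        _ ≤ k * Real.sin θ * |Real.cos θ| + 1 * Real.sin θ := by
            rw [abs_of_pos hS]
            gcongr
            · exact abs_sin_nat_mul_le hS.le k
            · exact Real.abs_cos_le_one _
        _ = _ := by ring
    rw [le_sub_comm, div_le_iff₀ (by positivity)]
    nlinarith [mul_nonneg hS.le (sub_nonneg.2 hcos)]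

theorem integral_exp_arc (θ : ℝ) (m : ℤ) :
    ∫ s in -θ..θ, Complex.exp (Complex.I * m * s) = (arcMultiplier θ m : ℂ) := by
  unfold arcMultiplier
  split_ifs with hm
  · simp [hm]
    ring
  · have hm' : (m : ℂ) ≠ 0 := by exact_mod_cast hm
    have hc : Complex.I * m ≠ 0 := mul_ne_zero Complex.I_ne_zero hm'
    rw [integral_exp_mul_complex hc]
    push_cast
    rw [Complex.sin]
    have e1 : Complex.I * m * θ = m * θ * Complex.I := by ring
    have e2 : Complex.I * m * -θ = -(m * θ) * Complex.I := by ring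
    rw [e1, e2]
    field_simp
    rw [Complex.I_sq]
    ring

/-- Fourier coefficients of a `2π`-periodic function. -/
noncomputable def circleCoeff (g : ℝ → ℂ) (m : ℤ) : ℂ :=
  (1 / (2 * Real.pi) : ℝ) •
    ∫ x in (0 : ℝ)..2 * Real.pi, Complex.exp (Complex.I * (-m : ℤ) * x) * g x

/-- The integral over the arc of half-length `θ` centred at `x`. -/
noncomputable def arcIntegral (θ : ℝ) (g : ℝ → ℂ) (x : ℝ) : ℂ := ∫ s in -θ..θ, g (x + s)

theorem exp_int_periodic (m : ℤ) :
    Function.Periodic (fun x : ℝ => Complex.exp (Complex.I * m * x)) (2 * Real.pi) := by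
  intro x
  simp only
  push_cast
  rw [show Complex.I * m * (x + 2 * Real.pi) =
    Complex.I * m * x + m * (2 * Real.pi * Complex.I) by ring, Complex.exp_add,
    Complex.exp_int_mul_two_pi_mul_I, mul_one]

theorem continuous_arcIntegral (θ : ℝ) {g : ℝ → ℂ} (hg : Continuous g) :
    Continuous (arcIntegral θ g) := by
  unfold arcIntegral
  exact intervalIntegral.continuous_parametric_intervalIntegral_of_continuous' (by fun_prop) _ _

theorem circleCoeff_arcIntegral (θ : ℝ) {g : ℝ → ℂ} (hg : Continuous g)
    (hper : Function.Periodic g (2 * Real.pi)) (m : ℤ) :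
    circleCoeff (arcIntegral θ g) m = arcMultiplier θ m * circleCoeff g m := by
  simp only [circleCoeff, arcIntegral, ← intervalIntegral.integral_const_mul]
  rw [intervalIntegral_intervalIntegral_swap]
  · rw [mul_smul_comm, ← integral_exp_arc, ← intervalIntegral.integral_mul_const]
    congr 1
    refine intervalIntegral.integral_congr fun s _ => ?_
    rw [← intervalIntegral.integral_const_mul]
    have h1 : ∀ x : ℝ, Complex.exp (Complex.I * (-m : ℤ) * x) * g (x + s) =
        (fun y : ℝ => Complex.exp (Complex.I * m * s) *
          (Complex.exp (Complex.I * (-m : ℤ) * y) * g y)) (x + s) := by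
      intro x
      simp only
      rw [← mul_assoc, ← Complex.exp_add]
      congr 2
      push_cast
      ring
    simp only [h1]
    rw [intervalIntegral.integral_comp_add_right (fun y : ℝ => Complex.exp (Complex.I * m * s) *
          (Complex.exp (Complex.I * (-m : ℤ) * y) * g y))]
    have h2 : Function.Periodic (fun y : ℝ => Complex.exp (Complex.I * m * s) *
          (Complex.exp (Complex.I * (-m : ℤ) * y) * g y)) (2 * Real.pi) := by
      intro y
      have := exp_int_periodic (-m) y
      simp only at this ⊢
      rw [this, hper]
    rw [zero_add, add_comm, h2.intervalIntegral_add_eq s 0, zero_add]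
  · have hc : Continuous (Function.uncurry fun (x s : ℝ) =>
        Complex.exp (Complex.I * (-m : ℤ) * x) * g (x + s)) := by
      unfold Function.uncurry
      fun_prop
    exact (hc.continuousOn.integrableOn_compact (isCompact_uIcc.prod isCompact_uIcc)).mono_set
      (prod_mono uIoc_subset_uIcc uIoc_subset_uIcc)

theorem norm_circleCoeff_le {g : ℝ → ℂ} {M : ℝ} (hM : ∀ x, ‖g x‖ ≤ M) (m : ℤ) :
    ‖circleCoeff g m‖ ≤ M := by
  have hp := Real.two_pi_pos
  have h := intervalIntegral.norm_integral_le_of_norm_le_const (a := 0) (b := 2 * Real.pi)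
    (f := fun x : ℝ => Complex.exp (Complex.I * (-m : ℤ) * x) * g x) (C := M) fun x _ => by
      rw [norm_mul, show Complex.I * (-m : ℤ) * x = ((-m : ℤ) * x : ℝ) * Complex.I by
        push_cast; ring, Complex.norm_exp_ofReal_mul_I, one_mul]
      exact hM x
  rw [sub_zero, abs_of_pos hp] at h
  rw [circleCoeff, norm_smul, Real.norm_of_nonneg (by positivity), one_div, inv_mul_le_iff₀ hp]
  linarith

theorem circleCoeff_sub_const_mul {f g : ℝ → ℂ} (hf : Continuous f) (hg : Continuous g) (c : ℂ)
    (m : ℤ) : circleCoeff (fun x => f x - c * g x) m = circleCoeff f m - c * circleCoeff g m := by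
  simp only [circleCoeff]
  rw [mul_smul_comm, ← smul_sub, ← intervalIntegral.integral_const_mul,
    ← intervalIntegral.integral_sub (Continuous.intervalIntegrable (by fun_prop) _ _)
      (Continuous.intervalIntegrable (by fun_prop) _ _)]
  congr 1
  refine intervalIntegral.integral_congr fun x _ => ?_
  ring

theorem hasSum_circleCoeff {g : ℝ → ℂ} (hg : Continuous g)
    (hper : Function.Periodic g (2 * Real.pi)) (hs : Summable (circleCoeff g)) (x : ℝ) :
    HasSum (fun m : ℤ => circleCoeff g m * Complex.exp (Complex.I * m * x)) (g x) := by
  have : Fact (0 < 2 * Real.pi) := ⟨Real.two_pi_pos⟩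
  have hpi : (Real.pi : ℂ) ≠ 0 := by exact_mod_cast Real.pi_ne_zero
  set f : C(AddCircle (2 * Real.pi), ℂ) :=
    ⟨hper.lift, continuous_coinduced_dom.2 hg⟩ with hf
  have hexp : ∀ (m : ℤ) (y : ℝ), fourier m (y : AddCircle (2 * Real.pi)) =
      Complex.exp (Complex.I * m * y) := by
    intro m y
    rw [fourier_coe_apply]
    congr 1
    push_cast
    field_simp
  have hcoeff : fourierCoeff f = circleCoeff g := by
    funext m
    rw [fourierCoeff_eq_intervalIntegral f m 0, zero_add, circleCoeff]
    congr 1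
    refine intervalIntegral.integral_congr fun y _ => ?_
    simp only [hexp, smul_eq_mul]
    rfl
  have := has_pointwise_sum_fourier_series_of_summable (f := f) (by rw [hcoeff]; exact hs) x
  simp only [hcoeff, hexp, smul_eq_mul] at this
  exact this

theorem summable_sq_arcMultiplier (θ : ℝ) : Summable fun m : ℤ => arcMultiplier θ m ^ 2 := by
  have h1 : Summable fun m : ℤ => 4 * (1 / (m : ℝ) ^ 2) :=
    (Real.summable_one_div_int_pow.2 one_lt_two).mul_left 4
  refine h1.of_norm_bounded_eventually ?_
  filter_upwards [(finite_singleton (0 : ℤ)).compl_mem_cofinite] with m hm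
  have hm : m ≠ 0 := hm
  have hm' : 0 < |(m : ℝ)| := abs_pos.2 (by exact_mod_cast hm)
  rw [norm_pow, Real.norm_eq_abs, ← sq_abs (m : ℝ)]
  calc _ ≤ (2 / |(m : ℝ)|) ^ 2 := by
        gcongr
        exact abs_arcMultiplier_le hm
    _ = _ := by ring

theorem exists_pos_le_abs_arcMultiplier_sub {θ : ℝ} (h0 : 0 < θ) (hπ : θ < Real.pi) :
    ∃ c > 0, ∀ m : ℤ, m ≠ 1 → m ≠ -1 → c ≤ |arcMultiplier θ m - 2 * Real.sin θ| := by
  have hS : 0 < Real.sin θ := Real.sin_pos_of_pos_of_lt_pi h0 hπ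
  have hcos : |Real.cos θ| < 1 := by
    rw [← sq_lt_one_iff_abs_lt_one]
    nlinarith [Real.sin_sq_add_cos_sq θ]
  refine ⟨min (2 * (θ - Real.sin θ)) (Real.sin θ * (1 - |Real.cos θ|)),
    lt_min (by linarith [Real.sin_lt h0]) (mul_pos hS (by linarith)), fun m h1 h2 => ?_⟩
  by_cases hm : m = 0
  · refine (min_le_left _ _).trans (le_trans (le_of_eq ?_) (le_abs_self _))
    rw [arcMultiplier, if_pos hm]
    ring
  · refine (min_le_right _ _).trans ((arcMultiplier_le hS (m := m) ?_).trans ?_)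
    · rw [le_abs]
      omega
    · rw [abs_sub_comm]
      exact le_abs_self _

/-- The linearized area functional at a circle controls a periodic function up to the span of
`cos` and `sin`. -/
theorem exists_const_trig_approx {θ : ℝ} (h0 : 0 < θ) (hπ : θ < Real.pi) :
    ∃ C : ℝ, 0 ≤ C ∧ ∀ a : ℝ → ℝ, Continuous a → Function.Periodic a (2 * Real.pi) → ∀ M : ℝ,
      (∀ x, |(∫ t in x - θ..x + θ, a t) - 2 * Real.sin θ * a x| ≤ M) →
      ∃ p q : ℝ, ∀ x, |a x - (p * Real.cos x + q * Real.sin x)| ≤ C * M := by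
  have hS : 0 < Real.sin θ := Real.sin_pos_of_pos_of_lt_pi h0 hπ
  obtain ⟨c, hc, hcm⟩ := exists_pos_le_abs_arcMultiplier_sub h0 hπ
  set S := Real.sin θ with hSdef
  set Λ := ∑' m : ℤ, arcMultiplier θ m ^ 2 with hΛ
  have hΛ0 : 0 ≤ Λ := tsum_nonneg fun m => sq_nonneg _
  refine ⟨(Λ / c + 2 * θ + 2 * S) / (4 * S ^ 2), by positivity, fun a ha hper M hM => ?_⟩
  have hM0 : 0 ≤ M := (abs_nonneg _).trans (hM 0)
  set g : ℝ → ℂ := fun x => (a x : ℂ) with hg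
  have hgc : Continuous g := by fun_prop
  have hgp : Function.Periodic g (2 * Real.pi) := fun x => by simp only [hg, hper x]
  set g₁ := arcIntegral θ g with hg₁
  have hg₁c : Continuous g₁ := continuous_arcIntegral θ hgc
  have hg₁p : Function.Periodic g₁ (2 * Real.pi) := fun x => by
    simp only [hg₁, arcIntegral, add_right_comm x, hgp _]
  set g₂ := arcIntegral θ g₁ with hg₂
  have hg₂c : Continuous g₂ := continuous_arcIntegral θ hg₁c
  have hg₂p : Function.Periodic g₂ (2 * Real.pi) := fun x => by
    simp only [hg₂, arcIntegral, add_right_comm x, hg₁p _]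
  set f : ℝ → ℂ := fun x => g₁ x - (2 * S : ℝ) * g x with hf
  have hfM : ∀ x, ‖f x‖ ≤ M := by
    intro x
    have h1 : f x = ((∫ t in x - θ..x + θ, a t) - 2 * S * a x : ℝ) := by
      simp only [hf, hg₁, arcIntegral, hg]
      rw [intervalIntegral.integral_ofReal,
        intervalIntegral.integral_comp_add_left (fun t => a t) x, ← sub_eq_add_neg]
      push_cast
      ring
    rw [h1, Complex.norm_real]
    exact hM x
  have hcf : ∀ m, circleCoeff f m = (arcMultiplier θ m - 2 * S : ℝ) * circleCoeff g m := by
    intro m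
    rw [hf, circleCoeff_sub_const_mul hg₁c hgc, hg₁, circleCoeff_arcIntegral θ hgc hgp]
    push_cast
    ring
  have hcg : ∀ m : ℤ, m ≠ 1 → m ≠ -1 → ‖circleCoeff g m‖ ≤ M / c := by
    intro m h1 h2
    have h3 := norm_circleCoeff_le hfM m
    rw [hcf, norm_mul, Complex.norm_real] at h3
    rw [le_div_iff₀' hc]
    exact (mul_le_mul_of_nonneg_right (hcm m h1 h2) (norm_nonneg _)).trans h3
  have hcg₂ : ∀ m, circleCoeff g₂ m = (arcMultiplier θ m ^ 2 : ℝ) * circleCoeff g m := by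
    intro m
    rw [hg₂, circleCoeff_arcIntegral θ hg₁c hg₁p, hg₁, circleCoeff_arcIntegral θ hgc hgp]
    push_cast
    ring
  have hbound : ∀ m : ℤ, m ≠ 1 → m ≠ -1 →
      ‖circleCoeff g₂ m‖ ≤ arcMultiplier θ m ^ 2 * (M / c) := by
    intro m h1 h2
    rw [hcg₂, norm_mul, Complex.norm_real, Real.norm_of_nonneg (sq_nonneg _)]
    gcongr
    exact hcg m h1 h2
  have hsumb := (summable_sq_arcMultiplier θ).mul_right (M / c)
  have hsum : Summable (circleCoeff g₂) := by
    refine hsumb.of_norm_bounded_eventually ?_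
    filter_upwards [(toFinite ({1, -1} : Set ℤ)).compl_mem_cofinite] with m hm
    simp only [mem_compl_iff, mem_insert_iff, mem_singleton_iff, not_or] at hm
    exact hbound m hm.1 hm.2
  have hone : arcMultiplier θ 1 = 2 * S := by simp [arcMultiplier, hSdef]
  have hnegone : arcMultiplier θ (-1) = 2 * S := by rw [arcMultiplier_neg, hone]
  set z := circleCoeff g 1 with hz
  set w := circleCoeff g (-1) with hw
  have hmain : ∀ x, ‖g x - (z * Complex.exp (Complex.I * x) + w * Complex.exp (-(Complex.I * x)))‖ ≤
      (Λ / c + 2 * θ + 2 * S) / (4 * S ^ 2) * M := by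
    intro x
    have h1 := hasSum_circleCoeff hg₂c hg₂p hsum x
    set F : ℤ → ℂ := fun m => circleCoeff g₂ m * Complex.exp (Complex.I * m * x) with hF
    have h2 : HasSum (fun m : ℤ => if m ∈ ({1, -1} : Finset ℤ) then F m else 0)
        (∑ m ∈ ({1, -1} : Finset ℤ), if m ∈ ({1, -1} : Finset ℤ) then F m else 0) :=
      hasSum_sum_of_ne_finset_zero fun m hm => if_neg hm
    rw [Finset.sum_pair (by norm_num)] at h2
    have h3 := h1.sub h2
    have h4 : ‖g₂ x - (F 1 + F (-1))‖ ≤ Λ * (M / c) := by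
      have h5 := tsum_of_norm_bounded ((summable_sq_arcMultiplier θ).hasSum.mul_right (M / c))
        (f := fun m => F m - if m ∈ ({1, -1} : Finset ℤ) then F m else 0) (fun m => by
          split_ifs with hm
          · rw [sub_self, norm_zero]
            positivity
          · simp only [Finset.mem_insert, Finset.mem_singleton, not_or] at hm
            rw [sub_zero, norm_mul, show Complex.I * m * x = (m * x : ℝ) * Complex.I by
              push_cast; ring, Complex.norm_exp_ofReal_mul_I, mul_one]
            exact hbound m hm.1 hm.2)
      rw [h3.tsum_eq] at h5
      simpa using h5
    have h6 : F 1 + F (-1) = (4 * S ^ 2 : ℝ) *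
        (z * Complex.exp (Complex.I * x) + w * Complex.exp (-(Complex.I * x))) := by
      simp only [hF, hcg₂, hone, hnegone, ← hz, ← hw]
      push_cast
      ring_nf
    have h7 : arcIntegral θ f x = g₂ x - (2 * S : ℝ) * g₁ x := by
      simp only [arcIntegral, hf, hg₂, hg₁]
      rw [intervalIntegral.integral_sub (Continuous.intervalIntegrable (by fun_prop) _ _)
        (Continuous.intervalIntegrable (by fun_prop) _ _), intervalIntegral.integral_const_mul]
    have h8 : ‖arcIntegral θ f x‖ ≤ M * (2 * θ) := by
      have := intervalIntegral.norm_integral_le_of_norm_le_const (a := -θ) (b := θ)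
        (f := fun s => f (x + s)) (C := M) fun s _ => hfM _
      rwa [sub_neg_eq_add, ← two_mul, abs_of_pos (by positivity)] at this
    have h9 : (4 * S ^ 2 : ℝ) *
        (g x - (z * Complex.exp (Complex.I * x) + w * Complex.exp (-(Complex.I * x)))) =
        g₂ x - (F 1 + F (-1)) - arcIntegral θ f x - (2 * S : ℝ) * f x := by
      rw [h6, h7, hf]
      push_cast
      ring
    have h10 : 4 * S ^ 2 *
        ‖g x - (z * Complex.exp (Complex.I * x) + w * Complex.exp (-(Complex.I * x)))‖ ≤
        Λ * (M / c) + M * (2 * θ) + 2 * S * M := by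
      rw [← Real.norm_of_nonneg (show 0 ≤ 4 * S ^ 2 by positivity), ← Complex.norm_real, ← norm_mul,
        h9]
      refine (norm_sub_le _ _).trans (add_le_add ((norm_sub_le _ _).trans (add_le_add h4 h8)) ?_)
      rw [norm_mul, Complex.norm_real, Real.norm_of_nonneg (by positivity)]
      gcongr
      exact hfM x
    rw [div_mul_eq_mul_div, le_div_iff₀' (by positivity)]
    refine h10.trans (le_of_eq ?_)
    ring
  refine ⟨(z + w).re, (Complex.I * (z - w)).re, fun x => ?_⟩
  have h1 := (Complex.abs_re_le_norm _).trans (hmain x)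
  refine le_trans (le_of_eq ?_) h1
  congr 1
  rw [show Complex.exp (Complex.I * x) = Complex.cos x + Complex.sin x * Complex.I by
      rw [mul_comm, Complex.exp_mul_I],
    show Complex.exp (-(Complex.I * x)) = Complex.cos x - Complex.sin x * Complex.I by
      rw [mul_comm, ← neg_mul, Complex.exp_mul_I, Complex.cos_neg, Complex.sin_neg]; ring,
    ← Complex.ofReal_cos, ← Complex.ofReal_sin]
  simp [hg, -Complex.ofReal_cos, -Complex.ofReal_sin]
  ring

end Fourier

namespace Ck

variable {E F G : Type*} [NormedAddCommGroup E] [NormedSpace ℝ E] [NormedAddCommGroup F]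
  [NormedSpace ℝ F] [NormedAddCommGroup G] [NormedSpace ℝ G] {n : ℕ}

theorem norm_iteratedDeriv_bilin_le (B : E →L[ℝ] F →L[ℝ] G) (f : Ck n E) (g : Ck n F) {j : ℕ}
    (hj : j ≤ n) (x : ℝ) :
    ‖iteratedDeriv j (fun x => B (f x) (g x)) x‖ ≤ ‖B‖ * 2 ^ n * ‖f‖ * ‖g‖ := by
  have hj' : (j : WithTop ℕ∞) ≤ n := by exact_mod_cast hj
  have h := B.norm_iteratedFDeriv_le_of_bilinear f.contDiff g.contDiff x hj'
  simp only [norm_iteratedFDeriv_eq_norm_iteratedDeriv] at h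
  refine h.trans ?_
  rw [mul_assoc, mul_assoc]
  gcongr
  calc ∑ i ∈ Finset.range (j + 1), (j.choose i : ℝ) * ‖iteratedDeriv i f x‖ *
        ‖iteratedDeriv (j - i) g x‖
      ≤ ∑ i ∈ Finset.range (j + 1), (j.choose i : ℝ) * (‖f‖ * ‖g‖) := by
        refine Finset.sum_le_sum fun i hi => ?_
        have hi' := Finset.mem_range.1 hi
        rw [mul_assoc]
        gcongr
        · exact f.norm_iteratedDeriv_le (by omega) x
        · exact g.norm_iteratedDeriv_le (by omega) x
    _ = 2 ^ j * (‖f‖ * ‖g‖) := by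
        rw [← Finset.sum_mul]
        exact_mod_cast congrArg (fun a : ℕ => (a : ℝ) * (‖f‖ * ‖g‖)) (Nat.sum_range_choose j)
    _ ≤ _ := by
        gcongr
        norm_num

/-- A continuous bilinear map induces a continuous bilinear map on spaces of `C^n` functions. -/
noncomputable def bilinL (n : ℕ) (B : E →L[ℝ] F →L[ℝ] G) : Ck n E →L[ℝ] Ck n F →L[ℝ] Ck n G :=
  LinearMap.mkContinuous₂
    (LinearMap.mk₂ ℝ (fun f g => (⟨fun x => B (f x) (g x),
        (B.contDiff.comp f.contDiff).clm_apply g.contDiff, fun x => by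
          simp only [f.periodic x, g.periodic x]⟩ : Ck n G))
      (fun f f' g => ext fun x => by simp [add_apply]; rfl)
      (fun c f g => ext fun x => by simp [smul_apply]; rfl)
      (fun f g g' => ext fun x => by simp [add_apply]; rfl)
      (fun c f g => ext fun x => by simp [smul_apply]; rfl)) (‖B‖ * 2 ^ n)
    fun f g => by
      rw [norm_le_iff (by positivity)]
      exact fun j hj x => norm_iteratedDeriv_bilin_le B f g hj x

theorem bilinL_apply (B : E →L[ℝ] F →L[ℝ] G) (f : Ck n E) (g : Ck n F) (x : ℝ) :
    bilinL n B f g x = B (f x) (g x) := rfl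

theorem norm_bilinL_le (B : E →L[ℝ] F →L[ℝ] G) (f : Ck n E) (g : Ck n F) :
    ‖bilinL n B f g‖ ≤ ‖B‖ * 2 ^ n * ‖f‖ * ‖g‖ := by
  rw [norm_le_iff (by positivity)]
  exact fun j hj x => norm_iteratedDeriv_bilin_le B f g hj x

theorem continuous (f : Ck n E) : Continuous f.1 := f.contDiff.continuous

theorem norm_integral_le (f : Ck n E) (x y : ℝ) : ‖∫ t in x..y, f t‖ ≤ ‖f‖ * ‖y - x‖ :=
  intervalIntegral.norm_integral_le_of_norm_le_const fun t _ => f.norm_apply_le t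

/-- Integration from `0` to `x`. -/
noncomputable def integralL (n : ℕ) (E : Type*) [NormedAddCommGroup E] [NormedSpace ℝ E] (x : ℝ) :
    Ck n E →L[ℝ] E :=
  LinearMap.mkContinuous
    { toFun := fun f => ∫ t in (0 : ℝ)..x, f t
      map_add' := fun f g => intervalIntegral.integral_add (f.continuous.intervalIntegrable _ _)
        (g.continuous.intervalIntegrable _ _)
      map_smul' := fun c f => intervalIntegral.integral_smul c f.1 } ‖x‖ fun f => by
        rw [mul_comm]
        have := f.norm_integral_le 0 x
        rwa [sub_zero] at this

theorem integralL_apply (f : Ck n E) (x : ℝ) : integralL n E x f = ∫ t in (0 : ℝ)..x, f t := rfl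

theorem integralL_sub (f : Ck n E) (x y : ℝ) :
    integralL n E y f - integralL n E x f = ∫ t in x..y, f t :=
  intervalIntegral.integral_interval_sub_left (f.continuous.intervalIntegrable _ _)
    (f.continuous.intervalIntegrable _ _)

theorem isLittleO_norm_mul_norm {X : Type*} [NormedAddCommGroup X] (x : X) :
    (fun y => ‖y - x‖ * ‖y - x‖) =o[𝓝 x] fun y => y - x := by
  have h1 : Tendsto (fun y => ‖y - x‖) (𝓝 x) (𝓝 0) := by
    have : Continuous fun y : X => ‖y - x‖ := by fun_prop
    simpa using this.tendsto x
  have h2 := ((Asymptotics.isLittleO_one_iff ℝ).2 h1).mul_isBigO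
    (Asymptotics.isBigO_refl (fun y => ‖y - x‖) (𝓝 x))
  simp only [one_mul] at h2
  exact h2.of_norm_right

theorem hasDerivAt_integralL [CompleteSpace E] (n : ℕ) (x : ℝ) :
    HasDerivAt (integralL (n + 1) E) (evalL (n + 1) E x) x := by
  rw [hasDerivAt_iff_isLittleO]
  refine Asymptotics.IsBigO.trans_isLittleO ?_ (isLittleO_norm_mul_norm x)
  refine Asymptotics.IsBigO.of_bound 1 (Eventually.of_forall fun y => ?_)
  refine ContinuousLinearMap.opNorm_le_bound _ (by positivity) fun f => ?_
  rw [norm_mul, norm_norm, one_mul]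
  change ‖integralL (n + 1) E y f - integralL (n + 1) E x f - (y - x) • f x‖ ≤ _
  rw [integralL_sub, ← intervalIntegral.integral_const,
    ← intervalIntegral.integral_sub (f.continuous.intervalIntegrable _ _)
      (intervalIntegrable_const ..)]
  have := intervalIntegral.norm_integral_le_of_norm_le_const (a := x) (b := y)
    (f := fun t => f t - f x) (C := ‖f‖ * ‖y - x‖) fun t ht => by
      refine (f.norm_sub_le x t).trans ?_
      gcongr
      exact abs_sub_left_of_mem_uIcc (uIoc_subset_uIcc ht)
  refine this.trans (le_of_eq ?_)
  rw [Real.norm_eq_abs]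
  ring

theorem contDiff_integralL [CompleteSpace E] (n : ℕ) : ContDiff ℝ n (integralL n E) := by
  cases n with
  | zero =>
    rw [Nat.cast_zero, contDiff_zero]
    have : LipschitzWith 1 (integralL 0 E) := LipschitzWith.of_dist_le_mul fun y z => by
      rw [dist_eq_norm, dist_eq_norm, NNReal.coe_one, one_mul]
      refine ContinuousLinearMap.opNorm_le_bound _ (norm_nonneg _) fun f => ?_
      rw [mul_comm, _root_.sub_apply, integralL_sub]
      exact f.norm_integral_le z y
    exact this.continuous
  | succ n =>
    rw [show ((n + 1 : ℕ) : WithTop ℕ∞) = (n : WithTop ℕ∞) + 1 by push_cast; rfl,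
      contDiff_succ_iff_deriv]
    refine ⟨fun x => (hasDerivAt_integralL n x).differentiableAt, by simp, ?_⟩
    rw [funext fun x => (hasDerivAt_integralL (E := E) n x).deriv]
    exact contDiff_evalL n

/-- Integration with a variable endpoint gains one derivative jointly in the integrand and the
endpoint. -/
theorem contDiff_integral_eval [CompleteSpace E] (n : ℕ) :
    ContDiff ℝ (n + 1 : ℕ) fun p : Ck n E × ℝ => ∫ t in (0 : ℝ)..p.2, p.1 t := by
  have hd : ∀ p : Ck n E × ℝ, HasFDerivAt (fun p : Ck n E × ℝ => ∫ t in (0 : ℝ)..p.2, p.1 t)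
      ((integralL n E p.2).comp (ContinuousLinearMap.fst ℝ _ _) +
        (ContinuousLinearMap.snd ℝ (Ck n E) ℝ).smulRight (p.1 p.2)) p := by
    rintro ⟨f, x⟩
    have h1 : HasFDerivAt (fun p : Ck n E × ℝ => ∫ t in (0 : ℝ)..p.2, f t)
        ((ContinuousLinearMap.snd ℝ (Ck n E) ℝ).smulRight (f x)) (f, x) := by
      have := (show HasFDerivAt (fun x => ∫ t in (0 : ℝ)..x, f t) _ (f, x).2 from
        (f.continuous.integral_hasStrictDerivAt 0 x).hasDerivAt.hasFDerivAt).comp (f, x)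
          hasFDerivAt_snd
      refine this.congr_fderiv ?_
      ext p <;> simp
    have h2 : HasFDerivAt (fun p : Ck n E × ℝ => integralL n E p.2 (p.1 - f))
        ((integralL n E x).comp (ContinuousLinearMap.fst ℝ (Ck n E) ℝ)) (f, x) := by
      rw [hasFDerivAt_iff_isLittleO]
      refine Asymptotics.IsBigO.trans_isLittleO ?_ (isLittleO_norm_mul_norm (f, x))
      refine Asymptotics.IsBigO.of_bound 1 (Eventually.of_forall fun p => ?_)
      rw [norm_mul, norm_norm, one_mul]
      calc _ = ‖integralL n E p.2 (p.1 - f) - integralL n E x (p.1 - f)‖ := by simp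
        _ ≤ ‖p.1 - f‖ * ‖p.2 - x‖ := by
          rw [integralL_sub]
          exact norm_integral_le _ _ _
        _ ≤ _ := by
          gcongr
          · exact norm_fst_le (p - (f, x))
          · exact norm_snd_le (p - (f, x))
    refine (h2.add h1).congr_of_eventuallyEq (Eventually.of_forall fun p => ?_)
    simp [← integralL_apply]
  rw [show ((n + 1 : ℕ) : WithTop ℕ∞) = (n : WithTop ℕ∞) + 1 by push_cast; rfl,
    contDiff_succ_iff_fderiv]
  refine ⟨fun x => (hd x).differentiableAt, by simp, ?_⟩
  rw [funext fun x => (hd x).fderiv]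
  exact (((contDiff_integralL n).comp contDiff_snd).clm_comp contDiff_const).add
    (contDiff_const.smulRight (contDiff_eval n))

end Ck

/-- A `C¹` map that is homogeneous in its first argument depends continuously, in the operator norm
with respect to the first argument, on its second argument. -/
theorem ContDiffAt.eventually_norm_sub_le_of_homogeneous {X Y Z : Type*} [NormedAddCommGroup X]
    [NormedSpace ℝ X] [NormedAddCommGroup Y] [NormedSpace ℝ Y] [NormedAddCommGroup Z]
    [NormedSpace ℝ Z] {T : X × Y → Z} {y₀ : Y} (hT : ContDiffAt ℝ 1 T (0, y₀)) {V : Set Y}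
    (hV : V ∈ 𝓝 y₀) (hom : ∀ y ∈ V, ∀ (c : ℝ) x, T (c • x, y) = c • T (x, y)) {ε : ℝ}
    (hε : 0 < ε) : ∀ᶠ y in 𝓝 y₀, ∀ x, ‖T (x, y) - T (x, y₀)‖ ≤ ε * ‖x‖ := by
  have hs : HasStrictFDerivAt T (fderiv ℝ T (0, y₀)) (0, y₀) :=
    hT.hasStrictFDerivAt (by simp)
  set D := fderiv ℝ T (0, y₀) with hD
  have hDx : ∀ x, D (x, 0) = T (x, y₀) := by
    intro x
    have h1 : HasDerivAt (fun s : ℝ => (s • x, y₀)) (x, 0) 0 := by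
      simpa using ((hasDerivAt_id (0 : ℝ)).smul_const x).prodMk (hasDerivAt_const (0 : ℝ) y₀)
    have h2 : HasFDerivAt T D ((0 : ℝ) • x, y₀) := by simpa using hs.hasFDerivAt
    have h3 := h2.comp_hasDerivAt (f := fun s : ℝ => (s • x, y₀)) 0 h1
    have h4 : HasDerivAt (fun s : ℝ => s • T (x, y₀)) (T (x, y₀)) 0 := by
      simpa using (hasDerivAt_id (0 : ℝ)).smul_const (T (x, y₀))
    refine h3.unique (h4.congr_of_eventuallyEq (Eventually.of_forall fun s => ?_))
    exact hom y₀ (mem_of_mem_nhds hV) s x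
  have hb := hs.isLittleO.def hε
  obtain ⟨δ, hδ, hball⟩ := Metric.eventually_nhds_iff_ball.1 hb
  filter_upwards [hV, Metric.ball_mem_nhds y₀ hδ] with y hyV hy x
  have hT0 : T (0, y) = 0 := by simpa using hom y hyV 0 0
  have hsmall : ∀ z : X, ‖z‖ < δ → ‖T (z, y) - T (z, y₀)‖ ≤ ε * ‖z‖ := by
    intro z hz
    have h := hball ((z, y), (0, y)) (by
      rw [← ball_prod_same, ← ball_prod_same]
      exact ⟨⟨by simpa using hz, hy⟩, ⟨by simpa using hδ, hy⟩⟩)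
    simpa [hT0, hDx] using h
  rcases eq_or_ne x 0 with rfl | hx
  · exact hsmall 0 (by simpa using hδ)
  · have hx' := norm_pos_iff.2 hx
    set s := δ / (2 * ‖x‖) with hs'
    have hs0 : 0 < s := by positivity
    have h := hsmall (s • x) (by
      rw [norm_smul, Real.norm_of_nonneg hs0.le, hs']
      field_simp
      norm_num)
    rw [hom y hyV, hom y₀ (mem_of_mem_nhds hV), ← smul_sub, norm_smul, norm_smul,
      Real.norm_of_nonneg hs0.le] at h
    refine le_of_mul_le_mul_left ?_ hs0
    linarith

section Variation

variable {k m : ℕ}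

/-- The velocity of a curve, as an element of `C^k(S¹; ℝ²)`. -/
noncomputable def velocityL (h : k ≤ m + 1) : Ck (m + 2) Plane →L[ℝ] Ck k Plane :=
  (Ck.inclL h Plane).comp (Ck.derivL (m + 1) Plane)

/-- The part of the first variation of the area that involves an integral of the variation. -/
noncomputable def arcVariation (h : k ≤ m + 1) (a b : Ck (m + 2) Plane × ℝ → ℝ)
    (p : (Ck k Plane × Ck (m + 2) Plane) × ℝ) : ℝ :=
  (∫ t in (0 : ℝ)..p.2 + a (p.1.2, p.2), Ck.bilinL k wedge p.1.1 (velocityL h p.1.2) t) -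
    ∫ t in (0 : ℝ)..p.2 - b (p.1.2, p.2), Ck.bilinL k wedge p.1.1 (velocityL h p.1.2) t

/-- The chord between the intersection points. -/
noncomputable def endChord (a b : Ck (m + 2) Plane × ℝ → ℝ) (p : Ck (m + 2) Plane × ℝ) : Plane :=
  p.1 (p.2 + a p) - p.1 (p.2 - b p)

/-- The first variation of the area as an operator on `C^k(S¹; ℝ²)`. -/
noncomputable def variation (h : k ≤ m + 1) (a b : Ck (m + 2) Plane × ℝ → ℝ)
    (γ : Ck (m + 2) Plane) (σ : Ck k Plane) : Ck k ℝ :=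
  Ck.ofFun k (fun φ => arcVariation h a b ((σ, γ), φ)) -
    Ck.bilinL k wedge σ (Ck.ofFun k fun φ => endChord a b (γ, φ))

variable {U : Set (Ck (m + 2) Plane)} {a b : Ck (m + 2) Plane × ℝ → ℝ}

theorem contDiffOn_arcVariation (h : k ≤ m + 1)
    (ha : ContDiffOn ℝ (m + 2 : ℕ) a (U ×ˢ univ)) (hb : ContDiffOn ℝ (m + 2 : ℕ) b (U ×ˢ univ)) :
    ContDiffOn ℝ (k + 1 : ℕ) (arcVariation h a b) ((univ ×ˢ U) ×ˢ univ) := by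
  have hB : ContDiff ℝ (k + 1 : ℕ) fun p : (Ck k Plane × Ck (m + 2) Plane) × ℝ =>
      Ck.bilinL k wedge p.1.1 (velocityL h p.1.2) :=
    ((Ck.bilinL k wedge).contDiff.comp (contDiff_fst.comp contDiff_fst)).clm_apply
      ((velocityL h).contDiff.comp (contDiff_snd.comp contDiff_fst))
  have hq : ContDiff ℝ (k + 1 : ℕ) fun p : (Ck k Plane × Ck (m + 2) Plane) × ℝ =>
      ((p.1.2, p.2) : Ck (m + 2) Plane × ℝ) := by fun_prop
  have ha' : ContDiffOn ℝ (k + 1 : ℕ) (fun p : (Ck k Plane × Ck (m + 2) Plane) × ℝ =>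
      a (p.1.2, p.2)) ((univ ×ˢ U) ×ˢ univ) :=
    (ha.of_le (by norm_cast; omega)).comp hq.contDiffOn fun p hp => ⟨hp.1.2, mem_univ _⟩
  have hb' : ContDiffOn ℝ (k + 1 : ℕ) (fun p : (Ck k Plane × Ck (m + 2) Plane) × ℝ =>
      b (p.1.2, p.2)) ((univ ×ˢ U) ×ˢ univ) :=
    (hb.of_le (by norm_cast; omega)).comp hq.contDiffOn fun p hp => ⟨hp.1.2, mem_univ _⟩
  exact ((Ck.contDiff_integral_eval k).comp_contDiffOn
      (hB.contDiffOn.prodMk (contDiffOn_snd.add ha'))).sub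
    ((Ck.contDiff_integral_eval k).comp_contDiffOn (hB.contDiffOn.prodMk (contDiffOn_snd.sub hb')))

theorem contDiffOn_endChord
    (ha : ContDiffOn ℝ (m + 2 : ℕ) a (U ×ˢ univ)) (hb : ContDiffOn ℝ (m + 2 : ℕ) b (U ×ˢ univ)) :
    ContDiffOn ℝ (m + 2 : ℕ) (endChord a b) (U ×ˢ univ) :=
  ((Ck.contDiff_eval (m + 2)).comp_contDiffOn (contDiffOn_fst.prodMk (contDiffOn_snd.add ha))).sub
    ((Ck.contDiff_eval (m + 2)).comp_contDiffOn
      (contDiffOn_fst.prodMk (contDiffOn_snd.sub hb)))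

theorem arcVariation_eq (h : k ≤ m + 1) (σ : Ck k Plane) (γ : Ck (m + 2) Plane) (φ : ℝ) :
    arcVariation h a b ((σ, γ), φ) =
      ∫ t in φ - b (γ, φ)..φ + a (γ, φ), wedge (σ t) (deriv γ t) :=
  Ck.integralL_sub (Ck.bilinL k wedge σ (velocityL h γ)) _ _

theorem periodic_arcVariation (h : k ≤ m + 1) (σ : Ck k Plane) {γ : Ck (m + 2) Plane}
    (hap : Function.Periodic (fun φ => a (γ, φ)) (2 * Real.pi))
    (hbp : Function.Periodic (fun φ => b (γ, φ)) (2 * Real.pi)) :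
    Function.Periodic (fun φ => arcVariation h a b ((σ, γ), φ)) (2 * Real.pi) := by
  intro φ
  have h1 := hap φ
  have h2 := hbp φ
  simp only at h1 h2
  simp only [arcVariation_eq, h1, h2]
  rw [show φ + 2 * Real.pi - b (γ, φ) = φ - b (γ, φ) + 2 * Real.pi by ring,
    show φ + 2 * Real.pi + a (γ, φ) = φ + a (γ, φ) + 2 * Real.pi by ring,
    ← intervalIntegral.integral_comp_add_right]
  simp only [σ.periodic _, γ.periodic_deriv _]

theorem periodic_endChord {γ : Ck (m + 2) Plane}
    (hap : Function.Periodic (fun φ => a (γ, φ)) (2 * Real.pi))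
    (hbp : Function.Periodic (fun φ => b (γ, φ)) (2 * Real.pi)) :
    Function.Periodic (fun φ => endChord a b (γ, φ)) (2 * Real.pi) := by
  intro φ
  have h1 := hap φ
  have h2 := hbp φ
  simp only at h1 h2
  simp only [endChord, h1, h2]
  rw [show φ + 2 * Real.pi - b (γ, φ) = φ - b (γ, φ) + 2 * Real.pi by ring,
    show φ + 2 * Real.pi + a (γ, φ) = φ + a (γ, φ) + 2 * Real.pi by ring, γ.periodic, γ.periodic]

theorem variation_apply (h : k ≤ m + 1)
    (ha : ContDiffOn ℝ (m + 2 : ℕ) a (U ×ˢ univ)) (hb : ContDiffOn ℝ (m + 2 : ℕ) b (U ×ˢ univ))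
    (hap : ∀ γ ∈ U, Function.Periodic (fun φ => a (γ, φ)) (2 * Real.pi))
    (hbp : ∀ γ ∈ U, Function.Periodic (fun φ => b (γ, φ)) (2 * Real.pi))
    {γ : Ck (m + 2) Plane} (hγ : γ ∈ U) (σ : Ck k Plane) (φ : ℝ) :
    variation h a b γ σ φ =
      ∫ t in φ - b (γ, φ)..φ + a (γ, φ), wedge (chord σ φ t) (deriv γ t) := by
  have e1 : (Ck.ofFun k fun φ => arcVariation h a b ((σ, γ), φ)).1 = _ :=
    Ck.coe_ofFun_section (x := (σ, γ)) (U := univ ×ˢ U)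
      ((contDiffOn_arcVariation h ha hb).of_le (by norm_cast; omega))
      (fun p hp => periodic_arcVariation h p.1 (hap _ hp.2) (hbp _ hp.2)) ⟨mem_univ _, hγ⟩
  have e2 : (Ck.ofFun k fun φ => endChord a b (γ, φ)).1 = _ :=
    Ck.coe_ofFun_section (x := γ) ((contDiffOn_endChord ha hb).of_le (by norm_cast; omega))
      (fun γ hγ => periodic_endChord (hap γ hγ) (hbp γ hγ)) hγ
  have hc : Continuous (deriv γ) := (Ck.derivL (m + 1) Plane γ).continuous
  have hσ := σ.continuous
  have h3 : ∫ t in φ - b (γ, φ)..φ + a (γ, φ), wedge (σ φ) (deriv γ t) =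
      wedge (σ φ) (endChord a b (γ, φ)) := by
    rw [ContinuousLinearMap.intervalIntegral_comp_comm _ (hc.intervalIntegrable _ _),
      intervalIntegral.integral_deriv_eq_sub (fun t _ => γ.differentiable t)
        (hc.intervalIntegrable _ _), endChord]
  rw [variation, Ck.sub_apply, Ck.bilinL_apply, e1, e2]
  simp only [chord, map_sub, _root_.sub_apply, arcVariation_eq]
  rw [intervalIntegral.integral_sub, h3]
  · refine Continuous.intervalIntegrable ?_ _ _
    exact (wedge.continuous.comp hσ).clm_apply hc
  · exact ((wedge (σ φ)).continuous.comp hc).intervalIntegrable _ _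

theorem eventually_norm_variation_sub_le (h : k ≤ m + 1) (hU : IsOpen U)
    (ha : ContDiffOn ℝ (m + 2 : ℕ) a (U ×ˢ univ)) (hb : ContDiffOn ℝ (m + 2 : ℕ) b (U ×ˢ univ))
    (hap : ∀ γ ∈ U, Function.Periodic (fun φ => a (γ, φ)) (2 * Real.pi))
    (hbp : ∀ γ ∈ U, Function.Periodic (fun φ => b (γ, φ)) (2 * Real.pi))
    {γ₀ : Ck (m + 2) Plane} (hγ₀ : γ₀ ∈ U) {ε : ℝ} (hε : 0 < ε) :
    ∀ᶠ γ in 𝓝 γ₀, ∀ σ : Ck k Plane,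
      ‖variation h a b γ σ - variation h a b γ₀ σ‖ ≤ ε * ‖σ‖ := by
  have hcd := contDiffOn_arcVariation h ha hb
  have hper : ∀ p ∈ (univ : Set (Ck k Plane)) ×ˢ U,
      Function.Periodic (fun φ => arcVariation h a b (p, φ)) (2 * Real.pi) :=
    fun p hp => periodic_arcVariation h p.1 (hap _ hp.2) (hbp _ hp.2)
  have hO : IsOpen ((univ : Set (Ck k Plane)) ×ˢ U) := isOpen_univ.prod hU
  have hT := contDiffOn_ofFun_section (k := k) (ℓ := 1) hO hcd hper
  have hmem : ((0 : Ck k Plane), γ₀) ∈ (univ : Set (Ck k Plane)) ×ˢ U := ⟨mem_univ _, hγ₀⟩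
  have hT1 := (hT _ hmem).contDiffAt (hO.mem_nhds hmem)
  have h1 := ContDiffAt.eventually_norm_sub_le_of_homogeneous (by simpa using hT1)
    (hU.mem_nhds hγ₀) (fun γ hγ c σ => Ck.ext fun φ => by
      have e : ∀ σ : Ck k Plane, (Ck.ofFun k fun φ => arcVariation h a b ((σ, γ), φ)).1 = _ :=
        fun σ => Ck.coe_ofFun_section (x := (σ, γ)) (U := univ ×ˢ U)
          (hcd.of_le (by norm_cast; omega)) hper ⟨mem_univ _, hγ⟩
      rw [Ck.smul_apply, e, e]
      simp only [arcVariation_eq, Ck.smul_apply, map_smul, _root_.smul_apply,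
        intervalIntegral.integral_smul]) (half_pos hε)
  have hW := continuousOn_ofFun_section (k := k) hU
    ((contDiffOn_endChord ha hb).of_le (by norm_cast; omega))
    (fun γ hγ => periodic_endChord (hap γ hγ) (hbp γ hγ))
  have hWc := hW.continuousAt (hU.mem_nhds hγ₀)
  set K := ‖wedge‖ * 2 ^ k + 1 with hK
  have hK0 : 0 < K := by positivity
  have h2 := Metric.continuousAt_iff'.1 hWc (ε / 2 / K) (by positivity)
  filter_upwards [h1, h2] with γ hγ1 hγ2 σ
  rw [dist_eq_norm] at hγ2
  rw [variation, variation, sub_sub_sub_comm, ← map_sub]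
  refine (norm_sub_le _ _).trans ?_
  have h3 := Ck.norm_bilinL_le wedge σ ((Ck.ofFun k fun φ => endChord a b (γ, φ)) -
    Ck.ofFun k fun φ => endChord a b (γ₀, φ))
  have h4 : ‖wedge‖ * 2 ^ k * ‖σ‖ * ‖(Ck.ofFun k fun φ => endChord a b (γ, φ)) -
      Ck.ofFun k fun φ => endChord a b (γ₀, φ)‖ ≤ K * ‖σ‖ * (ε / 2 / K) := by
    gcongr
    linarith
  have h5 : K * ‖σ‖ * (ε / 2 / K) = ε / 2 * ‖σ‖ := by
    field_simp
  linarith [hγ1 σ]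

end Variation

theorem IsChordRoot.eq_of_circleCurve {r α β R θ₀ φ a b : ℝ} {n : ℕ}
    (h : IsChordRoot r α β (circleCurve n R) φ a b) (hR : 0 < R)
    (hr : r ^ 2 = 2 * R ^ 2 * (1 - Real.cos θ₀)) (hα : 0 < α) (hβ : β < Real.pi)
    (hθ₀ : θ₀ ∈ Icc 0 Real.pi) : a = θ₀ ∧ b = θ₀ := by
  have key : ∀ x ∈ Icc 0 Real.pi, ∀ y, Real.cos y = Real.cos x →
      ‖chord (circleCurve n R) φ (φ + y)‖ = r → x = θ₀ := by
    intro x hx y hxy h1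
    refine Real.injOn_cos hx hθ₀ ?_
    rw [← hxy]
    have h2 := norm_sq_circleCurve_sub n R φ y
    change ‖chord (circleCurve n R) φ (φ + y)‖ ^ 2 = _ at h2
    rw [h1, hr] at h2
    have h3 : 2 * R ^ 2 ≠ 0 := by positivity
    linarith [mul_left_cancel₀ h3 h2]
  have h1 := h.right_mem
  have h2 := h.left_mem
  refine ⟨key a ⟨by linarith [h1.1], by linarith [h1.2]⟩ a rfl (h.norm_right hα hβ),
    key b ⟨by linarith [h2.1], by linarith [h2.2]⟩ (-b) (Real.cos_neg b) ?_⟩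
  rw [← sub_eq_add_neg]
  exact h.norm_left hα hβ

section ArcEquation

theorem hasDerivAt_integral_arc {b : ℝ → ℝ} (hb : Continuous b) (θ x : ℝ) :
    HasDerivAt (fun x => ∫ t in x - θ..x + θ, b t) (b (x + θ) - b (x - θ)) x := by
  have hP := fun y => (hb.integral_hasStrictDerivAt 0 y).hasDerivAt
  have h := ((hP (x + θ)).comp_add_const x θ).sub ((hP (x - θ)).comp_sub_const x θ)
  refine h.congr_of_eventuallyEq (Eventually.of_forall fun y => ?_)
  exact (intervalIntegral.integral_interval_sub_left (hb.intervalIntegrable _ _)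
    (hb.intervalIntegrable _ _)).symm

theorem abs_iteratedDeriv_succ_le_of_arc {n : ℕ} {θ : ℝ} (hS : 0 < Real.sin θ) {b f : Ck n ℝ}
    (hf : ∀ x, f x = (∫ t in x - θ..x + θ, b t) - 2 * Real.sin θ * b x) {j : ℕ} (hj : j + 1 ≤ n)
    {M : ℝ} (hM : ∀ x, |iteratedDeriv j b x| ≤ M) (x : ℝ) :
    |iteratedDeriv (j + 1) b x| ≤ (‖f‖ + 2 * M) / (2 * Real.sin θ) := by
  have hbd : ContDiff ℝ (j + 1 : ℕ) b.1 := b.contDiff.of_le (by exact_mod_cast hj)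
  have hbj : ContDiff ℝ j b.1 := hbd.of_le (by norm_cast; omega)
  have hbj' : ContDiff ℝ j (deriv b.1) := by
    rw [show ((j + 1 : ℕ) : WithTop ℕ∞) = (j : WithTop ℕ∞) + 1 by push_cast; rfl,
      contDiff_succ_iff_deriv] at hbd
    exact hbd.2.2
  have hdf : deriv f.1 = fun x => (b (x + θ) - b (x + -θ)) - 2 * Real.sin θ * deriv b x := by
    funext x
    have h1 := (hasDerivAt_integral_arc b.continuous θ x).sub
      (((hbd.differentiable (by simp) x).hasDerivAt).const_mul (2 * Real.sin θ))
    rw [← sub_eq_add_neg, ← h1.deriv]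
    congr 1
    exact funext hf
  have hshift : ∀ s, ContDiff ℝ j fun x => b.1 (x + s) := fun s =>
    hbj.comp (contDiff_id.add contDiff_const)
  have h1 : iteratedDeriv (j + 1) f x = iteratedDeriv j b (x + θ) - iteratedDeriv j b (x + -θ) -
      2 * Real.sin θ * iteratedDeriv (j + 1) b x := by
    rw [iteratedDeriv_succ', hdf]
    erw [iteratedDeriv_fun_sub ((hshift θ).sub (hshift (-θ))).contDiffAt
      (contDiff_const.mul hbj').contDiffAt]
    rw [iteratedDeriv_fun_sub (hshift θ).contDiffAt (hshift (-θ)).contDiffAt,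
      iteratedDeriv_comp_add_const, iteratedDeriv_comp_add_const,
      iteratedDeriv_const_mul_field, ← iteratedDeriv_succ']
  have h2 := f.norm_iteratedDeriv_le hj x
  rw [Real.norm_eq_abs] at h2
  rw [le_div_iff₀' (by positivity), ← abs_of_pos (show 0 < 2 * Real.sin θ by positivity), ← abs_mul,
    show 2 * Real.sin θ * iteratedDeriv (j + 1) b x = iteratedDeriv j b (x + θ) -
      iteratedDeriv j b (x + -θ) - iteratedDeriv (j + 1) f x by rw [h1]; ring]
  calc _ ≤ |iteratedDeriv j b (x + θ)| + |iteratedDeriv j b (x + -θ)| +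
          |iteratedDeriv (j + 1) f x| :=
        (abs_sub _ _).trans (add_le_add_left (abs_sub _ _) _)
    _ ≤ _ := by linarith [hM (x + θ), hM (x + -θ)]

theorem exists_norm_le_of_arc (n : ℕ) {θ : ℝ} (hS : 0 < Real.sin θ) :
    ∃ C, 0 ≤ C ∧ ∀ b f : Ck n ℝ,
      (∀ x, f x = (∫ t in x - θ..x + θ, b t) - 2 * Real.sin θ * b x) →
      ∀ M, (∀ x, |b x| ≤ M) → ‖b‖ ≤ C * (‖f‖ + M) := by
  have key : ∀ j, ∃ C, 0 ≤ C ∧ ∀ b f : Ck n ℝ,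
      (∀ x, f x = (∫ t in x - θ..x + θ, b t) - 2 * Real.sin θ * b x) →
      ∀ M, (∀ x, |b x| ≤ M) → ∀ i ≤ j, i ≤ n → ∀ x, |iteratedDeriv i b x| ≤ C * (‖f‖ + M) := by
    intro j
    induction j with
    | zero =>
      refine ⟨1, zero_le_one, fun b f _ M hM i hi _ x => ?_⟩
      rw [Nat.le_zero.1 hi, iteratedDeriv_zero]
      linarith [hM x, norm_nonneg f]
    | succ j ih =>
      obtain ⟨C, hC, h⟩ := ih
      refine ⟨C + (1 + 2 * C) / (2 * Real.sin θ), by positivity, fun b f hf M hM i hi hin x => ?_⟩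
      have hM0 : 0 ≤ M := (abs_nonneg _).trans (hM 0)
      have hN : 0 ≤ ‖f‖ + M := by positivity
      rw [add_mul]
      rcases Nat.lt_or_ge i (j + 1) with hlt | hge
      · have h2 : 0 ≤ (1 + 2 * C) / (2 * Real.sin θ) * (‖f‖ + M) := by positivity
        linarith [h b f hf M hM i (by omega) hin x]
      · obtain rfl : i = j + 1 := by omega
        have h2 := abs_iteratedDeriv_succ_le_of_arc hS hf hin
          (fun y => h b f hf M hM j le_rfl (by omega) y) x
        have h3 : (‖f‖ + 2 * (C * (‖f‖ + M))) / (2 * Real.sin θ) ≤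
            (1 + 2 * C) / (2 * Real.sin θ) * (‖f‖ + M) := by
          rw [div_mul_eq_mul_div]
          gcongr
          linarith
        linarith [mul_nonneg hC hN]
  obtain ⟨C, hC, h⟩ := key n
  refine ⟨C, hC, fun b f hf M hM => ?_⟩
  have hM0 : 0 ≤ M := (abs_nonneg _).trans (hM 0)
  exact (Ck.norm_le_iff (by positivity)).2 fun j hj x => h b f hf M hM j hj hj x

/-- The cosine as an element of `C^n(S¹; ℝ)`. -/
noncomputable def Ck.cos (n : ℕ) : Ck n ℝ := ⟨Real.cos, Real.contDiff_cos, Real.cos_periodic⟩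

/-- The sine as an element of `C^n(S¹; ℝ)`. -/
noncomputable def Ck.sin (n : ℕ) : Ck n ℝ := ⟨Real.sin, Real.contDiff_sin, Real.sin_periodic⟩

/-- A function is controlled in `C^{n+1}` by its first order jet at `0` and the difference of its
integral over arcs of radius `θ` and its multiple by `2 sin θ`. -/
theorem exists_norm_le_of_arc_of_jet_eq_zero (n : ℕ) {θ : ℝ} (h0 : 0 < θ) (hπ : θ < Real.pi) :
    ∃ C, 0 ≤ C ∧ ∀ a f : Ck (n + 1) ℝ,
      (∀ x, f x = (∫ t in x - θ..x + θ, a t) - 2 * Real.sin θ * a x) →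
      a 0 = 0 → deriv a 0 = 0 → ‖a‖ ≤ C * ‖f‖ := by
  have hS : 0 < Real.sin θ := Real.sin_pos_of_pos_of_lt_pi h0 hπ
  obtain ⟨C₀, hC₀, h₀⟩ := exists_const_trig_approx h0 hπ
  obtain ⟨C₁, hC₁, h₁⟩ := exists_norm_le_of_arc (n + 1) hS
  set C₂ := C₁ * (1 + C₀) with hC₂
  refine ⟨C₂ * (1 + ‖Ck.cos (n + 1)‖ + ‖Ck.sin (n + 1)‖), by positivity,
    fun a f hf ha0 ha1 => ?_⟩
  obtain ⟨p, q, hpq⟩ := h₀ a a.continuous a.periodic ‖f‖ fun x => by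
    rw [← hf]
    exact f.norm_apply_le x
  set b : Ck (n + 1) ℝ := a - (p • Ck.cos (n + 1) + q • Ck.sin (n + 1)) with hb
  have hbx : ∀ x, b x = a x - (p * Real.cos x + q * Real.sin x) := fun x => rfl
  have hbd : deriv b 0 = deriv a 0 - q := by
    have h1 := ((a.differentiable 0).hasDerivAt).sub
      (((Real.hasDerivAt_cos 0).const_mul p).add ((Real.hasDerivAt_sin 0).const_mul q))
    have h2 : HasDerivAt b.1 _ 0 := h1
    rw [h2.deriv]
    simp
  have hfb : ∀ x, f x = (∫ t in x - θ..x + θ, b t) - 2 * Real.sin θ * b x := by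
    intro x
    simp only [hbx]
    have ic : IntervalIntegrable (fun t => p * Real.cos t) volume (x - θ) (x + θ) :=
      Continuous.intervalIntegrable (by fun_prop) _ _
    have is : IntervalIntegrable (fun t => q * Real.sin t) volume (x - θ) (x + θ) :=
      Continuous.intervalIntegrable (by fun_prop) _ _
    rw [intervalIntegral.integral_sub (a.continuous.intervalIntegrable _ _) (ic.add is),
      intervalIntegral.integral_add ic is, intervalIntegral.integral_const_mul,
      intervalIntegral.integral_const_mul, integral_cos, integral_sin, hf]
    simp only [Real.sin_add, Real.sin_sub, Real.cos_add, Real.cos_sub]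
    ring
  have hbn : ‖b‖ ≤ C₂ * ‖f‖ := by
    refine (h₁ b f hfb _ fun x => hpq x).trans (le_of_eq ?_)
    rw [hC₂]
    ring
  have hp : ‖p‖ ≤ ‖b‖ := by
    have := b.norm_apply_le 0
    rw [hbx, ha0] at this
    simpa using this
  have hq : ‖q‖ ≤ ‖b‖ := by
    have := b.norm_deriv_le 0
    rw [hbd, ha1] at this
    simpa using this
  calc ‖a‖ = ‖b + (p • Ck.cos (n + 1) + q • Ck.sin (n + 1))‖ := by rw [hb, sub_add_cancel]
    _ ≤ ‖b‖ + (‖p‖ * ‖Ck.cos (n + 1)‖ + ‖q‖ * ‖Ck.sin (n + 1)‖) := by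
      refine (norm_add_le _ _).trans (add_le_add_right ((norm_add_le _ _).trans ?_) _)
      rw [norm_smul, norm_smul]
    _ ≤ ‖b‖ + (‖b‖ * ‖Ck.cos (n + 1)‖ + ‖b‖ * ‖Ck.sin (n + 1)‖) := by gcongr
    _ = ‖b‖ * (1 + ‖Ck.cos (n + 1)‖ + ‖Ck.sin (n + 1)‖) := by ring
    _ ≤ C₂ * ‖f‖ * (1 + ‖Ck.cos (n + 1)‖ + ‖Ck.sin (n + 1)‖) := by gcongr
    _ = _ := by ring

/-- A periodic function that vanishes at `0` is controlled by its derivative up to constants. -/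
theorem Ck.norm_le_of_deriv_eq_const_add {n : ℕ} {b : Ck (n + 1) ℝ} {g : Ck n ℝ} {c : ℝ}
    (hb0 : b 0 = 0) (hb : ∀ x, deriv b x = c + g x) : ‖b‖ ≤ 4 * Real.pi * ‖g‖ := by
  have hp := Real.pi_pos
  have hc : |c| ≤ ‖g‖ := by
    have h1 : ∫ t in (0 : ℝ)..2 * Real.pi, deriv b t = 0 := by
      rw [intervalIntegral.integral_deriv_eq_sub (fun t _ => b.differentiable t)
        ((Ck.derivL n ℝ b).continuous.intervalIntegrable _ _)]
      have := b.periodic 0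
      rw [zero_add] at this
      rw [this, sub_self]
    simp only [hb] at h1
    rw [intervalIntegral.integral_add intervalIntegrable_const
      (g.continuous.intervalIntegrable _ _), intervalIntegral.integral_const, sub_zero,
      smul_eq_mul] at h1
    have h2 := g.norm_integral_le 0 (2 * Real.pi)
    rw [sub_zero, Real.norm_of_nonneg (show 0 ≤ 2 * Real.pi by positivity),
      show ∫ t in (0 : ℝ)..2 * Real.pi, g t = -(2 * Real.pi * c) by linarith, norm_neg, norm_mul,
      Real.norm_of_nonneg (show 0 ≤ 2 * Real.pi by positivity), mul_comm] at h2
    exact le_of_mul_le_mul_right h2 (by positivity)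
  set κ : Ck n ℝ := ⟨fun _ => c, contDiff_const, fun _ => rfl⟩ with hκ
  have hκn : ‖κ‖ ≤ ‖g‖ := by
    refine ((Ck.norm_le_iff (abs_nonneg c)).2 fun j _ x => ?_).trans hc
    change ‖iteratedDeriv j (fun _ => c) x‖ ≤ _
    rw [iteratedDeriv_const]
    split_ifs <;> simp
  have hd : Ck.derivL n ℝ b = κ + g := Ck.ext fun x => hb x
  have hdn : ‖Ck.derivL n ℝ b‖ ≤ 2 * ‖g‖ := by
    rw [hd]
    linarith [norm_add_le κ g]
  have hbx : ∀ x, ‖b x‖ ≤ 4 * Real.pi * ‖g‖ := by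
    intro x
    obtain ⟨y, hy, hxy⟩ := b.periodic.exists_mem_Ico₀ Real.two_pi_pos x
    rw [hxy, show b y = b y - b 0 by rw [hb0, sub_zero]]
    have h1 := convex_univ.norm_image_sub_le_of_norm_deriv_le (𝕜 := ℝ) (f := b.1)
      (fun x _ => b.differentiable x)
      (fun x _ => ((Ck.derivL n ℝ b).norm_apply_le x).trans hdn) (mem_univ 0) (mem_univ y)
    rw [sub_zero, Real.norm_of_nonneg hy.1] at h1
    refine h1.trans ?_
    nlinarith [mul_le_mul_of_nonneg_left hy.2.le (norm_nonneg g)]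
  refine (Ck.norm_le_iff (by positivity)).2 fun j hj x => ?_
  cases j with
  | zero => simpa using hbx x
  | succ j =>
    have h1 := (Ck.derivL n ℝ b).norm_iteratedDeriv_le (Nat.succ_le_succ_iff.1 hj) x
    rw [iteratedDeriv_succ']
    refine (h1.trans hdn).trans ?_
    gcongr
    linarith [Real.pi_gt_three]

end ArcEquation

section Frame

/-- The Euclidean inner product of the plane as a continuous bilinear map. -/
noncomputable def dot : Plane →L[ℝ] Plane →L[ℝ] ℝ :=
  (EuclideanSpace.proj (0 : Fin 2) : Plane →L[ℝ] ℝ).smulRight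
      (EuclideanSpace.proj (0 : Fin 2) : Plane →L[ℝ] ℝ) +
    (EuclideanSpace.proj (1 : Fin 2) : Plane →L[ℝ] ℝ).smulRight
      (EuclideanSpace.proj (1 : Fin 2) : Plane →L[ℝ] ℝ)

theorem dot_apply (x y : Plane) : dot x y = x 0 * y 0 + x 1 * y 1 := by
  simp [dot]

/-- The outer unit normal of the circle. -/
noncomputable def Ck.normal (n : ℕ) : Ck n Plane := circleCurve n 1

/-- The unit tangent of the circle. -/
noncomputable def Ck.tangent (n : ℕ) : Ck n Plane := Ck.derivL n Plane (circleCurve (n + 1) 1)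

theorem Ck.normal_apply (n : ℕ) (x : ℝ) : Ck.normal n x = !₂[Real.cos x, Real.sin x] := by
  rw [Ck.normal, circleCurve_apply]
  simp

theorem Ck.tangent_apply (n : ℕ) (x : ℝ) : Ck.tangent n x = !₂[-Real.sin x, Real.cos x] := by
  rw [Ck.tangent, Ck.derivL_apply, deriv_circleCurve]
  simp

theorem deriv_circleCurve_eq_smul (N n : ℕ) (R x : ℝ) :
    deriv (circleCurve N R) x = R • Ck.tangent n x := by
  rw [deriv_circleCurve, Ck.tangent_apply]
  ext i
  fin_cases i <;> simp

theorem Ck.hasDerivAt_normal (n : ℕ) (x : ℝ) : HasDerivAt (Ck.normal n) (Ck.tangent n x) x := by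
  have := circleCurve_hasDerivAt n 1 x
  rw [Ck.tangent_apply]
  simpa [Ck.normal] using this

theorem Ck.frame_decomposition {n : ℕ} (σ : Ck n Plane) :
    σ = Ck.bilinL n (ContinuousLinearMap.lsmul ℝ ℝ) (Ck.bilinL n wedge σ (Ck.tangent n))
        (Ck.normal n) +
      Ck.bilinL n (ContinuousLinearMap.lsmul ℝ ℝ) (Ck.bilinL n wedge (Ck.normal n) σ)
        (Ck.tangent n) := by
  refine Ck.ext fun x => ?_
  rw [Ck.add_apply]
  simp only [Ck.bilinL_apply, Ck.normal_apply, Ck.tangent_apply, ContinuousLinearMap.lsmul_apply,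
    wedge_apply]
  have h := Real.sin_sq_add_cos_sq x
  ext i
  fin_cases i
  · simp
    linear_combination (-(σ x 0)) * h
  · simp
    linear_combination (-(σ x 1)) * h

theorem Ck.exists_norm_le_frame (n : ℕ) : ∃ K, 0 ≤ K ∧ ∀ σ : Ck n Plane,
    ‖σ‖ ≤ K * (‖Ck.bilinL n wedge σ (Ck.tangent n)‖ + ‖Ck.bilinL n wedge (Ck.normal n) σ‖) := by
  set B : ℝ →L[ℝ] Plane →L[ℝ] Plane := ContinuousLinearMap.lsmul ℝ ℝ
  refine ⟨‖B‖ * 2 ^ n * ‖Ck.normal n‖ + ‖B‖ * 2 ^ n * ‖Ck.tangent n‖, by positivity, fun σ => ?_⟩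
  set a := Ck.bilinL n wedge σ (Ck.tangent n) with ha
  set b := Ck.bilinL n wedge (Ck.normal n) σ with hb
  have h1 : ‖σ‖ ≤ ‖Ck.bilinL n B a (Ck.normal n)‖ + ‖Ck.bilinL n B b (Ck.tangent n)‖ :=
    (congrArg norm σ.frame_decomposition).le.trans (norm_add_le _ _)
  have h2 := Ck.norm_bilinL_le B a (Ck.normal n)
  have h3 := Ck.norm_bilinL_le B b (Ck.tangent n)
  have h4 : 0 ≤ ‖B‖ * 2 ^ n * ‖Ck.normal n‖ * ‖b‖ := by positivity
  have h5 : 0 ≤ ‖B‖ * 2 ^ n * ‖Ck.tangent n‖ * ‖a‖ := by positivity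
  linarith

variable {n : ℕ}

theorem circleVariation_eq {R : ℝ} (N : ℕ) (σ : Ck (n + 1) Plane) (θ φ : ℝ) :
    ∫ t in φ - θ..φ + θ, wedge (chord σ φ t) (deriv (circleCurve N R) t) =
      R * ((∫ t in φ - θ..φ + θ, Ck.bilinL (n + 1) wedge σ (Ck.tangent (n + 1)) t) -
        2 * Real.sin θ * Ck.bilinL (n + 1) wedge σ (Ck.tangent (n + 1)) φ) := by
  have hτ := (Ck.tangent (n + 1)).continuous
  have h1 : ∫ t in φ - θ..φ + θ, wedge (σ φ) (Ck.tangent (n + 1) t) =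
      2 * Real.sin θ * wedge (σ φ) (Ck.tangent (n + 1) φ) := by
    rw [ContinuousLinearMap.intervalIntegral_comp_comm _ (hτ.intervalIntegrable _ _),
      intervalIntegral.integral_eq_sub_of_hasDerivAt
        (fun t _ => Ck.hasDerivAt_normal (n + 1) t) (hτ.intervalIntegrable _ _)]
    simp only [Ck.normal_apply, Ck.tangent_apply, wedge_apply, PiLp.sub_apply, Real.cos_add,
      Real.cos_sub, Real.sin_add, Real.sin_sub]
    simp
    ring
  simp only [deriv_circleCurve_eq_smul N (n + 1) R, chord, map_smul, map_sub, _root_.sub_apply,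
    smul_eq_mul]
  rw [intervalIntegral.integral_const_mul, intervalIntegral.integral_sub, h1]
  · rfl
  · exact (Ck.bilinL (n + 1) wedge σ (Ck.tangent (n + 1))).continuous.intervalIntegrable _ _
  · exact ((wedge (σ φ)).continuous.comp hτ).intervalIntegrable _ _

theorem deriv_normalComponent {σ : Ck (n + 1) Plane} (h0 : σ 0 = 0) (h1 : deriv σ 0 0 = 0) :
    deriv (Ck.bilinL (n + 1) wedge σ (Ck.tangent (n + 1))) 0 = 0 := by
  have hd := (σ.hasDerivAt 0).wedge ((Ck.tangent (n + 1)).hasDerivAt 0)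
  have hd' : HasDerivAt (Ck.bilinL (n + 1) wedge σ (Ck.tangent (n + 1))) _ 0 := hd
  rw [hd'.deriv, h0, Ck.tangent_apply, wedge_apply]
  simp [h1]

theorem deriv_tangentialComponent {R : ℝ} (hR : R ≠ 0) (σ β : Ck (n + 1) Plane) {c : ℝ}
    (hc : ∀ φ, inner ℝ (deriv σ φ) (deriv β φ) = c) (x : ℝ) :
    deriv (Ck.bilinL (n + 1) wedge (Ck.normal (n + 1)) σ) x = c / R +
      (R⁻¹ • Ck.bilinL n dot (Ck.derivL n Plane σ)
        (Ck.derivL n Plane (circleCurve (n + 1) R - β)) -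
        Ck.incl n.le_succ (Ck.bilinL (n + 1) wedge σ (Ck.tangent (n + 1)))) x := by
  have hd : HasDerivAt (Ck.bilinL (n + 1) wedge (Ck.normal (n + 1)) σ) _ x :=
    (Ck.hasDerivAt_normal (n + 1) x).wedge (σ.hasDerivAt x)
  rw [hd.deriv]
  change _ = c / R + (R⁻¹ * dot (deriv σ x) (deriv (circleCurve (n + 1) R - β : Ck (n + 1) Plane) x)
    - wedge (σ x) (Ck.tangent (n + 1) x))
  have h1 : deriv (circleCurve (n + 1) R - β : Ck (n + 1) Plane) x =
      R • Ck.tangent (n + 1) x - deriv β x := by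
    rw [← deriv_circleCurve_eq_smul (n + 1)]
    exact (((circleCurve (n + 1) R).hasDerivAt x).sub (β.hasDerivAt x)).deriv
  have h2 := hc x
  rw [inner_plane] at h2
  rw [h1, Ck.normal_apply, Ck.tangent_apply, ← h2]
  simp only [dot_apply, wedge_apply, PiLp.sub_apply, PiLp.smul_apply]
  simp
  field_simp
  ring

/-- The first variation at the circle is bounded below on infinitesimal variations that preserve the
constancy of speed with respect to a curve close to the circle. -/
theorem exists_norm_le_circleVariation (n N : ℕ) {R θ : ℝ} (hR : 0 < R) (h0 : 0 < θ)
    (hπ : θ < Real.pi) :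
    ∃ C, 0 < C ∧ ∃ δ, 0 < δ ∧ ∀ (β σ : Ck (n + 1) Plane) (f : Ck (n + 1) ℝ) (c : ℝ),
      ‖circleCurve (n + 1) R - β‖ ≤ δ → (∀ φ, inner ℝ (deriv σ φ) (deriv β φ) = c) →
      σ 0 = 0 → deriv σ 0 0 = 0 →
      (∀ φ, f φ = ∫ t in φ - θ..φ + θ, wedge (chord σ φ t) (deriv (circleCurve N R) t)) →
      ‖σ‖ ≤ C * ‖f‖ := by
  obtain ⟨A, hA, hAb⟩ := exists_norm_le_of_arc_of_jet_eq_zero n h0 hπ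
  obtain ⟨K, hK, hKb⟩ := Ck.exists_norm_le_frame (n + 1)
  have hp := Real.pi_pos
  set D := R⁻¹ * (‖dot‖ * 2 ^ n) with hD
  have hD0 : 0 ≤ D := by positivity
  set Q := 4 * Real.pi * K * D with hQ
  have hQ0 : 0 ≤ Q := by positivity
  refine ⟨2 * K * (1 + 4 * Real.pi) * (A * R⁻¹) + 1, by positivity, 1 / (2 * (Q + 1)),
    by positivity, fun β σ f c hβ hc hσ0 hσ1 hf => ?_⟩
  set a := Ck.bilinL (n + 1) wedge σ (Ck.tangent (n + 1)) with ha
  set b := Ck.bilinL (n + 1) wedge (Ck.normal (n + 1)) σ with hb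
  have han : ‖a‖ ≤ A * R⁻¹ * ‖f‖ := by
    have h1 := hAb a (R⁻¹ • f) (fun x => by
      rw [Ck.smul_apply, hf, circleVariation_eq, smul_eq_mul, inv_mul_cancel_left₀ hR.ne'])
      (by rw [ha, Ck.bilinL_apply, hσ0]; simp) (deriv_normalComponent hσ0 hσ1)
    rwa [norm_smul, Real.norm_of_nonneg (inv_nonneg.2 hR.le), ← mul_assoc] at h1
  have hbn := Ck.norm_le_of_deriv_eq_const_add (b := b)
    (by rw [hb, Ck.bilinL_apply, hσ0]; simp) (deriv_tangentialComponent hR.ne' σ β hc)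
  rw [← ha] at hbn
  have hdle : ∀ τ : Ck (n + 1) Plane, ‖Ck.derivL n Plane τ‖ ≤ ‖τ‖ := fun τ =>
    (Ck.norm_le_iff (norm_nonneg τ)).2 fun j hj x => by
      have := τ.norm_iteratedDeriv_le (Nat.succ_le_succ hj) x
      rwa [iteratedDeriv_succ'] at this
  have hincl : ‖Ck.incl n.le_succ a‖ ≤ ‖a‖ :=
    (Ck.norm_le_iff (norm_nonneg a)).2 fun j hj x => a.norm_iteratedDeriv_le (hj.trans n.le_succ) x
  have hg : ‖R⁻¹ • Ck.bilinL n dot (Ck.derivL n Plane σ)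
      (Ck.derivL n Plane (circleCurve (n + 1) R - β)) - Ck.incl n.le_succ a‖ ≤
      D * ‖σ‖ * (1 / (2 * (Q + 1))) + ‖a‖ := by
    refine (norm_sub_le _ _).trans (add_le_add ?_ hincl)
    rw [norm_smul, Real.norm_of_nonneg (inv_nonneg.2 hR.le)]
    calc _ ≤ R⁻¹ * (‖dot‖ * 2 ^ n * ‖Ck.derivL n Plane σ‖ *
          ‖Ck.derivL n Plane (circleCurve (n + 1) R - β)‖) := by
          gcongr
          exact Ck.norm_bilinL_le _ _ _
      _ ≤ R⁻¹ * (‖dot‖ * 2 ^ n * ‖σ‖ * (1 / (2 * (Q + 1)))) := by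
          gcongr
          · exact hdle σ
          · exact (hdle _).trans hβ
      _ = _ := by rw [hD]; ring
  have h1 : ‖σ‖ ≤ K * (‖a‖ + 4 * Real.pi * (D * ‖σ‖ * (1 / (2 * (Q + 1))) + ‖a‖)) := by
    refine (hKb σ).trans ?_
    gcongr
    refine hbn.trans ?_
    gcongr
  have h2 : K * (‖a‖ + 4 * Real.pi * (D * ‖σ‖ * (1 / (2 * (Q + 1))) + ‖a‖)) =
      K * (1 + 4 * Real.pi) * ‖a‖ + Q / (Q + 1) * (‖σ‖ / 2) := by
    rw [hQ]
    field_simp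
    ring
  have h3 : Q / (Q + 1) * (‖σ‖ / 2) ≤ ‖σ‖ / 2 := by
    refine mul_le_of_le_one_left (by positivity) ?_
    rw [div_le_one (by positivity)]
    linarith
  have h4 : K * (1 + 4 * Real.pi) * ‖a‖ ≤ K * (1 + 4 * Real.pi) * (A * R⁻¹ * ‖f‖) := by gcongr
  linarith [norm_nonneg f]

end Frame

theorem Ck.norm_incl_le {E : Type*} [NormedAddCommGroup E] [NormedSpace ℝ E] {k n : ℕ} (h : k ≤ n)
    (f : Ck n E) : ‖Ck.incl h f‖ ≤ ‖f‖ :=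
  (Ck.norm_le_iff (norm_nonneg f)).2 fun _ hj x => f.norm_iteratedDeriv_le (hj.trans h) x

theorem exists_chord_angle {r R : ℝ} (hr : 0 < r) (hR : r / 2 < R) :
    ∃ θ, 0 < θ ∧ θ < Real.pi ∧ r ^ 2 = 2 * R ^ 2 * (1 - Real.cos θ) := by
  have hR0 : 0 < R := by linarith
  have h1 : 0 < r / (2 * R) := by positivity
  have h2 : r / (2 * R) < 1 := by
    rw [div_lt_one (by positivity)]
    linarith
  refine ⟨2 * Real.arcsin (r / (2 * R)), by linarith [Real.arcsin_pos.2 h1],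
    by linarith [Real.arcsin_lt_pi_div_two.2 h2], ?_⟩
  rw [Real.cos_two_mul, Real.cos_sq', Real.sin_arcsin (by linarith) h2.le]
  field_simp
  ring

/-- Near the circle, the circular integral invariant is a `C^{ℓ+1}` map whose derivative at the
circle is bounded below on normalized variations, and varies little in the `C^k` norm. -/
theorem exists_circularInvariant_map (n ℓ : ℕ) {r R : ℝ} (hr : 0 < r) (hR : r / 2 < R)
    (h : n + 1 ≤ n + 1 + ℓ + 2) :
    ∃ ρ, 0 < ρ ∧ ∃ c, 0 < c ∧ ∃ I : Ck (n + 1 + ℓ + 2) Plane → Ck (n + 1) ℝ,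
      (∀ γ ∈ Metric.ball (circleCurve (n + 1 + ℓ + 2) R) ρ, ∀ φ,
        I γ φ = circularInvariant r γ φ) ∧
      ContDiffOn ℝ (ℓ + 1 : ℕ) I (Metric.ball (circleCurve (n + 1 + ℓ + 2) R) ρ) ∧
      (∀ β ∈ Metric.ball (circleCurve (n + 1 + ℓ + 2) R) ρ, ∀ (σ : Ck (n + 1 + ℓ + 2) Plane)
        (s : ℝ), (∀ φ, inner ℝ (deriv σ φ) (deriv β φ) = s) → σ 0 = 0 → deriv σ 0 0 = 0 →
        c * ‖Ck.incl h σ‖ ≤ ‖fderiv ℝ I (circleCurve (n + 1 + ℓ + 2) R) σ‖) ∧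
      ∀ γ ∈ Metric.ball (circleCurve (n + 1 + ℓ + 2) R) ρ, ∀ σ,
        ‖fderiv ℝ I γ σ - fderiv ℝ I (circleCurve (n + 1 + ℓ + 2) R) σ‖ ≤
          c / 2 * ‖Ck.incl h σ‖ := by
  have hR0 : 0 < R := by linarith
  obtain ⟨θ, hθ0, hθπ, hrθ⟩ := exists_chord_angle hr hR
  set m := n + 1 + ℓ with hm
  set α := θ / 2 with hα
  set β := (θ + Real.pi) / 2 with hβ
  have hα0 : 0 < α := by positivity
  have hβπ : β < Real.pi := by linarith
  obtain ⟨ρ₀, hρ₀, hnear⟩ := Metric.eventually_nhds_iff_ball.1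
    (eventually_isNearCircle m hR0 hrθ hα0 (by linarith) (show θ < β by linarith) hβπ)
  set γ₀ := circleCurve (m + 2) R with hγ₀
  set U := Metric.ball γ₀ ρ₀ with hUdef
  have hU : IsOpen U := Metric.isOpen_ball
  have hγ₀U : γ₀ ∈ U := Metric.mem_ball_self hρ₀
  obtain ⟨a, b, ha, hb, hap, hbp, hroot⟩ :=
    exists_chordRoots hr hα0 (show α < β by linarith) hβπ hU hnear
  have hk : n + 1 ≤ m + 1 := by omega
  set I : Ck (m + 2) Plane → Ck (n + 1) ℝ :=
    fun γ => Ck.ofFun (n + 1) fun φ => diskArea r a b (γ, φ) with hI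
  have hG : ContDiffOn ℝ (n + 1 + (ℓ + 1) : ℕ) (diskArea r a b) (U ×ˢ univ) :=
    contDiffOn_diskArea hr hβπ ha hb hroot
  have hper : ∀ γ ∈ U, Function.Periodic (fun φ => diskArea r a b (γ, φ)) (2 * Real.pi) :=
    fun γ hγ => periodic_diskArea (hap γ hγ) (hbp γ hγ)
  have hder : ∀ γ ∈ U, ∀ σ, fderiv ℝ I γ σ = variation hk a b γ (Ck.incl h σ) := by
    intro γ hγ σ
    rw [(hasFDerivAt_ofFun_section hU (k := n + 1) (hG.of_le (by norm_cast; omega)) hper hγ).fderiv]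
    refine Ck.ext fun φ => ?_
    have hG1 : ContDiffOn ℝ (n + 1 + 1 : ℕ) (diskArea r a b) (U ×ˢ univ) :=
      hG.of_le (by norm_cast; omega)
    rw [Ck.flipL_apply, Ck.coe_ofFun_section (hG1.partialFst hU)
      (fun γ hγ => periodic_partialFst hU hper hγ) hγ, variation_apply hk ha hb hap hbp hγ]
    exact fderiv_diskArea hr hα0 hβπ hU ha hb hroot hγ φ σ
  obtain ⟨C, hC, δ, hδ, hbound⟩ := exists_norm_le_circleVariation n (m + 2) hR0 hθ0 hθπ
  obtain ⟨ρ₁, hρ₁, hsmall⟩ := Metric.eventually_nhds_iff_ball.1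
    (eventually_norm_variation_sub_le hk hU ha hb hap hbp hγ₀U (show 0 < C⁻¹ / 2 by positivity))
  refine ⟨min ρ₀ (min ρ₁ δ), by positivity, C⁻¹, by positivity, I, ?_, ?_, ?_, ?_⟩
  · intro γ hγ φ
    have hγU : γ ∈ U := Metric.ball_subset_ball (min_le_left _ _) hγ
    rw [hI, Ck.coe_ofFun_section (hG.of_le (by norm_cast)) hper hγU]
    exact (circularInvariant_eq_diskArea (hnear γ hγU).isConvexCurve hr hα0 hβπ
      (hroot γ hγU φ)).symm
  · exact (contDiffOn_ofFun_section hU hG hper).mono (Metric.ball_subset_ball (min_le_left _ _))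
  · intro κ hκ σ s hs hσ0 hσ1
    rw [hder γ₀ hγ₀U, inv_mul_le_iff₀ hC]
    refine hbound (Ck.incl h κ) (Ck.incl h σ) _ s ?_ hs hσ0 hσ1 fun φ => ?_
    · have h1 := Ck.norm_incl_le h (γ₀ - κ)
      rw [Metric.mem_ball, dist_comm, dist_eq_norm] at hκ
      exact h1.trans (hκ.le.trans ((min_le_right _ _).trans (min_le_right _ _)))
    · obtain ⟨e1, e2⟩ := (hroot γ₀ hγ₀U φ).eq_of_circleCurve hR0 hrθ hα0 hβπ ⟨hθ0.le, hθπ.le⟩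
      rw [variation_apply hk ha hb hap hbp hγ₀U, e1, e2]
  · intro γ hγ σ
    rw [hder γ (Metric.ball_subset_ball (min_le_left _ _) hγ), hder γ₀ hγ₀U]
    exact hsmall γ (Metric.ball_subset_ball ((min_le_right _ _).trans (min_le_left _ _)) hγ) _

theorem deriv_coord_zero_of_inner {v : Plane} (h : inner ℝ v (!₂[1, 0] : Plane) = 0) : v 0 = 0 := by
  rw [inner_plane] at h
  simpa using h

/-- A lower bound for differences of a map from lower bounds for its derivative in one direction. -/
theorem mul_le_norm_image_sub {X Y : Type*} [NormedAddCommGroup X] [NormedSpace ℝ X]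
    [NormedAddCommGroup Y] [NormedSpace ℝ Y] {I : X → Y} {V : Set X} (hV : Convex ℝ V)
    (hI : ∀ x ∈ V, DifferentiableAt ℝ I x) {D : X →L[ℝ] Y} {x y : X} (hx : x ∈ V) (hy : y ∈ V)
    {A B : ℝ} (hA : A ≤ ‖D (x - y)‖)
    (hB : ∀ z ∈ V, ‖fderiv ℝ I z (x - y) - D (x - y)‖ ≤ B) : A - B ≤ ‖I x - I y‖ := by
  set σ := x - y with hσ
  have hmem : ∀ t ∈ Icc (0 : ℝ) 1, y + t • σ ∈ V := fun t ht =>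
    hV.add_smul_sub_mem hy hx ht
  have hd : ∀ t ∈ Icc (0 : ℝ) 1, HasDerivWithinAt (fun t : ℝ => I (y + t • σ) - t • D σ)
      (fderiv ℝ I (y + t • σ) σ - D σ) (Icc 0 1) t := by
    intro t ht
    have h1 : HasDerivAt (fun t : ℝ => y + t • σ) σ t := by
      simpa using ((hasDerivAt_id t).smul_const σ).const_add y
    have h2 := (hI _ (hmem t ht)).hasFDerivAt.comp_hasDerivAt t h1
    have h3 := h2.sub ((hasDerivAt_id t).smul_const (D σ))
    rw [one_smul] at h3
    exact h3.hasDerivWithinAt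
  have h1 := norm_image_sub_le_of_norm_deriv_le_segment_01' hd
    (fun t ht => hB _ (hmem t ⟨ht.1, ht.2.le⟩))
  simp only [one_smul, zero_smul, add_zero, sub_zero] at h1
  rw [show y + σ = x by rw [hσ]; abel] at h1
  have h2 : ‖D σ‖ ≤ ‖I x - I y‖ + ‖I x - D σ - I y‖ := by
    refine le_trans (le_of_eq ?_) (norm_sub_le (I x - I y) (I x - D σ - I y))
    congr 1
    abel
  linarith

theorem mainTheorem1 (k : ℕ) (hk : 1 ≤ k) (r R : ℝ) (hr : 0 < r) (hR : r / 2 < R) :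
    (∀ ℓ : ℕ, 1 ≤ ℓ →
      ∃ (V : Set (Ck (k + ℓ + 1) Plane)) (I : Ck (k + ℓ + 1) Plane → Ck k ℝ),
        IsOpen V ∧ circleCurve (k + ℓ + 1) R ∈ V ∧
        (∀ γ ∈ V, ∀ φ, I γ φ = circularInvariant r γ φ) ∧
        ContDiffOn ℝ ℓ I V ∧
        ∀ γ ∈ V ∩ normalizedCurves (k + ℓ + 1),
          Set.InjOn (fderiv ℝ I γ) (curveTangentSpace γ)) ∧
    ∃ (W : Set (Ck (k + 6) Plane)) (I : Ck (k + 6) Plane → Ck k ℝ) (c : ℝ),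
      IsOpen W ∧ circleCurve (k + 6) R ∈ W ∧ 0 < c ∧
      (∀ γ ∈ W, ∀ φ, I γ φ = circularInvariant r γ φ) ∧
      (∀ γ ∈ W ∩ normalizedCurves (k + 6), ∀ γ' ∈ W ∩ normalizedCurves (k + 6),
        c * ‖Ck.incl (Nat.le_add_right k 6) γ - Ck.incl (Nat.le_add_right k 6) γ'‖
          ≤ ‖I γ - I γ'‖) ∧
      Set.InjOn (fun γ : Ck (k + 6) Plane => circularInvariant r γ)
        (W ∩ normalizedCurves (k + 6)) := by
  obtain ⟨n, rfl⟩ : ∃ n, k = n + 1 := ⟨k - 1, by omega⟩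
  refine ⟨fun ℓ hℓ => ?_, ?_⟩
  · obtain ⟨ℓ, rfl⟩ : ∃ j, ℓ = j + 1 := ⟨ℓ - 1, by omega⟩
    obtain ⟨ρ, hρ, c, hc, I, hI, hcd, hlow, hdiff⟩ :=
      exists_circularInvariant_map n ℓ hr hR (by omega)
    refine ⟨Metric.ball (circleCurve (n + 1 + ℓ + 2) R) ρ, I, Metric.isOpen_ball,
      Metric.mem_ball_self hρ, hI, hcd, fun γ hγ => ?_⟩
    obtain ⟨hγV, ⟨s, -, -, hγ0, -⟩, -⟩ := hγ
    have hker : ∀ σ ∈ curveTangentSpace γ, fderiv ℝ I γ σ = 0 → σ = 0 := by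
      rintro σ ⟨⟨t, ht⟩, hσ0, hσ1⟩ h0
      rw [hγ0] at hσ1
      have h1 := hlow γ hγV σ t ht hσ0 (deriv_coord_zero_of_inner hσ1)
      have h2 := hdiff γ hγV σ
      rw [h0, zero_sub, norm_neg] at h2
      have h3 : ‖Ck.incl (show n + 1 ≤ n + 1 + ℓ + 2 by omega) σ‖ = 0 := by
        refine le_antisymm ?_ (norm_nonneg _)
        by_contra hne
        nlinarith
      have h4 := norm_eq_zero.1 h3
      exact Ck.ext fun x => congrArg (fun f : Ck (n + 1) Plane => f x) h4
    intro σ hσ τ hτ hστ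
    refine sub_eq_zero.1 (hker _ (Submodule.sub_mem _ hσ hτ) ?_)
    rw [map_sub, sub_eq_zero]
    exact hστ
  · obtain ⟨ρ, hρ, c, hc, I, hI, hcd, hlow, hdiff⟩ :=
      exists_circularInvariant_map n 4 hr hR (by omega)
    have hest : ∀ γ ∈ Metric.ball (circleCurve (n + 1 + 6) R) ρ ∩ normalizedCurves (n + 1 + 6),
        ∀ γ' ∈ Metric.ball (circleCurve (n + 1 + 6) R) ρ ∩ normalizedCurves (n + 1 + 6),
        c / 2 * ‖Ck.incl (Nat.le_add_right (n + 1) 6) γ -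
          Ck.incl (Nat.le_add_right (n + 1) 6) γ'‖ ≤ ‖I γ - I γ'‖ := by
      rintro γ ⟨hγ, ⟨s, -, hs, hγ0, hγ1⟩, -⟩ γ' ⟨hγ', ⟨s', -, hs', hγ0', hγ1'⟩, -⟩
      have hdσ : ∀ φ, deriv (γ - γ' : Ck (n + 1 + 6) Plane) φ = deriv γ φ - deriv γ' φ := fun φ =>
        ((γ.hasDerivAt φ).sub (γ'.hasDerivAt φ)).deriv
      have hdβ : ∀ φ, deriv (γ' + (1 / 2 : ℝ) • (γ - γ') : Ck (n + 1 + 6) Plane) φ =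
          deriv γ' φ + (1 / 2 : ℝ) • (deriv γ φ - deriv γ' φ) := fun φ =>
        ((γ'.hasDerivAt φ).add
          (((γ.hasDerivAt φ).sub (γ'.hasDerivAt φ)).const_smul (1 / 2 : ℝ))).deriv
      have h1 := hlow (γ' + (1 / 2 : ℝ) • (γ - γ'))
        ((convex_ball _ _).add_smul_sub_mem hγ' hγ ⟨by norm_num, by norm_num⟩) (γ - γ')
        ((s ^ 2 - s' ^ 2) / 2) (fun φ => by
          rw [hdσ, hdβ, ← hs φ, ← hs' φ, norm_sq_plane, norm_sq_plane, inner_plane]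
          simp
          ring)
        (by rw [Ck.sub_apply, hγ0, hγ0', sub_self]) (by rw [hdσ, hγ1, hγ1']; simp)
      have h2 := mul_le_norm_image_sub (convex_ball (circleCurve (n + 1 + 6) R) ρ)
        (fun z hz => ((hcd z hz).contDiffAt (Metric.isOpen_ball.mem_nhds hz)).differentiableAt
          (by simp)) hγ hγ' h1 (fun z hz => hdiff z hz (γ - γ'))
      refine le_trans (le_of_eq ?_) h2
      change _ = c * ‖Ck.incl (Nat.le_add_right (n + 1) 6) γ -
          Ck.incl (Nat.le_add_right (n + 1) 6) γ'‖ - c / 2 *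
          ‖Ck.incl (Nat.le_add_right (n + 1) 6) γ - Ck.incl (Nat.le_add_right (n + 1) 6) γ'‖
      ring
    refine ⟨Metric.ball (circleCurve (n + 1 + 6) R) ρ, I, c / 2, Metric.isOpen_ball,
      Metric.mem_ball_self hρ, by positivity, hI, hest, fun γ hγ γ' hγ' heq => ?_⟩
    have h1 := hest γ hγ γ' hγ'
    have h2 : I γ = I γ' := Ck.ext fun φ => by
      rw [hI γ hγ.1, hI γ' hγ'.1]
      exact congrFun heq φ
    rw [h2, sub_self, norm_zero] at h1
    have h3 : ‖Ck.incl (Nat.le_add_right (n + 1) 6) γ -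
        Ck.incl (Nat.le_add_right (n + 1) 6) γ'‖ = 0 := by
      refine le_antisymm ?_ (norm_nonneg _)
      by_contra hne
      nlinarith
    have h4 := sub_eq_zero.1 (norm_eq_zero.1 h3)
    exact Ck.ext fun x => congrArg (fun f : Ck (n + 1) Plane => f x) h4
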